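/- Let $m,n\ge 0$ be integers, let $A_{m,n}=\mathbb{C}[t_1,\dots,t_m]\otimes\Lambda(\xi_1,\dots,\xi_n)$ be the supercommutative superalgebra in the even variables $t_1,\dots,t_m$ and the odd variables $\xi_1,\dots,\xi_n$, and let $W_{m,n}$ be the Lie superalgebra of all superderivations of $A_{m,n}$. Let $\triangle_{m,n}=\operatorname{Span}\{\frac{\partial}{\partial t_i},\frac{\partial}{\partial \xi_k}:1\le i\le m,\ 1\le k\le n\}\subset W_{m,n}$. Write $e_1,\dots,e_m$ for the standard basis of $\mathbb{Z}^m$, and for $I=\{i_1<\dots<i_k\}\subseteq\{1,\dots,n\}$ put $\xi_I=\xi_{i_1}\cdots\xi_{i_k}$. For $\alpha,\beta\in\mathbb{Z}_{\ge 0}^m$, $I,J\subseteq\{1,\dots,n\}$, $r\in\mathbb{Z}_{\ge0}$, $1\le j\le m$ and $\partial,\partial'\in\triangle_{m,n}$, define the following element of the universal enveloping algebra $\mathcal{U}(W_{m,n})$: $$w^{r,j,\partial,\partial'}_{\alpha,\beta,I,J}=\sum_{i=0}^{r}(-1)^i\binom{r}{i}\,t^{\alpha+(r-i)e_j}\xi_I\partial\cdot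 t^{\beta+ie_j}\xi_J\partial'.$$ A ($\mathbb{Z}_2$-graded) $W_{m,n}$-module $M$ over $\mathbb{C}$ is called a weight module if $M=\bigoplus_{\lambda\in\mathbb{C}^m}M_\lambda$, where $M_\lambda=\{v\in M: t_i\frac{\partial}{\partial t_i}v=\lambda_iv,\ 1\le i\le m\}$; it is called uniformly bounded if it is a weight module and there is $N\in\mathbb{N}$ with $\dim M_\lambda\le N$ for all $\lambda\in\mathbb{C}^m$. **Theorem 5.4.** Let $M$ be a uniformly bounded $W_{m,n}$-module. Then there exists $r\in\mathbb{N}$ such that $$w^{r,j,\partial,\partial'}_{\alpha,\beta,I,J}\,M=0$$ for all $\alpha,\beta\in\mathbb{Z}_{\ge0}^m$, all $I,J\subseteq\{1,\dots,n\}$, all $1\le j\le m$ and all $\partial,\partial'\in\triangle_{m,n}$. -/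

import Mathlib

open scoped TensorProduct

noncomputable section

namespace WittSuper

/-! ### The supercommutative algebra of polynomials in even and odd variables -/

/-- The Koszul sign `(-1)^{ij}` attached to two parities. -/
def sgn (i j : ZMod 2) : ℂ := (-1) ^ (i.val * j.val)

/-- The exterior algebra on `n` generators. -/
abbrev Ext (n : ℕ) : Type := ExteriorAlgebra ℂ (Fin n → ℂ)

/-- The even (`i = 0`) and odd (`i = 1`) part of the exterior algebra. -/
abbrev extParity (n : ℕ) (i : ZMod 2) : Submodule ℂ (Ext n) :=
  CliffordAlgebra.evenOdd (0 : QuadraticForm ℂ (Fin n → ℂ)) i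

/-- The odd generator `ξ_j` of the exterior algebra. -/
def extGen (n : ℕ) (j : Fin n) : Ext n := ExteriorAlgebra.ι ℂ (Pi.single j 1)

/-- `A_{m,n} = ℂ[t_1, …, t_m] ⊗ Λ(ξ_1, …, ξ_n)`. All polynomials are even, so the sign rule in
the product of the tensor product of superalgebras is void and this is the ordinary tensor
product of algebras. -/
abbrev A (m n : ℕ) : Type := MvPolynomial (Fin m) ℂ ⊗[ℂ] Ext n

/-- The even and odd part of `A_{m,n}`. -/
def parity (m n : ℕ) (i : ZMod 2) : Submodule ℂ (A m n) :=
  Submodule.span ℂ {a | ∃ p : MvPolynomial (Fin m) ℂ, ∃ x ∈ extParity n i, a = p ⊗ₜ[ℂ] x}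

/-- The monomial `t^α ξ_I`, where `ξ_I` is the product of the `ξ_i`, `i ∈ I`, in increasing
order. -/
def mono {m n : ℕ} (α : Fin m →₀ ℕ) (I : Finset (Fin n)) : A m n :=
  MvPolynomial.monomial α (1 : ℂ) ⊗ₜ[ℂ] ((I.sort (· ≤ ·)).map (extGen n)).prod

/-! ### Superderivations -/

/-- The space of superderivations of `A_{m,n}` that are homogeneous of parity `i`. -/
def superDer (m n : ℕ) (i : ZMod 2) : Submodule ℂ (Module.End ℂ (A m n)) where
  carrier := {D | (∀ j, ∀ a ∈ parity m n j, D a ∈ parity m n (i + j)) ∧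
    ∀ j, ∀ a ∈ parity m n j, ∀ b, D (a * b) = D a * b + sgn i j • (a * D b)}
  add_mem' := by
    rintro D E ⟨hD, hD'⟩ ⟨hE, hE'⟩
    refine ⟨fun j a ha => add_mem (hD j a ha) (hE j a ha), fun j a ha b => ?_⟩
    simp only [LinearMap.add_apply, hD' j a ha b, hE' j a ha b, add_mul, mul_add, smul_add]
    abel
  zero_mem' := ⟨fun j a _ => by simp, fun j a _ b => by simp⟩
  smul_mem' := by
    rintro c D ⟨hD, hD'⟩
    refine ⟨fun j a ha => Submodule.smul_mem _ c (hD j a ha), fun j a ha b => ?_⟩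
    simp only [LinearMap.smul_apply, hD' j a ha b, smul_add, smul_mul_assoc, mul_smul_comm]
    rw [smul_comm]

/-- The Witt superalgebra `W_{m,n}` of all superderivations of `A_{m,n}`. -/
def W (m n : ℕ) : Submodule ℂ (Module.End ℂ (A m n)) := superDer m n 0 ⊔ superDer m n 1

theorem superDer_le (m n : ℕ) (i : ZMod 2) : superDer m n i ≤ W m n := by
  fin_cases i
  · exact le_sup_left
  · exact le_sup_right

/-- The homogeneous component of parity `i` of `W_{m,n}`. -/
def homog (m n : ℕ) (i : ZMod 2) : Submodule ℂ (W m n) := (superDer m n i).comap (W m n).subtype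

theorem eq_zero_or_one (i : ZMod 2) : i = 0 ∨ i = 1 := by
  fin_cases i
  · exact Or.inl rfl
  · exact Or.inr rfl

theorem sgn_add_left (i k j : ZMod 2) : sgn (i + k) j = sgn i j * sgn k j := by
  rcases eq_zero_or_one i with rfl | rfl <;> rcases eq_zero_or_one k with rfl | rfl <;>
    rcases eq_zero_or_one j with rfl | rfl <;>
    simp [sgn, ZMod.val_one, show (1 + 1 : ZMod 2) = 0 from rfl]

theorem sgn_comm (i j : ZMod 2) : sgn i j = sgn j i := by simp only [sgn, Nat.mul_comm]

theorem sgn_add_right (i k j : ZMod 2) : sgn i (k + j) = sgn i k * sgn i j := by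
  rw [sgn_comm, sgn_add_left, sgn_comm k, sgn_comm j]

theorem sgn_mul_self (i j : ZMod 2) : sgn i j * sgn i j = 1 := by
  rcases eq_zero_or_one i with rfl | rfl <;> rcases eq_zero_or_one j with rfl | rfl <;>
    norm_num [sgn, ZMod.val_one]

/-- The super commutator of homogeneous superderivations is a superderivation. -/
theorem superComm_mem {m n : ℕ} {i j : ZMod 2} {D E : Module.End ℂ (A m n)}
    (hD : D ∈ superDer m n i) (hE : E ∈ superDer m n j) :
    D * E - sgn i j • (E * D) ∈ superDer m n (i + j) := by
  obtain ⟨hD, hD'⟩ := hD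
  obtain ⟨hE, hE'⟩ := hE
  refine ⟨fun k a ha => ?_, fun k a ha b => ?_⟩
  · refine sub_mem ?_ (Submodule.smul_mem _ _ ?_)
    · simpa [add_assoc] using hD _ _ (hE _ _ ha)
    · have := hE _ _ (hD _ _ ha)
      rwa [← add_assoc, add_comm j i] at this
  · simp only [LinearMap.sub_apply, LinearMap.smul_apply, Module.End.mul_apply]
    rw [hE' k a ha b, hD' k a ha b]
    simp only [map_add, map_smul]
    rw [hD' _ _ (hE k a ha) b, hD' _ _ ha, hE' _ _ (hD k a ha) b, hE' _ _ ha]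
    simp only [sgn_add_right, sgn_add_left, sub_mul, mul_sub, smul_add, smul_sub, smul_smul,
      smul_mul_assoc, mul_smul_comm, sgn_comm j i]
    have h1 := sgn_mul_self i j
    match_scalars <;> first | ring1 | linear_combination -sgn j k * h1

/-- The Lie superbracket `[x, y] = xy - (-1)^{ij} yx` of homogeneous `x, y ∈ W_{m,n}` of parities
`i` and `j`. -/
def bracket {m n : ℕ} {i j : ZMod 2} (x : homog m n i) (y : homog m n j) : homog m n (i + j) :=
  ⟨⟨x.1.1 * y.1.1 - sgn i j • (y.1.1 * x.1.1), superDer_le m n _ (superComm_mem x.2 y.2)⟩,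
    superComm_mem x.2 y.2⟩

/-! ### Multiplication of superderivations by elements of `A_{m,n}` -/

theorem ext_ι_mul {n : ℕ} (v : Fin n → ℂ) {j : ZMod 2} {y : Ext n} (hy : y ∈ extParity n j) :
    ExteriorAlgebra.ι ℂ v * y = sgn 1 j • (y * ExteriorAlgebra.ι ℂ v) := by
  have key : ∀ a b : Fin n → ℂ, ExteriorAlgebra.ι ℂ a * ExteriorAlgebra.ι ℂ b =
      -(ExteriorAlgebra.ι ℂ b * ExteriorAlgebra.ι ℂ a) := fun a b =>
    eq_neg_of_add_eq_zero_left (ExteriorAlgebra.ι_add_mul_swap a b)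
  have step : ∀ (a b : Fin n → ℂ) (x : Ext n),
      ExteriorAlgebra.ι ℂ v * x = sgn 1 j • (x * ExteriorAlgebra.ι ℂ v) →
      ExteriorAlgebra.ι ℂ v * (ExteriorAlgebra.ι ℂ a * ExteriorAlgebra.ι ℂ b * x) =
        sgn 1 j • (ExteriorAlgebra.ι ℂ a * ExteriorAlgebra.ι ℂ b * x * ExteriorAlgebra.ι ℂ v) := by
    intro a b x hx
    rw [← mul_assoc, ← mul_assoc, key v a, neg_mul, mul_assoc (ExteriorAlgebra.ι ℂ a), key v b,
      mul_neg, neg_neg, mul_assoc, mul_assoc, hx, mul_smul_comm, mul_smul_comm]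
    simp only [mul_assoc]
  rcases eq_zero_or_one j with rfl | rfl
  · induction y, hy using CliffordAlgebra.even_induction with
    | algebraMap r => simp [sgn, Algebra.commutes]
    | add x y _ _ hx hy => rw [mul_add, add_mul, smul_add, hx, hy]
    | ι_mul_ι_mul a b x _ hx => exact step a b x hx
  · induction y, hy using CliffordAlgebra.odd_induction with
    | ι b => simpa [sgn, ZMod.val_one] using key v b
    | add x y _ _ hx hy => rw [mul_add, add_mul, smul_add, hx, hy]
    | ι_mul_ι_mul a b x _ hx => exact step a b x hx

theorem ext_super_comm {n : ℕ} {i j : ZMod 2} {x y : Ext n} (hx : x ∈ extParity n i)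
    (hy : y ∈ extParity n j) : x * y = sgn i j • (y * x) := by
  have step : ∀ (a b : Fin n → ℂ) (x : Ext n), x * y = sgn i j • (y * x) →
      ExteriorAlgebra.ι ℂ a * ExteriorAlgebra.ι ℂ b * x * y =
        sgn i j • (y * (ExteriorAlgebra.ι ℂ a * ExteriorAlgebra.ι ℂ b * x)) := by
    intro a b x h
    rw [mul_assoc, h, mul_smul_comm, ← mul_assoc, mul_assoc _ _ y, ext_ι_mul b hy, mul_smul_comm,
      ← mul_assoc, ext_ι_mul a hy]
    simp only [smul_mul_assoc, smul_smul, mul_assoc, sgn_mul_self, mul_one]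
  rcases eq_zero_or_one i with rfl | rfl
  · induction x, hx using CliffordAlgebra.even_induction with
    | algebraMap r => simp [sgn, Algebra.commutes]
    | add x z _ _ hx hz => rw [mul_add, add_mul, smul_add, hx, hz]
    | ι_mul_ι_mul a b x _ hx => exact step a b x hx
  · induction x, hx using CliffordAlgebra.odd_induction with
    | ι b => exact ext_ι_mul b hy
    | add x z _ _ hx hz => rw [mul_add, add_mul, smul_add, hx, hz]
    | ι_mul_ι_mul a b x _ hx => exact step a b x hx

theorem super_comm {m n : ℕ} {i j : ZMod 2} {a b : A m n} (ha : a ∈ parity m n i)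
    (hb : b ∈ parity m n j) : a * b = sgn i j • (b * a) := by
  induction ha using Submodule.span_induction with
  | mem a ha =>
    obtain ⟨p, x, hx, rfl⟩ := ha
    induction hb using Submodule.span_induction with
    | mem b hb =>
      obtain ⟨q, y, hy, rfl⟩ := hb
      rw [Algebra.TensorProduct.tmul_mul_tmul, Algebra.TensorProduct.tmul_mul_tmul,
        ext_super_comm hx hy, mul_comm p q, TensorProduct.tmul_smul]
    | zero => simp
    | add b c _ _ hb hc => rw [mul_add, add_mul, smul_add, hb, hc]
    | smul c b _ hb => rw [mul_smul_comm, smul_mul_assoc, hb, smul_comm]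
  | zero => simp
  | add b c _ _ hb hc => rw [mul_add, add_mul, smul_add, hb, hc]
  | smul c b _ hb => rw [mul_smul_comm, smul_mul_assoc, hb, smul_comm]

theorem parity_mul {m n : ℕ} {i j : ZMod 2} {a b : A m n} (ha : a ∈ parity m n i)
    (hb : b ∈ parity m n j) : a * b ∈ parity m n (i + j) := by
  induction ha using Submodule.span_induction with
  | mem a ha =>
    obtain ⟨p, x, hx, rfl⟩ := ha
    induction hb using Submodule.span_induction with
    | mem b hb =>
      obtain ⟨q, y, hy, rfl⟩ := hb
      exact Submodule.subset_span ⟨p * q, x * y, SetLike.mul_mem_graded hx hy,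
        Algebra.TensorProduct.tmul_mul_tmul _ _ _ _⟩
    | zero => simp
    | add b c _ _ hb hc => rw [mul_add]; exact add_mem hb hc
    | smul c b _ hb => rw [mul_smul_comm]; exact Submodule.smul_mem _ _ hb
  | zero => simp
  | add b c _ _ hb hc => rw [add_mul]; exact add_mem hb hc
  | smul c b _ hb => rw [smul_mul_assoc]; exact Submodule.smul_mem _ _ hb

theorem parity_sup (m n : ℕ) : parity m n 0 ⊔ parity m n 1 = ⊤ := by
  rw [eq_top_iff, ← TensorProduct.span_tmul_eq_top, Submodule.span_le]
  rintro _ ⟨p, x, rfl⟩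
  have hx : x ∈ extParity n 0 ⊔ extParity n 1 := by
    rw [(CliffordAlgebra.evenOdd_isCompl (0 : QuadraticForm ℂ (Fin n → ℂ))).sup_eq_top]
    trivial
  obtain ⟨y, hy, z, hz, rfl⟩ := Submodule.mem_sup.1 hx
  rw [TensorProduct.tmul_add]
  exact Submodule.add_mem_sup (Submodule.subset_span ⟨p, y, hy, rfl⟩)
    (Submodule.subset_span ⟨p, z, hz, rfl⟩)

theorem mulLeft_mem_superDer {m n : ℕ} {k i : ZMod 2} {a : A m n} (ha : a ∈ parity m n k)
    {D : Module.End ℂ (A m n)} (hD : D ∈ superDer m n i) :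
    LinearMap.mulLeft ℂ a * D ∈ superDer m n (k + i) := by
  refine ⟨fun j b hb => ?_, fun j b hb c => ?_⟩
  · rw [add_assoc]
    exact parity_mul ha (hD.1 j b hb)
  · simp only [Module.End.mul_apply, LinearMap.mulLeft_apply]
    rw [hD.2 j b hb c, mul_add, mul_smul_comm, ← mul_assoc a b, super_comm ha hb, sgn_add_left,
      smul_mul_assoc, smul_smul, mul_assoc, mul_assoc, mul_comm (sgn i j)]

theorem mulLeft_mem_W {m n : ℕ} (a : A m n) {D : Module.End ℂ (A m n)} (hD : D ∈ W m n) :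
    LinearMap.mulLeft ℂ a * D ∈ W m n := by
  have ha : a ∈ parity m n 0 ⊔ parity m n 1 := by rw [parity_sup]; trivial
  obtain ⟨b, hb, c, hc, rfl⟩ := Submodule.mem_sup.1 ha
  obtain ⟨E, hE, F, hF, rfl⟩ := Submodule.mem_sup.1 hD
  have e : LinearMap.mulLeft ℂ (b + c) = LinearMap.mulLeft ℂ b + LinearMap.mulLeft ℂ c := by
    refine LinearMap.ext fun x => ?_
    simp [add_mul]
  rw [e, add_mul, mul_add, mul_add]
  exact add_mem
    (add_mem (superDer_le _ _ _ (mulLeft_mem_superDer hb hE))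
      (superDer_le _ _ _ (mulLeft_mem_superDer hb hF)))
    (add_mem (superDer_le _ _ _ (mulLeft_mem_superDer hc hE))
      (superDer_le _ _ _ (mulLeft_mem_superDer hc hF)))

/-- The product `a x ∈ W_{m,n}` of `a ∈ A_{m,n}` and a superderivation `x`:
`(a x)(b) = a · x(b)`. -/
def fieldMul {m n : ℕ} (a : A m n) (x : W m n) : W m n :=
  ⟨LinearMap.mulLeft ℂ a * x.1, mulLeft_mem_W a x.2⟩

/-! ### Partial derivatives -/

/-- `∂/∂ξ_j` on the exterior algebra: the contraction with the `j`-th coordinate form. -/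
def extDeriv (n : ℕ) (j : Fin n) : Module.End ℂ (Ext n) :=
  CliffordAlgebra.contractLeft (Q := (0 : QuadraticForm ℂ (Fin n → ℂ)))
    (LinearMap.proj j : (Fin n → ℂ) →ₗ[ℂ] ℂ)

theorem extDeriv_ι_mul {n : ℕ} (j : Fin n) (a : Fin n → ℂ) (x : Ext n) :
    extDeriv n j (ExteriorAlgebra.ι ℂ a * x) =
      a j • x - ExteriorAlgebra.ι ℂ a * extDeriv n j x :=
  CliffordAlgebra.contractLeft_ι_mul _ a x

theorem extDeriv_algebraMap {n : ℕ} (j : Fin n) (c : ℂ) :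
    extDeriv n j (algebraMap ℂ (Ext n) c) = 0 :=
  CliffordAlgebra.contractLeft_algebraMap _ _ c

theorem extDeriv_ι {n : ℕ} (j : Fin n) (a : Fin n → ℂ) :
    extDeriv n j (ExteriorAlgebra.ι ℂ a) = algebraMap ℂ (Ext n) (a j) :=
  CliffordAlgebra.contractLeft_ι _ _ a

theorem ι_mem_extParity {n : ℕ} (a : Fin n → ℂ) : ExteriorAlgebra.ι ℂ a ∈ extParity n 1 :=
  CliffordAlgebra.ι_mem_evenOdd_one _ a

theorem extDeriv_mem {n : ℕ} (j : Fin n) {i : ZMod 2} {x : Ext n} (hx : x ∈ extParity n i) :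
    extDeriv n j x ∈ extParity n (1 + i) := by
  have step : ∀ (a b : Fin n → ℂ) (x : Ext n), x ∈ extParity n i →
      extDeriv n j x ∈ extParity n (1 + i) →
      extDeriv n j (ExteriorAlgebra.ι ℂ a * ExteriorAlgebra.ι ℂ b * x) ∈ extParity n (1 + i) := by
    intro a b x hx h
    rw [mul_assoc, extDeriv_ι_mul, extDeriv_ι_mul, mul_sub, mul_smul_comm]
    refine sub_mem (Submodule.smul_mem _ _ ?_) (sub_mem (Submodule.smul_mem _ _ ?_) ?_)
    · exact SetLike.mul_mem_graded (ι_mem_extParity b) hx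
    · exact SetLike.mul_mem_graded (ι_mem_extParity a) hx
    · have := SetLike.mul_mem_graded (ι_mem_extParity a)
        (SetLike.mul_mem_graded (ι_mem_extParity b) h)
      rwa [← add_assoc (1 : ZMod 2) 1, show (1 + 1 : ZMod 2) = 0 from rfl, zero_add] at this
  rcases eq_zero_or_one i with rfl | rfl
  · induction x, hx using CliffordAlgebra.even_induction with
    | algebraMap r => exact (extDeriv_algebraMap j r).symm ▸ zero_mem _
    | add x y _ _ hx hy => rw [map_add]; exact add_mem hx hy
    | ι_mul_ι_mul a b x hx' hx => exact step a b x hx' hx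
  · induction x, hx using CliffordAlgebra.odd_induction with
    | ι b =>
      exact (extDeriv_ι j b).symm ▸ SetLike.algebraMap_mem_graded
        (CliffordAlgebra.evenOdd (0 : QuadraticForm ℂ (Fin n → ℂ))) (b j)
    | add x y _ _ hx hy => rw [map_add]; exact add_mem hx hy
    | ι_mul_ι_mul a b x hx' hx => exact step a b x hx' hx

theorem extDeriv_mul {n : ℕ} (j : Fin n) {i : ZMod 2} {x : Ext n} (hx : x ∈ extParity n i)
    (y : Ext n) :
    extDeriv n j (x * y) = extDeriv n j x * y + sgn 1 i • (x * extDeriv n j y) := by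
  have step : ∀ (a b : Fin n → ℂ) (x : Ext n),
      extDeriv n j (x * y) = extDeriv n j x * y + sgn 1 i • (x * extDeriv n j y) →
      extDeriv n j (ExteriorAlgebra.ι ℂ a * ExteriorAlgebra.ι ℂ b * x * y) =
        extDeriv n j (ExteriorAlgebra.ι ℂ a * ExteriorAlgebra.ι ℂ b * x) * y +
          sgn 1 i • (ExteriorAlgebra.ι ℂ a * ExteriorAlgebra.ι ℂ b * x * extDeriv n j y) := by
    intro a b x h
    simp only [mul_assoc, extDeriv_ι_mul, h, mul_sub, sub_mul, mul_add, mul_smul_comm,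
      smul_mul_assoc]
    abel
  rcases eq_zero_or_one i with rfl | rfl
  · induction x, hx using CliffordAlgebra.even_induction with
    | algebraMap r =>
      rw [extDeriv_algebraMap, ← Algebra.smul_def, ← Algebra.smul_def]
      simp [sgn]
    | add x z _ _ hx hz => simp only [add_mul, map_add, hx, hz, smul_add]; abel
    | ι_mul_ι_mul a b x _ hx => exact step a b x hx
  · induction x, hx using CliffordAlgebra.odd_induction with
    | ι b =>
      have h1 := extDeriv_ι_mul j b y
      have h2 := extDeriv_ι j b
      change extDeriv n j (ExteriorAlgebra.ι ℂ b * y) =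
        extDeriv n j (ExteriorAlgebra.ι ℂ b) * y +
          sgn 1 1 • (ExteriorAlgebra.ι ℂ b * extDeriv n j y)
      rw [h1, h2, ← Algebra.smul_def]
      simp [sgn, ZMod.val_one, sub_eq_add_neg]
    | add x z _ _ hx hz => simp only [add_mul, map_add, hx, hz, smul_add]; abel
    | ι_mul_ι_mul a b x _ hx => exact step a b x hx

/-- The map `∂/∂t_i` on `A_{m,n}`. -/
def tDeriv (m n : ℕ) (i : Fin m) : Module.End ℂ (A m n) :=
  LinearMap.rTensor (Ext n)
    ((MvPolynomial.pderiv i : Derivation ℂ (MvPolynomial (Fin m) ℂ) (MvPolynomial (Fin m) ℂ)) :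
      MvPolynomial (Fin m) ℂ →ₗ[ℂ] MvPolynomial (Fin m) ℂ)

theorem tDeriv_tmul {m n : ℕ} (i : Fin m) (p : MvPolynomial (Fin m) ℂ) (x : Ext n) :
    tDeriv m n i (p ⊗ₜ[ℂ] x) = MvPolynomial.pderiv i p ⊗ₜ[ℂ] x := rfl

/-- The map `∂/∂ξ_j` on `A_{m,n}`. -/
def xiDeriv (m n : ℕ) (j : Fin n) : Module.End ℂ (A m n) :=
  LinearMap.lTensor (MvPolynomial (Fin m) ℂ) (extDeriv n j)

theorem xiDeriv_tmul {m n : ℕ} (j : Fin n) (p : MvPolynomial (Fin m) ℂ) (x : Ext n) :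
    xiDeriv m n j (p ⊗ₜ[ℂ] x) = p ⊗ₜ[ℂ] extDeriv n j x := rfl

theorem tDeriv_mem (m n : ℕ) (i : Fin m) : tDeriv m n i ∈ superDer m n 0 := by
  refine ⟨fun k a ha => ?_, fun k a ha b => ?_⟩
  · rw [zero_add]
    induction ha using Submodule.span_induction with
    | mem a ha =>
      obtain ⟨p, x, hx, rfl⟩ := ha
      exact Submodule.subset_span ⟨MvPolynomial.pderiv i p, x, hx, rfl⟩
    | zero => simp
    | add b c _ _ hb hc => rw [map_add]; exact add_mem hb hc
    | smul c b _ hb => rw [map_smul]; exact Submodule.smul_mem _ _ hb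
  · have hs : sgn 0 k = 1 := by simp [sgn]
    rw [hs, one_smul]
    clear ha
    induction a using TensorProduct.induction_on with
    | zero => simp
    | add a c ha hc => simp only [add_mul, map_add, ha, hc]; abel
    | tmul p x =>
      induction b using TensorProduct.induction_on with
      | zero => simp
      | add a c ha hc => simp only [mul_add, map_add, ha, hc]; abel
      | tmul q y =>
        simp only [Algebra.TensorProduct.tmul_mul_tmul, tDeriv_tmul, Derivation.leibniz, smul_eq_mul,
          TensorProduct.add_tmul]
        rw [mul_comm q, add_comm]

theorem xiDeriv_mem (m n : ℕ) (j : Fin n) : xiDeriv m n j ∈ superDer m n 1 := by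
  refine ⟨fun k a ha => ?_, fun k a ha b => ?_⟩
  · induction ha using Submodule.span_induction with
    | mem a ha =>
      obtain ⟨p, x, hx, rfl⟩ := ha
      exact Submodule.subset_span ⟨p, extDeriv n j x, extDeriv_mem j hx, rfl⟩
    | zero => simp
    | add b c _ _ hb hc => rw [map_add]; exact add_mem hb hc
    | smul c b _ hb => rw [map_smul]; exact Submodule.smul_mem _ _ hb
  · induction ha using Submodule.span_induction with
    | mem a ha =>
      obtain ⟨p, x, hx, rfl⟩ := ha
      induction b using TensorProduct.induction_on with
      | zero => simp
      | add a c ha hc => simp only [mul_add, map_add, ha, hc, smul_add]; abel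
      | tmul q y =>
        simp only [Algebra.TensorProduct.tmul_mul_tmul, xiDeriv_tmul,
          extDeriv_mul j hx y, TensorProduct.tmul_add, TensorProduct.tmul_smul]
    | zero => simp
    | add b c _ _ hb hc => simp only [add_mul, map_add, hb, hc, smul_add]; abel
    | smul c b _ hb => simp only [smul_mul_assoc, map_smul, hb, smul_add, smul_comm c]

/-- The even superderivation `∂/∂t_i`, as an element of `W_{m,n}`. -/
def dt (m n : ℕ) (i : Fin m) : W m n := ⟨tDeriv m n i, superDer_le m n 0 (tDeriv_mem m n i)⟩

/-- The odd superderivation `∂/∂ξ_j`, as an element of `W_{m,n}`. -/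
def dxi (m n : ℕ) (j : Fin n) : W m n := ⟨xiDeriv m n j, superDer_le m n 1 (xiDeriv_mem m n j)⟩

/-- `△_{m,n}`, the span of all `∂/∂t_i` and `∂/∂ξ_j`. -/
def Delta (m n : ℕ) : Submodule ℂ (W m n) :=
  Submodule.span ℂ (Set.range (dt m n) ∪ Set.range (dxi m n))

/-- The element `t_i ∂/∂t_i` of `W_{m,n}`. -/
def euler (m n : ℕ) (i : Fin m) : W m n := fieldMul (mono (Finsupp.single i 1) ∅) (dt m n i)

/-! ### The universal enveloping algebra -/

/-- The relations `xy = [x, y] + (-1)^{ij} yx`, for homogeneous `x, y` of parities `i, j`. -/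
inductive EnvRel (m n : ℕ) : TensorAlgebra ℂ (W m n) → TensorAlgebra ℂ (W m n) → Prop
  | comm {i j : ZMod 2} (x : homog m n i) (y : homog m n j) :
      EnvRel m n (TensorAlgebra.ι ℂ x.1 * TensorAlgebra.ι ℂ y.1)
        (TensorAlgebra.ι ℂ (bracket x y).1 +
          sgn i j • (TensorAlgebra.ι ℂ y.1 * TensorAlgebra.ι ℂ x.1))

/-- The universal enveloping algebra `U(W_{m,n})` of the Lie superalgebra `W_{m,n}`. -/
abbrev Env (m n : ℕ) : Type := RingQuot (EnvRel m n)

/-- The canonical map `W_{m,n} → U(W_{m,n})`. -/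
def envι (m n : ℕ) : W m n →ₗ[ℂ] Env m n :=
  (RingQuot.mkAlgHom ℂ (EnvRel m n)).toLinearMap ∘ₗ TensorAlgebra.ι ℂ

/-- The element
`∑_{i=0}^r (-1)^i C(r,i) t^{α+(r-i)e_j} ξ_I ∂ · t^{β+i e_j} ξ_J ∂'` of `U(W_{m,n})`. -/
def w {m n : ℕ} (r : ℕ) (j : Fin m) (d d' : W m n) (α β : Fin m →₀ ℕ) (I J : Finset (Fin n)) :
    Env m n :=
  ∑ i ∈ Finset.range (r + 1), ((-1 : ℂ) ^ i * (r.choose i : ℂ)) •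
    (envι m n (fieldMul (mono (α + Finsupp.single j (r - i)) I) d) *
      envι m n (fieldMul (mono (β + Finsupp.single j i) J) d'))

/-! ### Modules -/

/-- A structure of module over the Lie superalgebra `W_{m,n}` on the complex vector space `M`. -/
structure WittModule (m n : ℕ) (M : Type*) [AddCommGroup M] [Module ℂ M] where
  /-- The even and the odd part of `M`. -/
  part : ZMod 2 → Submodule ℂ M
  isInternal : DirectSum.IsInternal part
  /-- The action of `W_{m,n}`. -/
  act : W m n →ₗ[ℂ] Module.End ℂ M
  act_mem : ∀ (i j : ZMod 2) (x : homog m n i), ∀ v ∈ part j, act x.1 v ∈ part (i + j)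
  act_bracket : ∀ (i j : ZMod 2) (x : homog m n i) (y : homog m n j) (v : M),
    act (bracket x y).1 v = act x.1 (act y.1 v) - sgn i j • act y.1 (act x.1 v)

namespace WittModule

variable {m n : ℕ} {M : Type*} [AddCommGroup M] [Module ℂ M] (ρ : WittModule m n M)

/-- The action of `U(W_{m,n})` on a `W_{m,n}`-module. -/
def envAct : Env m n →ₐ[ℂ] Module.End ℂ M :=
  RingQuot.liftAlgHom ℂ ⟨TensorAlgebra.lift ℂ ρ.act, by
    rintro _ _ ⟨x, y⟩
    ext v
    simp [ρ.act_bracket]⟩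

/-- The weight space `M_λ` for `𝔥_{m,0}`. -/
def weightSpace (l : Fin m → ℂ) : Submodule ℂ M where
  carrier := {v | ∀ i, ρ.act (euler m n i) v = l i • v}
  add_mem' := fun hv hw i => by rw [map_add, hv i, hw i, smul_add]
  zero_mem' := fun i => by simp
  smul_mem' := fun c v hv i => by rw [map_smul, hv i, smul_comm]

open scoped Classical in
/-- `M` is a weight module: it is the direct sum of its weight spaces for `𝔥_{m,0}`. -/
def IsWeight : Prop := DirectSum.IsInternal ρ.weightSpace

/-- `M` is uniformly bounded: it is a weight module, and the dimensions of its weight spaces are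
bounded by one natural number. -/
def IsUniformlyBounded : Prop :=
  ρ.IsWeight ∧ ∃ N : ℕ, ∀ l : Fin m → ℂ, Module.rank ℂ (ρ.weightSpace l) ≤ (N : Cardinal)

end WittModule

end WittSuper

end

/-! ### Noncommutative words encoded by commutative polynomials. -/

noncomputable section

namespace WittSuper

/-! Fix `j`. The operators `L a = t_j^a ∂_j` satisfy [L a, L b] = (b - a) L (a + b - 1), and along
each coset l + ℤ e_j they act on weight spaces of dimension at most N. A polynomial in z_0, z_1
stands for the operator obtained from z_0^a z_1^b ↦ L a L b. The core of the proof is an exponent R,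
depending on N alone, such that every multiple of (z_0 - z_1)^R gives zero
(`exists_uniform_exponent`).

Suppose first that ∂ = L 0 is bijective near one end of the coset. Identifying weight spaces through
∂ makes each L a polynomial in the weight, and the operator of (z_0 - z_1)^r becomes r! times the
r-th coefficient of a series H(w) = (1 - w)² D(w) G(-w), see `wittSeries`. The bracket with L 2 is a
recursion that forces polynomial growth in a suitable variable, so H continues to Re w < 1. Words of
odd order at least 3 vanish by skew symmetry, so H(w) = H(-w) - 2w; hence H extends to an entire
function of polynomial growth and is a polynomial. An ultrapower of ℂ makes the index of a vanishing
even coefficient uniform in the dimension. Brackets then spread the vanishing of one even power to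
all its multiples (`mul_mem_wordKer`).

In general, ∂ is injective modulo its torsion, surjective on the divisible part of the torsion, and
every L a maps the torsion into that divisible part. Composing the vanishing on these layers shows
that products of two words vanish, and `pow_mem_wordKer_of_mul` converts this into the vanishing of
a single word of larger order.

Finally, a field t_j^a x whose factor x has coefficients free of t_j is reached by commutators:
first the left factor ∂_j is replaced by x (`annihilates_dt`), then the right one
(`annihilates_flat`), at the cost of three in the exponent. Every t^α ξ_I ∂ has this form for ∂ a
coordinate derivation, and linearity does the rest. -/

open MvPolynomial in
/-- The linear map sending `z_0^{a_0} ⋯ z_{n-1}^{a_{n-1}}` to `L a_0 * ⋯ * L a_{n-1}`. -/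
def word {U : Type*} [Ring U] [Algebra ℂ U] (L : ℕ → U) (n : ℕ) :
    MvPolynomial (Fin n) ℂ →ₗ[ℂ] U :=
  (basisMonomials (Fin n) ℂ).constr ℂ fun s => (List.ofFn fun i => L (s i)).prod

/-- The commutation relations of the elements `t^a ∂` of the Witt algebra. -/
def IsWitt {U : Type*} [Ring U] [Algebra ℂ U] (L : ℕ → U) : Prop :=
  ∀ a b, L a * L b - L b * L a = ((b : ℂ) - a) • L (a + b - 1)

section Words

open MvPolynomial

variable {U : Type*} [Ring U] [Algebra ℂ U] (L : ℕ → U)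

theorem word_monomial {n : ℕ} (s : Fin n →₀ ℕ) :
    word L n (monomial s 1) = (List.ofFn fun i => L (s i)).prod := by
  have := (basisMonomials (Fin n) ℂ).constr_basis ℂ
    (fun s => (List.ofFn fun i => L (s i)).prod) s
  simpa [word] using this

theorem monomial_eq_prod_X_pow {n : ℕ} (s : Fin n →₀ ℕ) :
    (monomial s 1 : MvPolynomial (Fin n) ℂ) = ∏ i, X i ^ s i := by
  rw [monomial_eq, Finsupp.prod_fintype _ _ (fun i => pow_zero _)]
  simp

theorem word_prod_X_pow {n : ℕ} (s : Fin n → ℕ) :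
    word L n (∏ i, X i ^ s i) = (List.ofFn fun i => L (s i)).prod := by
  have := word_monomial L (Finsupp.equivFunOnFinite.symm s)
  rw [monomial_eq_prod_X_pow] at this
  simpa using this

theorem linearMap_ext_X_pow {n : ℕ} {V : Type*} [AddCommGroup V] [Module ℂ V]
    {f g : MvPolynomial (Fin n) ℂ →ₗ[ℂ] V}
    (h : ∀ s : Fin n → ℕ, f (∏ i, X i ^ s i) = g (∏ i, X i ^ s i)) : f = g := by
  refine (basisMonomials (Fin n) ℂ).ext fun s => ?_
  rw [coe_basisMonomials]
  change f (monomial s 1) = g (monomial s 1)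
  rw [monomial_eq_prod_X_pow]
  exact h s

theorem word_two (a b : ℕ) : word L 2 (X 0 ^ a * X 1 ^ b) = L a * L b := by
  simpa using word_prod_X_pow L ![a, b]

theorem word_one (a : ℕ) : word L 1 (X 0 ^ a) = L a := by
  simpa using word_prod_X_pow L ![a]

theorem word_three (a b c : ℕ) :
    word L 3 (X 0 ^ a * X 1 ^ b * X 2 ^ c) = L a * (L b * L c) := by
  have := word_prod_X_pow L ![a, b, c]
  rw [Fin.prod_univ_three] at this
  simpa using this

theorem word_four (a b c d : ℕ) :
    word L 4 (X 0 ^ a * X 1 ^ b * X 2 ^ c * X 3 ^ d) = L a * (L b * (L c * L d)) := by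
  have := word_prod_X_pow L ![a, b, c, d]
  rw [Fin.prod_univ_four] at this
  simpa using this

variable {L}

/-- The derivation-like polynomial behind the bracket of two factors. -/
theorem bracket_pow {R : Type*} [CommRing R] [Algebra ℂ R] (x : R) (b c : ℕ) :
    x ^ b * ((c : R) * x ^ (c - 1)) - (b : R) * x ^ (b - 1) * x ^ c =
      ((c : ℂ) - b) • x ^ (b + c - 1) := by
  rw [Algebra.smul_def]
  rcases b with _ | b <;> rcases c with _ | c
  · simp
  · simp
  · simp
    ring
  · have : b + 1 + (c + 1) - 1 = b + c + 1 := by omega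
    rw [this]
    simp
    ring

/-- On the diagonal, ∂_1 - ∂_0 sends z_0^a z_1^b to (b - a) z^(a+b-1), which encodes the bracket [L
a, L b]. Thus exchanging neighbouring variables costs a word with one letter fewer; the versions in
three and four letters follow the same pattern. -/
theorem word_two_swap (hL : IsWitt L) (F : MvPolynomial (Fin 2) ℂ) :
    word L 2 F - word L 2 (aeval ![X 1, X 0] F) =
      word L 1 (aeval ![X 0, X 0] (pderiv 1 F - pderiv 0 F)) := by
  have key : word L 2 - (word L 2) ∘ₗ (aeval ![X 1, X 0] :
        MvPolynomial (Fin 2) ℂ →ₐ[ℂ] MvPolynomial (Fin 2) ℂ).toLinearMap =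
      word L 1 ∘ₗ (aeval ![X 0, X 0] :
        MvPolynomial (Fin 2) ℂ →ₐ[ℂ] MvPolynomial (Fin 1) ℂ).toLinearMap ∘ₗ
        ((pderiv 1 : Derivation ℂ (MvPolynomial (Fin 2) ℂ) _).toLinearMap -
          (pderiv 0 : Derivation ℂ (MvPolynomial (Fin 2) ℂ) _).toLinearMap) := by
    refine linearMap_ext_X_pow fun s => ?_
    have hd : aeval (![X 0, X 0] : Fin 2 → MvPolynomial (Fin 1) ℂ)
        (pderiv 1 (X 0 ^ s 0 * X 1 ^ s 1) - pderiv 0 (X 0 ^ s 0 * X 1 ^ s 1) :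
          MvPolynomial (Fin 2) ℂ) =
        ((s 1 : ℂ) - s 0) • (X 0 : MvPolynomial (Fin 1) ℂ) ^ (s 0 + s 1 - 1) := by
      rw [← bracket_pow]
      simp [Derivation.leibniz, Derivation.leibniz_pow, pderiv_X]
      ring
    have hs : aeval (![X 1, X 0] : Fin 2 → MvPolynomial (Fin 2) ℂ)
        (X 0 ^ s 0 * X 1 ^ s 1 : MvPolynomial (Fin 2) ℂ) = X 0 ^ s 1 * X 1 ^ s 0 := by
      simp [mul_comm]
    simp only [LinearMap.sub_apply, LinearMap.comp_apply, AlgHom.toLinearMap_apply,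
      Derivation.coeFn_coe, Fin.prod_univ_two]
    rw [hd, hs, word_two, word_two, map_smul, word_one]
    exact hL _ _
  exact LinearMap.congr_fun key F

theorem word_three_swap_left (hL : IsWitt L) (F : MvPolynomial (Fin 3) ℂ) :
    word L 3 F - word L 3 (aeval ![X 1, X 0, X 2] F) =
      word L 2 (aeval ![X 0, X 0, X 1] (pderiv 1 F - pderiv 0 F)) := by
  have key : word L 3 - (word L 3) ∘ₗ (aeval ![X 1, X 0, X 2] :
        MvPolynomial (Fin 3) ℂ →ₐ[ℂ] MvPolynomial (Fin 3) ℂ).toLinearMap =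
      word L 2 ∘ₗ (aeval ![X 0, X 0, X 1] :
        MvPolynomial (Fin 3) ℂ →ₐ[ℂ] MvPolynomial (Fin 2) ℂ).toLinearMap ∘ₗ
        ((pderiv 1 : Derivation ℂ (MvPolynomial (Fin 3) ℂ) _).toLinearMap -
          (pderiv 0 : Derivation ℂ (MvPolynomial (Fin 3) ℂ) _).toLinearMap) := by
    refine linearMap_ext_X_pow fun s => ?_
    have hd : aeval (![X 0, X 0, X 1] : Fin 3 → MvPolynomial (Fin 2) ℂ)
        (pderiv 1 (X 0 ^ s 0 * X 1 ^ s 1 * X 2 ^ s 2) -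
          pderiv 0 (X 0 ^ s 0 * X 1 ^ s 1 * X 2 ^ s 2) : MvPolynomial (Fin 3) ℂ) =
        ((s 1 : ℂ) - s 0) • (X 0 ^ (s 0 + s 1 - 1) * X 1 ^ s 2) := by
      rw [← smul_mul_assoc, ← bracket_pow]
      simp [Derivation.leibniz, Derivation.leibniz_pow, pderiv_X]
      ring
    have hs : aeval (![X 1, X 0, X 2] : Fin 3 → MvPolynomial (Fin 3) ℂ)
        (X 0 ^ s 0 * X 1 ^ s 1 * X 2 ^ s 2 : MvPolynomial (Fin 3) ℂ) =
        X 0 ^ s 1 * X 1 ^ s 0 * X 2 ^ s 2 := by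
      simp [mul_comm]
    simp only [LinearMap.sub_apply, LinearMap.comp_apply, AlgHom.toLinearMap_apply,
      Derivation.coeFn_coe, Fin.prod_univ_three]
    rw [hd, hs, word_three, word_three, map_smul, word_two, ← mul_assoc, ← mul_assoc, ← sub_mul,
      hL, smul_mul_assoc]
  exact LinearMap.congr_fun key F

theorem word_three_swap_right (hL : IsWitt L) (F : MvPolynomial (Fin 3) ℂ) :
    word L 3 F - word L 3 (aeval ![X 0, X 2, X 1] F) =
      word L 2 (aeval ![X 0, X 1, X 1] (pderiv 2 F - pderiv 1 F)) := by
  have key : word L 3 - (word L 3) ∘ₗ (aeval ![X 0, X 2, X 1] :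
        MvPolynomial (Fin 3) ℂ →ₐ[ℂ] MvPolynomial (Fin 3) ℂ).toLinearMap =
      word L 2 ∘ₗ (aeval ![X 0, X 1, X 1] :
        MvPolynomial (Fin 3) ℂ →ₐ[ℂ] MvPolynomial (Fin 2) ℂ).toLinearMap ∘ₗ
        ((pderiv 2 : Derivation ℂ (MvPolynomial (Fin 3) ℂ) _).toLinearMap -
          (pderiv 1 : Derivation ℂ (MvPolynomial (Fin 3) ℂ) _).toLinearMap) := by
    refine linearMap_ext_X_pow fun s => ?_
    have hd : aeval (![X 0, X 1, X 1] : Fin 3 → MvPolynomial (Fin 2) ℂ)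
        (pderiv 2 (X 0 ^ s 0 * X 1 ^ s 1 * X 2 ^ s 2) -
          pderiv 1 (X 0 ^ s 0 * X 1 ^ s 1 * X 2 ^ s 2) : MvPolynomial (Fin 3) ℂ) =
        ((s 2 : ℂ) - s 1) • (X 0 ^ s 0 * X 1 ^ (s 1 + s 2 - 1)) := by
      rw [← mul_smul_comm, ← bracket_pow]
      simp [Derivation.leibniz, Derivation.leibniz_pow, pderiv_X]
      ring
    have hs : aeval (![X 0, X 2, X 1] : Fin 3 → MvPolynomial (Fin 3) ℂ)
        (X 0 ^ s 0 * X 1 ^ s 1 * X 2 ^ s 2 : MvPolynomial (Fin 3) ℂ) =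
        X 0 ^ s 0 * X 1 ^ s 2 * X 2 ^ s 1 := by
      simp [mul_right_comm]
    simp only [LinearMap.sub_apply, LinearMap.comp_apply, AlgHom.toLinearMap_apply,
      Derivation.coeFn_coe, Fin.prod_univ_three]
    rw [hd, hs, word_three, word_three, map_smul, word_two, ← mul_sub, hL, mul_smul_comm]
  exact LinearMap.congr_fun key F

theorem word_four_swap_mid (hL : IsWitt L) (F : MvPolynomial (Fin 4) ℂ) :
    word L 4 F - word L 4 (aeval ![X 0, X 2, X 1, X 3] F) =
      word L 3 (aeval ![X 0, X 1, X 1, X 2] (pderiv 2 F - pderiv 1 F)) := by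
  have key : word L 4 - (word L 4) ∘ₗ (aeval ![X 0, X 2, X 1, X 3] :
        MvPolynomial (Fin 4) ℂ →ₐ[ℂ] MvPolynomial (Fin 4) ℂ).toLinearMap =
      word L 3 ∘ₗ (aeval ![X 0, X 1, X 1, X 2] :
        MvPolynomial (Fin 4) ℂ →ₐ[ℂ] MvPolynomial (Fin 3) ℂ).toLinearMap ∘ₗ
        ((pderiv 2 : Derivation ℂ (MvPolynomial (Fin 4) ℂ) _).toLinearMap -
          (pderiv 1 : Derivation ℂ (MvPolynomial (Fin 4) ℂ) _).toLinearMap) := by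
    refine linearMap_ext_X_pow fun s => ?_
    have hd : aeval (![X 0, X 1, X 1, X 2] : Fin 4 → MvPolynomial (Fin 3) ℂ)
        (pderiv 2 (X 0 ^ s 0 * X 1 ^ s 1 * X 2 ^ s 2 * X 3 ^ s 3) -
          pderiv 1 (X 0 ^ s 0 * X 1 ^ s 1 * X 2 ^ s 2 * X 3 ^ s 3) :
            MvPolynomial (Fin 4) ℂ) =
        ((s 2 : ℂ) - s 1) • (X 0 ^ s 0 * X 1 ^ (s 1 + s 2 - 1) * X 2 ^ s 3) := by
      rw [← smul_mul_assoc, ← mul_smul_comm, ← bracket_pow]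
      simp [Derivation.leibniz, Derivation.leibniz_pow, pderiv_X]
      ring
    have hs : aeval (![X 0, X 2, X 1, X 3] : Fin 4 → MvPolynomial (Fin 4) ℂ)
        (X 0 ^ s 0 * X 1 ^ s 1 * X 2 ^ s 2 * X 3 ^ s 3 : MvPolynomial (Fin 4) ℂ) =
        X 0 ^ s 0 * X 1 ^ s 2 * X 2 ^ s 1 * X 3 ^ s 3 := by
      simp [mul_right_comm]
    simp only [LinearMap.sub_apply, LinearMap.comp_apply, AlgHom.toLinearMap_apply,
      Derivation.coeFn_coe, Fin.prod_univ_four]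
    rw [hd, hs, word_four, word_four, map_smul, word_three, ← mul_sub, ← mul_assoc (L _) (L _),
      ← mul_assoc (L (s 2)) (L _), ← sub_mul, hL, smul_mul_assoc, mul_smul_comm]
  exact LinearMap.congr_fun key F

theorem word_four_mul (F G : MvPolynomial (Fin 2) ℂ) :
    word L 4 (aeval ![X 0, X 1] F * aeval ![X 2, X 3] G) = word L 2 F * word L 2 G := by
  have key : ((LinearMap.mul ℂ (MvPolynomial (Fin 4) ℂ)).compl₁₂
        (aeval ![X 0, X 1] : MvPolynomial (Fin 2) ℂ →ₐ[ℂ] MvPolynomial (Fin 4) ℂ).toLinearMap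
        (aeval ![X 2, X 3] : MvPolynomial (Fin 2) ℂ →ₐ[ℂ] MvPolynomial (Fin 4) ℂ).toLinearMap).compr₂
        (word L 4) = (LinearMap.mul ℂ U).compl₁₂ (word L 2) (word L 2) := by
    refine linearMap_ext_X_pow fun s => linearMap_ext_X_pow fun s' => ?_
    simp only [LinearMap.compr₂_apply, LinearMap.compl₁₂_apply, Fin.prod_univ_two,
      AlgHom.toLinearMap_apply, LinearMap.mul_apply']
    rw [word_two, word_two]
    have := word_four L (s 0) (s 1) (s' 0) (s' 1)
    simpa [mul_assoc] using this
  exact LinearMap.congr_fun (LinearMap.congr_fun key F) G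

/-- The action of `t^c ∂` on `ℂ[z_0, z_1]` corresponding to the commutator with a product of two
elements of the Witt algebra. -/
def adPoly (c : ℕ) : MvPolynomial (Fin 2) ℂ →ₗ[ℂ] MvPolynomial (Fin 2) ℂ :=
  LinearMap.mulLeft ℂ (X 0 ^ c) ∘ₗ (pderiv 0).toLinearMap +
    LinearMap.mulLeft ℂ (X 1 ^ c) ∘ₗ (pderiv 1).toLinearMap -
    LinearMap.mulLeft ℂ (C (c : ℂ) * (X 0 ^ (c - 1) + X 1 ^ (c - 1)))

theorem adPoly_apply (c : ℕ) (F : MvPolynomial (Fin 2) ℂ) :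
    adPoly c F = X 0 ^ c * pderiv 0 F + X 1 ^ c * pderiv 1 F -
      C (c : ℂ) * (X 0 ^ (c - 1) + X 1 ^ (c - 1)) * F := rfl

theorem commutator_word_two (hL : IsWitt L) (c : ℕ) (F : MvPolynomial (Fin 2) ℂ) :
    L c * word L 2 F - word L 2 F * L c = word L 2 (adPoly c F) := by
  have key : LinearMap.mulLeft ℂ (L c) ∘ₗ word L 2 - LinearMap.mulRight ℂ (L c) ∘ₗ word L 2 =
      word L 2 ∘ₗ adPoly c := by
    refine linearMap_ext_X_pow fun s => ?_
    have hd : adPoly c (X 0 ^ s 0 * X 1 ^ s 1) =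
        ((s 0 : ℂ) - c) • (X 0 ^ (c + s 0 - 1) * X 1 ^ s 1) +
        ((s 1 : ℂ) - c) • (X 0 ^ s 0 * X 1 ^ (c + s 1 - 1)) := by
      rw [← smul_mul_assoc, ← mul_smul_comm, ← bracket_pow, ← bracket_pow, adPoly_apply]
      simp [Derivation.leibniz, Derivation.leibniz_pow, pderiv_X]
      ring
    simp only [LinearMap.sub_apply, LinearMap.comp_apply, Fin.prod_univ_two,
      LinearMap.mulLeft_apply, LinearMap.mulRight_apply]
    rw [hd, map_add, map_smul, map_smul, word_two, word_two, word_two, ← smul_mul_assoc,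
      ← mul_smul_comm, ← hL, ← hL]
    noncomm_ring
  exact LinearMap.congr_fun key F

/-- A skew symmetric polynomial divisible by `(z_0 - z_1)^2` gives zero. -/
theorem word_two_eq_zero_of_skew (hL : IsWitt L) {F : MvPolynomial (Fin 2) ℂ}
    (hF : aeval ![X 1, X 0] F = -F) {G : MvPolynomial (Fin 2) ℂ} (hG : F = (X 0 - X 1) ^ 2 * G) :
    word L 2 F = 0 := by
  have h := word_two_swap hL F
  -- A double zero on the diagonal kills the first derivatives there, so exchanging the letters
  -- costs nothing.
  have h0 : aeval (![X 0, X 0] : Fin 2 → MvPolynomial (Fin 1) ℂ) (pderiv 1 F - pderiv 0 F) = 0 := by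
    rw [hG]
    simp [Derivation.leibniz, Derivation.leibniz_pow, pderiv_X]
  rw [hF, h0, map_neg, map_zero, sub_neg_eq_add, ← two_smul ℂ] at h
  exact (smul_eq_zero.1 h).resolve_left two_ne_zero

end Words

end WittSuper
end

/-! ### Propagation of vanishing from one power of z_0 - z_1 to its multiples. -/

noncomputable section

namespace WittSuper

section Vanishing

open MvPolynomial

theorem C_ofNat {σ : Type*} (n : ℕ) [n.AtLeastTwo] :
    (C (ofNat(n) : ℂ) : MvPolynomial σ ℂ) = ofNat(n) :=
  map_ofNat C n

/-- In the coordinates u = z_0 - z_1 and s = z_0 + z_1, the commutator with L 2 raises the power of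
s, up to a term in u^(p+2). This makes the induction in `pow_mul_pow_mem_wordKer` possible. -/
theorem adPoly_two (p i : ℕ) :
    C 2 * adPoly 2 ((X 0 - X 1) ^ p * (X 0 + X 1) ^ i) =
      C (2 * p + i - 4 : ℂ) * ((X 0 - X 1) ^ p * (X 0 + X 1) ^ (i + 1)) +
        C (i : ℂ) * ((X 0 - X 1) ^ (p + 2) * (X 0 + X 1) ^ (i - 1)) := by
  rw [adPoly_apply]
  rcases p with _ | p <;> rcases i with _ | i <;>
  · simp [Derivation.leibniz, Derivation.leibniz_pow, pderiv_X, C_ofNat]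
    ring

theorem adPoly_three (p : ℕ) :
    C 4 * adPoly 3 ((X 0 - X 1) ^ p) =
      C (3 * p - 6 : ℂ) * ((X 0 - X 1) ^ p * (X 0 + X 1) ^ 2) +
        C (p - 6 : ℂ) * (X 0 - X 1) ^ (p + 2) := by
  rw [adPoly_apply]
  rcases p with _ | p <;>
  · simp [Derivation.leibniz_pow, pderiv_X, C_ofNat]
    ring

variable {M : Type*} [AddCommGroup M] [Module ℂ M] {L : ℕ → Module.End ℂ M}

/-- The polynomials whose words vanish on a given subspace. -/
def wordKer (L : ℕ → Module.End ℂ M) (S : Submodule ℂ M) :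
    Submodule ℂ (MvPolynomial (Fin 2) ℂ) where
  carrier := {F | ∀ v ∈ S, word L 2 F v = 0}
  add_mem' := fun hF hG v hv => by rw [map_add, LinearMap.add_apply, hF v hv, hG v hv, add_zero]
  zero_mem' := fun v _ => by simp
  smul_mem' := fun c F hF v hv => by rw [map_smul, LinearMap.smul_apply, hF v hv, smul_zero]

theorem C_mul_mem_wordKer {S : Submodule ℂ M} {F : MvPolynomial (Fin 2) ℂ}
    (hF : F ∈ wordKer L S) (c : ℂ) : C c * F ∈ wordKer L S := by
  rw [← smul_eq_C_mul]
  exact Submodule.smul_mem _ _ hF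

theorem mem_wordKer_of_C_mul {S : Submodule ℂ M} {F : MvPolynomial (Fin 2) ℂ} {c : ℂ} (hc : c ≠ 0)
    (hF : C c * F ∈ wordKer L S) : F ∈ wordKer L S := by
  have := C_mul_mem_wordKer hF c⁻¹
  rwa [← mul_assoc, ← C_mul, inv_mul_cancel₀ hc, C_1, one_mul] at this

theorem adPoly_mem_wordKer (hL : IsWitt L) {S : Submodule ℂ M} (hS : ∀ a, ∀ v ∈ S, L a v ∈ S)
    (c : ℕ) {F : MvPolynomial (Fin 2) ℂ} (hF : F ∈ wordKer L S) : adPoly c F ∈ wordKer L S := by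
  intro v hv
  rw [← commutator_word_two hL, LinearMap.sub_apply, Module.End.mul_apply, Module.End.mul_apply,
    hF v hv, hF _ (hS c v hv), map_zero, sub_zero]

/-- The kernel is stable under commutators. Two commutators with L 2 and one with L 3 turn u^p into
two combinations of u^p s² and u^(p+2), where u = z_0 - z_1 and s = z_0 + z_1; these are
independent, so u^p s² can be eliminated. -/
theorem pow_mem_wordKer (hL : IsWitt L) {S : Submodule ℂ M} (hS : ∀ a, ∀ v ∈ S, L a v ∈ S)
    {p : ℕ} (hp : 4 ≤ p) (h : (X 0 - X 1) ^ p ∈ wordKer L S) :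
    (X 0 - X 1) ^ (p + 2) ∈ wordKer L S := by
  set K := wordKer L S
  have h1 : (X 0 - X 1) ^ p * (X 0 + X 1) ∈ K := by
    have := C_mul_mem_wordKer (adPoly_mem_wordKer hL hS 2 h) 2
    have e := adPoly_two p 0
    simp only [pow_zero, mul_one, zero_add, pow_one, Nat.cast_zero, map_zero, zero_mul,
      add_zero] at e
    rw [e] at this
    refine mem_wordKer_of_C_mul ?_ this
    have : (2 * p - 4 : ℂ) = ((2 * p - 4 : ℕ) : ℂ) := by
      rw [Nat.cast_sub (by omega)]; push_cast; ring
    rw [this]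
    exact_mod_cast (by omega)
  have h2 := C_mul_mem_wordKer (adPoly_mem_wordKer hL hS 2 h1) 2
  have e2 := adPoly_two p 1
  rw [pow_one] at e2
  rw [e2] at h2
  have h3 := C_mul_mem_wordKer (adPoly_mem_wordKer hL hS 3 h) 4
  rw [adPoly_three] at h3
  have h4 := sub_mem (C_mul_mem_wordKer h2 (3 * p - 6 : ℂ)) (C_mul_mem_wordKer h3 (2 * p - 3 : ℂ))
  refine mem_wordKer_of_C_mul (c := (3 * p - 6) - (2 * p - 3) * (p - 6)) ?_ ?_
  · have : ((3 * p - 6) - (2 * p - 3) * (p - 6) : ℂ) = ((-2 * p ^ 2 + 18 * p - 24 : ℤ) : ℂ) := by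
      push_cast; ring
    rw [this]
    -- The roots of p² - 9p + 12 are irrational, its discriminant being 33.
    have h5 : (-2 * p ^ 2 + 18 * p - 24 : ℤ) ≠ 0 := by
      intro h0
      rcases le_or_gt p 7 with h7 | h7
      · interval_cases p <;> omega
      · have : (8 : ℤ) ≤ p := by exact_mod_cast h7
        nlinarith
    exact_mod_cast h5
  · convert h4 using 1
    simp [C_ofNat]
    ring

/-- By `adPoly_two`, the case of s^(i+1) follows from s^i with the same p and from s^(i-1) with p +
2. The leading scalar 2p + i - 4 is nonzero since p ≥ 4; for i = 0 the truncated term carries the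
factor 0. -/
theorem pow_mul_pow_mem_wordKer (hL : IsWitt L) {S : Submodule ℂ M}
    (hS : ∀ a, ∀ v ∈ S, L a v ∈ S) (i : ℕ) : ∀ {p : ℕ}, 4 ≤ p →
    (X 0 - X 1) ^ p ∈ wordKer L S → (X 0 - X 1) ^ p * (X 0 + X 1) ^ i ∈ wordKer L S := by
  induction i using Nat.strong_induction_on with
  | _ i ih =>
    intro p hp h
    rcases i with _ | i
    · simpa using h
    · have h1 := C_mul_mem_wordKer (adPoly_mem_wordKer hL hS 2 (ih i (by omega) hp h)) 2
      have h2 := C_mul_mem_wordKer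
        (ih (i - 1) (by omega) (by omega : 4 ≤ p + 2) (pow_mem_wordKer hL hS hp h)) (i : ℂ)
      rw [adPoly_two] at h1
      have h3 := sub_mem h1 h2
      rw [add_sub_cancel_right] at h3
      refine mem_wordKer_of_C_mul ?_ h3
      have : (2 * p + i - 4 : ℂ) = ((2 * p + i - 4 : ℕ) : ℂ) := by
        rw [Nat.cast_sub (by omega)]; push_cast; ring
      rw [this]
      exact_mod_cast (by omega)

/-- If the word of `(z_0 - z_1)^r` vanishes on an invariant subspace, so does that of all
multiples. -/
theorem mul_mem_wordKer (hL : IsWitt L) {S : Submodule ℂ M} (hS : ∀ a, ∀ v ∈ S, L a v ∈ S)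
    {r : ℕ} (hr : 4 ≤ r) (he : Even r) (h : (X 0 - X 1) ^ r ∈ wordKer L S)
    (F : MvPolynomial (Fin 2) ℂ) : (X 0 - X 1) ^ r * F ∈ wordKer L S := by
  have heven : ∀ j, (X 0 - X 1) ^ (r + 2 * j) ∈ wordKer L S := by
    intro j
    induction j with
    | zero => simpa using h
    | succ j ih => exact pow_mem_wordKer hL hS (hr.trans (Nat.le_add_right _ _)) ih
  have hall : ∀ p i : ℕ, (X 0 - X 1) ^ (r + p) * (X 0 + X 1) ^ i ∈ wordKer L S := by
    intro p i
    rcases Nat.even_or_odd p with ⟨j, rfl⟩ | hp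
    · rw [← two_mul]
      exact pow_mul_pow_mem_wordKer hL hS i (by omega) (heven j)
    -- An odd power of z_0 - z_1 times a symmetric polynomial is skew, and it has a double zero on
    -- the diagonal.
    · intro v _
      rw [word_two_eq_zero_of_skew hL (G := (X 0 - X 1) ^ (r + p - 2) * (X 0 + X 1) ^ i),
        LinearMap.zero_apply]
      · have hop : Odd (r + p) := he.add_odd hp
        simp only [map_mul, map_pow, map_sub, map_add, aeval_X, Matrix.cons_val_zero,
          Matrix.cons_val_one]
        rw [← neg_sub, hop.neg_pow, add_comm (X 1 : MvPolynomial (Fin 2) ℂ), neg_mul]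
      · rw [← mul_assoc, ← pow_add]
        congr 2
        omega
  have hX : ∀ F : MvPolynomial (Fin 2) ℂ, ∀ p i : ℕ,
      (X 0 - X 1) ^ (r + p) * (X 0 + X 1) ^ i * F ∈ wordKer L S := by
    intro F
    induction F using MvPolynomial.induction_on with
    | C a => intro p i; rw [mul_comm]; exact C_mul_mem_wordKer (hall p i) a
    | add F G hF hG => intro p i; rw [mul_add]; exact add_mem (hF p i) (hG p i)
    | mul_X F k hF =>
      intro p i
      refine mem_wordKer_of_C_mul (c := 2) two_ne_zero ?_
      -- The variables are recovered from 2 z_0 = s + u and 2 z_1 = s - u.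
      have h1 := hF p (i + 1)
      have h2 := hF (p + 1) i
      fin_cases k
      · convert add_mem h1 h2 using 1
        simp [C_ofNat]
        ring
      · convert sub_mem h1 h2 using 1
        simp [C_ofNat]
        ring
  simpa using hX F 0 0

/-- If all products of two words of multiples of `(z_0 - z_1)^r` vanish, then the word of
`(z_0 - z_1)^{4r}` vanishes. -/
theorem pow_mem_wordKer_of_mul (hL : IsWitt L) {r : ℕ} (hr : 1 ≤ r) {S : Submodule ℂ M}
    (h : ∀ F : MvPolynomial (Fin 2) ℂ, ∀ s : Fin 2 → ℕ, ∀ v ∈ S,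
      word L 2 ((X 0 - X 1) ^ (2 * r) * F)
        (word L 2 ((X 0 - X 1) ^ (2 * r) * ∏ i, X i ^ s i) v) = 0) :
    (X 0 - X 1) ^ (8 * r) ∈ wordKer L S := by
  intro v hv
  have h4 : ∀ G : MvPolynomial (Fin 4) ℂ,
      word L 4 ((X 0 - X 1) ^ (2 * r) * (X 2 - X 3) ^ (2 * r) * G) v = 0 := by
    intro G
    have key : LinearMap.applyₗ v ∘ₗ word L 4 ∘ₗ
        LinearMap.mulLeft ℂ ((X 0 - X 1) ^ (2 * r) * (X 2 - X 3) ^ (2 * r)) = 0 := by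
      refine linearMap_ext_X_pow fun s => ?_
      have := word_four_mul (L := L) ((X 0 - X 1) ^ (2 * r) * (X 0 ^ s 0 * X 1 ^ s 1))
        ((X 0 - X 1) ^ (2 * r) * (∏ i, X i ^ (![s 2, s 3]) i))
      have hv' := h (X 0 ^ s 0 * X 1 ^ s 1) ![s 2, s 3] v hv
      rw [← Module.End.mul_apply, ← this] at hv'
      simp only [LinearMap.comp_apply, LinearMap.mulLeft_apply, LinearMap.zero_apply,
        LinearMap.applyₗ_apply_apply]
      rw [← hv']
      congr 2
      simp [Fin.prod_univ_four]
      ring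
    exact LinearMap.congr_fun key G
  have step1 : word L 3 ((X 0 - X 1) ^ (4 * r) * (X 1 - X 2) ^ (4 * r) * (X 0 - X 2)) v = 0 := by
    -- A multiple of the product of the two powers, completed so as to be skew in z_1, z_2 with only
    -- a simple zero at z_1 = z_2. Its word is zero, so the bracket term of the exchange must
    -- vanish; this removes one letter.
    set f : MvPolynomial (Fin 4) ℂ := (X 0 - X 1) ^ (2 * r) * (X 2 - X 3) ^ (2 * r) *
      ((X 0 - X 2) ^ (2 * r) * (X 1 - X 3) ^ (2 * r) * (X 0 - X 3) * (X 1 - X 2)) with hf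
    have hsk : aeval ![X 0, X 2, X 1, X 3] f = -f := by
      rw [hf]
      simp
      ring
    have hd : aeval ![X 0, X 1, X 1, X 2] (pderiv 2 f - pderiv 1 f) =
        C (-2 : ℂ) * ((X 0 - X 1) ^ (4 * r) * (X 1 - X 2) ^ (4 * r) * (X 0 - X 2) :
          MvPolynomial (Fin 3) ℂ) := by
      rw [hf]
      simp [Derivation.leibniz, Derivation.leibniz_pow, pderiv_X, C_ofNat]
      ring
    have := word_four_swap_mid hL f
    rw [hsk, hd, map_neg, ← smul_eq_C_mul, map_smul] at this
    have := LinearMap.congr_fun this v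
    simp only [LinearMap.sub_apply, LinearMap.neg_apply, LinearMap.smul_apply, hf, h4] at this
    rw [neg_zero, sub_zero, eq_comm, smul_eq_zero] at this
    exact this.resolve_left (by norm_num)
  -- The last two letters can be exchanged freely, because 4r ≥ 2 gives a multiple zero at z_1 =
  -- z_2. The simple factor then sits between the first two letters, where the same skew argument
  -- removes another letter.
  have step2 : word L 3 ((X 0 - X 2) ^ (4 * r) * (X 2 - X 1) ^ (4 * r) * (X 0 - X 1)) v = 0 := by
    have hd : aeval (![X 0, X 1, X 1] : Fin 3 → MvPolynomial (Fin 2) ℂ)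
        (pderiv 2 ((X 0 - X 1) ^ (4 * r) * (X 1 - X 2) ^ (4 * r) * (X 0 - X 2) :
          MvPolynomial (Fin 3) ℂ) -
        pderiv 1 ((X 0 - X 1) ^ (4 * r) * (X 1 - X 2) ^ (4 * r) * (X 0 - X 2))) = 0 := by
      have h0 : 4 * r ≠ 0 := by omega
      have h1 : 4 * r - 1 ≠ 0 := by omega
      simp [Derivation.leibniz, Derivation.leibniz_pow, pderiv_X, h0, h1]
    have := word_three_swap_right hL
      ((X 0 - X 1) ^ (4 * r) * (X 1 - X 2) ^ (4 * r) * (X 0 - X 2))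
    rw [hd, map_zero, sub_eq_zero] at this
    rw [this] at step1
    simpa using step1
  set f : MvPolynomial (Fin 3) ℂ :=
    (X 0 - X 2) ^ (4 * r) * (X 2 - X 1) ^ (4 * r) * (X 0 - X 1) with hf
  have hsk : aeval ![X 1, X 0, X 2] f = -f := by
    have h4r : Even (4 * r) := ⟨2 * r, by ring⟩
    rw [hf]
    simp only [map_mul, map_pow, map_sub, aeval_X, Matrix.cons_val_zero, Matrix.cons_val_one,
      Matrix.cons_val_two, Matrix.tail_cons, Matrix.head_cons]
    rw [← neg_sub (X 2) (X 1), ← neg_sub (X 0 : MvPolynomial (Fin 3) ℂ) (X 2), h4r.neg_pow,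
      h4r.neg_pow]
    ring
  have hd : aeval ![X 0, X 0, X 1] (pderiv 1 f - pderiv 0 f) =
      C (-2 : ℂ) * ((X 0 - X 1) ^ (8 * r) : MvPolynomial (Fin 2) ℂ) := by
    have h4r : Even (4 * r) := ⟨2 * r, by ring⟩
    have e : (X 1 - X 0 : MvPolynomial (Fin 2) ℂ) ^ (4 * r) = (X 0 - X 1) ^ (4 * r) := by
      rw [← neg_sub, h4r.neg_pow]
    rw [hf]
    simp [Derivation.leibniz, Derivation.leibniz_pow, pderiv_X, e, C_ofNat]
    ring
  have := word_three_swap_left hL f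
  rw [hsk, hd, map_neg, ← smul_eq_C_mul, map_smul] at this
  have := LinearMap.congr_fun this v
  simp only [LinearMap.sub_apply, LinearMap.neg_apply, LinearMap.smul_apply, step2] at this
  rw [neg_zero, sub_zero, eq_comm, smul_eq_zero] at this
  exact this.resolve_left (by norm_num)

end Vanishing

end WittSuper
end

/-! ### Umbral calculus and polynomial growth of the coefficients. -/

noncomputable section

namespace WittSuper

section Umbral

open Polynomial

variable {E : Type*} [Ring E] [Algebra ℂ E]

theorem polyC_ofNat (n : ℕ) [n.AtLeastTwo] :
    (C (ofNat(n) : ℂ) : ℂ[X]) = ofNat(n) := map_ofNat C n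

/-- The linear map sending `X^k` to `γ k`. -/
def umbral (γ : ℕ → E) : ℂ[X] →ₗ[ℂ] E := (basisMonomials ℂ).constr ℂ γ

theorem umbral_X_pow (γ : ℕ → E) (k : ℕ) : umbral γ (X ^ k) = γ k := by
  have := (basisMonomials ℂ).constr_basis ℂ γ k
  rw [coe_basisMonomials] at this
  rw [← monomial_one_right_eq_X_pow]
  exact this

/-- The recursion satisfied by the coefficients of the generating function of a representation of
the Witt algebra on which `∂` is invertible. -/
def IsRec (γ : ℕ → E) (g : E) : Prop :=
  ∀ k : ℕ, (((k : ℂ) - 1) * (k + 2)) • γ (k + 2) + (2 * ((k : ℂ) + 1) * (k - 1)) • γ (k + 1) +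
    ((k : ℂ) * (k - 1)) • γ k + γ (k + 1) * g - g * γ (k + 1) + γ k * g = 0

/-- By linearity only p = X^k matters, where this is the recursion itself. Written with a
differential operator, the recursion can be tested on the powers of any other polynomial. -/
theorem umbral_identity {γ : ℕ → E} {g : E} (h : IsRec γ g) (p : ℂ[X]) :
    umbral γ (X * (1 + X) * (X * (1 + X) * derivative (derivative p) + 2 * X * derivative p -
      2 * p)) + umbral γ ((1 + X) * p) * g - g * umbral γ (X * p) = 0 := by
  induction p using Polynomial.induction_on' with
  | add p q hp hq =>
    have e : umbral γ (X * (1 + X) * (X * (1 + X) * derivative (derivative (p + q)) +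
        2 * X * derivative (p + q) - 2 * (p + q))) + umbral γ ((1 + X) * (p + q)) * g -
        g * umbral γ (X * (p + q)) =
      (umbral γ (X * (1 + X) * (X * (1 + X) * derivative (derivative p) + 2 * X * derivative p -
        2 * p)) + umbral γ ((1 + X) * p) * g - g * umbral γ (X * p)) +
      (umbral γ (X * (1 + X) * (X * (1 + X) * derivative (derivative q) + 2 * X * derivative q -
        2 * q)) + umbral γ ((1 + X) * q) * g - g * umbral γ (X * q)) := by
      simp only [mul_add, add_mul, mul_sub, map_add, map_sub]
      abel
    rw [e, hp, hq, add_zero]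
  | monomial k c =>
    have e1 : (X * (1 + X) * (X * (1 + X) * derivative (derivative (monomial k c)) +
        2 * X * derivative (monomial k c) - 2 * monomial k c) : ℂ[X]) =
        (c * (((k : ℂ) - 1) * (k + 2))) • X ^ (k + 2) +
        (c * (2 * ((k : ℂ) + 1) * (k - 1))) • X ^ (k + 1) + (c * ((k : ℂ) * (k - 1))) • X ^ k := by
      rw [← C_mul_X_pow_eq_monomial]
      simp only [smul_eq_C_mul]
      rcases k with _ | _ | k
      · simp [polyC_ofNat]
        ring
      · simp
        right
        ring
      · simp [polyC_ofNat]
        ring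
    have e2 : ((1 + X) * monomial k c : ℂ[X]) = c • X ^ (k + 1) + c • X ^ k := by
      rw [← C_mul_X_pow_eq_monomial, smul_eq_C_mul, smul_eq_C_mul]
      ring
    have e3 : (X * monomial k c : ℂ[X]) = c • X ^ (k + 1) := by
      rw [← C_mul_X_pow_eq_monomial, smul_eq_C_mul]
      ring
    rw [e1, e2, e3]
    simp only [map_add, map_smul, umbral_X_pow]
    have := congrArg (c • ·) (h k)
    simp only [smul_zero] at this
    rw [← this]
    simp only [smul_add, smul_sub, add_mul, mul_add, smul_mul_assoc, mul_smul_comm, smul_smul]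
    abel

/-- The substitution 1 + 2X moves the zeros 0 and -1 of X(1 + X) to ±1. This symmetric form is
`umbral_identity` at p = (1 + 2X)^(m+2), multiplied by 4; it involves differences of terms two
apart, which is what keeps the growth polynomial. -/
theorem umbral_one_add_two_mul_X_rec {γ : ℕ → E} {g : E} (h : IsRec γ g) {a : ℕ → E}
    (ha : ∀ n, a n = umbral γ ((1 + 2 * X) ^ n)) (m : ℕ) :
    (((m : ℂ) + 4) * (m + 1)) • (a (m + 4) - a (m + 2)) =
      (2 * ((m : ℂ) + 2)) • (a (m + 3) - a (m + 1)) +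
      (((m : ℂ) + 2) * (m + 1)) • (a (m + 2) - a m) +
      (2 : ℂ) • (g * (a (m + 3) - a (m + 2)) - (a (m + 3) + a (m + 2)) * g) := by
  have key := umbral_identity h ((1 + 2 * X) ^ (m + 2))
  have e1 : (X * (1 + X) * (X * (1 + X) * derivative (derivative ((1 + 2 * X) ^ (m + 2))) +
      2 * X * derivative ((1 + 2 * X) ^ (m + 2)) - 2 * (1 + 2 * X) ^ (m + 2)) : ℂ[X]) =
      (1 / 4 : ℂ) • ((((m : ℂ) + 4) * (m + 1)) • ((1 + 2 * X) ^ (m + 4) - (1 + 2 * X) ^ (m + 2)) -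
      (2 * ((m : ℂ) + 2)) • ((1 + 2 * X) ^ (m + 3) - (1 + 2 * X) ^ (m + 1)) -
      (((m : ℂ) + 2) * (m + 1)) • ((1 + 2 * X) ^ (m + 2) - (1 + 2 * X) ^ m)) := by
    have h4 : (C (1 / 4 : ℂ)) * 4 = 1 := by
      rw [← map_ofNat C 4, ← C_mul]; norm_num
    have e4 : ∀ x : ℂ[X], (4 : ℂ[X]) * x = 4 * ((1 / 4 : ℂ) • (4 * x)) := by
      intro x
      rw [smul_eq_C_mul]
      linear_combination (-4 * x) * h4
    refine mul_left_cancel₀ (a := (4 : ℂ[X])) (by norm_num) ?_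
    rw [smul_eq_C_mul, ← mul_assoc (4 : ℂ[X]) (C _), mul_comm (4 : ℂ[X]) (C _), h4, one_mul]
    simp only [smul_eq_C_mul, map_mul, map_add, map_natCast, polyC_ofNat, map_one]
    have d1 : ∀ n : ℕ, derivative ((1 + 2 * X : ℂ[X]) ^ (n + 1)) =
        2 * ((n : ℂ[X]) + 1) * (1 + 2 * X) ^ n := by
      intro n
      rw [derivative_pow]
      simp
      ring
    have d2 : derivative (derivative ((1 + 2 * X : ℂ[X]) ^ (m + 2))) =
        4 * ((m : ℂ[X]) + 2) * ((m : ℂ[X]) + 1) * (1 + 2 * X) ^ m := by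
      rw [d1, show (2 * (((m + 1 : ℕ) : ℂ[X]) + 1)) = C (2 * (((m + 1 : ℕ) : ℂ) + 1)) by
        simp [polyC_ofNat], derivative_C_mul, d1]
      simp [polyC_ofNat]
      ring
    rw [d2, d1]
    push_cast
    ring
  have e2 : ((1 + X) * (1 + 2 * X) ^ (m + 2) : ℂ[X]) =
      (1 / 2 : ℂ) • ((1 + 2 * X) ^ (m + 3) + (1 + 2 * X) ^ (m + 2)) := by
    have h2 : (C (1 / 2 : ℂ)) * 2 = 1 := by
      rw [← map_ofNat C 2, ← C_mul]; norm_num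
    rw [smul_eq_C_mul]
    linear_combination (-(1 + X) * (1 + 2 * X) ^ (m + 2)) * h2
  have e3 : (X * (1 + 2 * X) ^ (m + 2) : ℂ[X]) =
      (1 / 2 : ℂ) • ((1 + 2 * X) ^ (m + 3) - (1 + 2 * X) ^ (m + 2)) := by
    have h2 : (C (1 / 2 : ℂ)) * 2 = 1 := by
      rw [← map_ofNat C 2, ← C_mul]; norm_num
    rw [smul_eq_C_mul]
    linear_combination (-X * (1 + 2 * X) ^ (m + 2)) * h2
  rw [e1, e2, e3] at key
  simp only [map_smul, map_sub, map_add, ← ha] at key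
  simp only [smul_mul_assoc, mul_smul_comm] at key
  have := congrArg ((4 : ℂ) • ·) key
  simp only [smul_add, smul_sub, smul_smul, smul_zero] at this
  rw [← sub_eq_zero, ← this]
  simp only [mul_sub, add_mul]
  module

theorem umbral_one_add_X_pow (γ : ℕ → E) (n : ℕ) :
    umbral γ ((1 + X) ^ n) = ∑ k ∈ Finset.range (n + 1), (n.choose k : ℂ) • γ k := by
  rw [add_comm, add_pow, map_sum]
  refine Finset.sum_congr rfl fun k _ => ?_
  rw [one_pow, mul_one, mul_comm, ← map_natCast C, ← smul_eq_C_mul, map_smul, umbral_X_pow]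

end Umbral

section Growth

variable {E : Type*} [NormedRing E] [NormedAlgebra ℂ E]

/-- If the terms are of size x and the earlier differences of size x/n, the hypotheses give
(n+2)(n-1) c ≤ (n + 1 + 8G) x. So the new difference is again of size x/n, up to a relative error
O(1/n) absorbed by K. -/
theorem growth_step {x G K n : ℝ} (hx : 0 ≤ x) (hG : 0 ≤ G) (hK : K = 4 + 18 * G) (hn : 2 ≤ n)
    {c y1 y2 z : ℝ} (h : (n + 2) * (n - 1) * c ≤ 2 * n * y1 + n * (n - 1) * y2 + 8 * G * z)
    (h1 : n * y1 ≤ x) (h2 : n * y2 ≤ x) (h3 : z ≤ x) :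
    (n + 1) * c ≤ x * (1 + K / (n + 1)) ∧ c ≤ x * (K / (n + 1)) := by
  have hp : 0 < (n + 2) * (n - 1) := by nlinarith
  have h4 : (n + 2) * (n - 1) * c ≤ (n + 1 + 8 * G) * x := by nlinarith
  have hc : c ≤ (n + 1 + 8 * G) * x / ((n + 2) * (n - 1)) := by
    rw [le_div_iff₀ hp]; linarith
  have hn1 : 0 < n + 1 := by linarith
  have hGn : 0 ≤ G * (n - 2) := mul_nonneg hG (by linarith)
  have hGn2 : 0 ≤ G * (n - 2) * (n - 2) := mul_nonneg hGn (by linarith)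
  constructor
  · have : (n + 1) * ((n + 1 + 8 * G) * x / ((n + 2) * (n - 1))) ≤ x * (1 + K / (n + 1)) := by
      rw [mul_div_assoc', div_le_iff₀ hp, one_add_div hn1.ne', mul_div_assoc', div_mul_eq_mul_div,
        le_div_iff₀ hn1, hK]
      have : (n + 1) * (n + 1 + 8 * G) * (n + 1) ≤ (n + 1 + (4 + 18 * G)) * ((n + 2) * (n - 1)) := by
        nlinarith
      calc (n + 1) * ((n + 1 + 8 * G) * x) * (n + 1)
          = x * ((n + 1) * (n + 1 + 8 * G) * (n + 1)) := by ring
        _ ≤ x * ((n + 1 + (4 + 18 * G)) * ((n + 2) * (n - 1))) := mul_le_mul_of_nonneg_left this hx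
        _ = _ := by ring
    exact (mul_le_mul_of_nonneg_left hc hn1.le).trans this
  · refine hc.trans ?_
    rw [div_le_iff₀ hp, mul_div_assoc', div_mul_eq_mul_div, le_div_iff₀ hn1, hK]
    have : (n + 1 + 8 * G) * (n + 1) ≤ (4 + 18 * G) * ((n + 2) * (n - 1)) := by nlinarith
    calc (n + 1 + 8 * G) * x * (n + 1) = x * ((n + 1 + 8 * G) * (n + 1)) := by ring
      _ ≤ x * ((4 + 18 * G) * ((n + 2) * (n - 1))) := mul_le_mul_of_nonneg_left this hx
      _ = _ := by ring

/-- Each step multiplies the bound by 1 + N/(n+1), and the product of these factors is a binomial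
coefficient, hence polynomial in n. -/
theorem exists_growth_bound {a : ℕ → E} {g : E}
    (h : ∀ m : ℕ, (((m : ℂ) + 4) * (m + 1)) • (a (m + 4) - a (m + 2)) =
      (2 * ((m : ℂ) + 2)) • (a (m + 3) - a (m + 1)) +
      (((m : ℂ) + 2) * (m + 1)) • (a (m + 2) - a m) +
      (2 : ℂ) • (g * (a (m + 3) - a (m + 2)) - (a (m + 3) + a (m + 2)) * g)) :
    ∃ A : ℝ, ∃ N : ℕ, 0 ≤ A ∧ ∀ n, ‖a n‖ ≤ A * ((n + N).choose N : ℝ) := by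
  obtain ⟨N, hN⟩ := exists_nat_ge (4 + 18 * ‖g‖)
  -- The bound on the norm of g is enlarged until the constant of `growth_step` is an integer.
  obtain ⟨G, hG⟩ : ∃ G : ℝ, (N : ℝ) = 4 + 18 * G := ⟨(N - 4) / 18, by ring⟩
  have hgG : ‖g‖ ≤ G := by linarith
  have hG0 : 0 ≤ G := (norm_nonneg g).trans hgG
  set A : ℝ := 8 * (‖a 0‖ + ‖a 1‖ + ‖a 2‖ + ‖a 3‖) with hA
  have hA0 : 0 ≤ A := by positivity
  set B : ℕ → ℝ := fun n => ((n + N).choose N : ℝ) with hB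
  have hB1 : ∀ n, 1 ≤ B n := fun n => by
    simp only [hB]
    exact_mod_cast Nat.succ_le_of_lt (Nat.choose_pos (by omega))
  have hBs : ∀ n : ℕ, B (n + 1) = B n * (1 + N / ((n : ℝ) + 1)) := by
    intro n
    have h1 := Nat.add_one_mul_choose_eq (n + N) n
    have e1 : (n + N).choose n = (n + N).choose N := by
      rw [← Nat.choose_symm (by omega : N ≤ n + N)]; congr 1; omega
    have e2 : (n + N).succ.choose n.succ = (n + 1 + N).choose N := by
      rw [← Nat.choose_symm (by omega : N ≤ n + 1 + N)]; congr 1 <;> omega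
    rw [e1, e2] at h1
    have h2 : ((n : ℝ) + N + 1) * B n = B (n + 1) * (n + 1) := by
      simp only [hB]; exact_mod_cast h1
    field_simp
    linarith
  refine ⟨A, N, hA0, ?_⟩
  -- Sizes and differences are bounded together, since each of the two bounds feeds the other.
  have key : ∀ n : ℕ, (∀ k ≤ n + 3, ‖a k‖ ≤ A * B (n + 2)) ∧
      (∀ k ≤ n + 1, ((n : ℝ) + 2) * ‖a (k + 2) - a k‖ ≤ A * B (n + 2)) := by
    intro n
    induction n with
    | zero =>
      have hAB : A ≤ A * B 2 := le_mul_of_one_le_right hA0 (hB1 2)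
      have h0 := norm_nonneg (a 0)
      have h1 := norm_nonneg (a 1)
      have h2 := norm_nonneg (a 2)
      have h3 := norm_nonneg (a 3)
      constructor
      · intro k hk
        refine le_trans ?_ hAB
        interval_cases k <;> linarith
      · intro k hk
        refine le_trans ?_ hAB
        have := norm_sub_le (a (k + 2)) (a k)
        push_cast
        interval_cases k <;> simp only [Nat.zero_add, Nat.reduceAdd] at this ⊢ <;> linarith
    | succ n ih =>
      obtain ⟨ih1, ih2⟩ := ih
      have hx : 0 ≤ A * B (n + 2) := mul_nonneg hA0 (zero_le_one.trans (hB1 _))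
      have hstep : A * B (n + 1 + 2) = A * B (n + 2) * (1 + N / ((n : ℝ) + 2 + 1)) := by
        have := hBs (n + 2)
        push_cast at this
        rw [show n + 1 + 2 = n + 2 + 1 by ring, this, ← mul_assoc]
      have hineq : ((n : ℝ) + 2 + 2) * (n + 2 - 1) * ‖a (n + 4) - a (n + 2)‖ ≤
          2 * ((n : ℝ) + 2) * ‖a (n + 3) - a (n + 1)‖ +
          ((n : ℝ) + 2) * (n + 2 - 1) * ‖a (n + 2) - a n‖ + 8 * G * (A * B (n + 2)) := by
        have h1 := congrArg norm (h n)
        have c1 : ‖(((n : ℂ) + 4) * (n + 1))‖ = ((n : ℝ) + 2 + 2) * (n + 2 - 1) := by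
          have : (((n : ℂ) + 4) * (n + 1)) = (((n + 4) * (n + 1) : ℕ) : ℂ) := by push_cast; ring
          rw [this, Complex.norm_natCast]; push_cast; ring
        have c2 : ‖(2 * ((n : ℂ) + 2))‖ = 2 * ((n : ℝ) + 2) := by
          have : (2 * ((n : ℂ) + 2)) = ((2 * (n + 2) : ℕ) : ℂ) := by push_cast; ring
          rw [this, Complex.norm_natCast]; push_cast; ring
        have c3 : ‖(((n : ℂ) + 2) * (n + 1))‖ = ((n : ℝ) + 2) * (n + 2 - 1) := by
          have : (((n : ℂ) + 2) * (n + 1)) = (((n + 2) * (n + 1) : ℕ) : ℂ) := by push_cast; ring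
          rw [this, Complex.norm_natCast]; push_cast; ring
        rw [norm_smul, c1] at h1
        rw [h1]
        refine (norm_add_le _ _).trans (add_le_add ((norm_add_le _ _).trans ?_) ?_)
        · rw [norm_smul, norm_smul, c2, c3]
        · rw [norm_smul]
          have h3 := ih1 (n + 3) le_rfl
          have h2 := ih1 (n + 2) (by omega)
          have n1 : ‖g * (a (n + 3) - a (n + 2))‖ ≤ G * (2 * (A * B (n + 2))) :=
            (norm_mul_le _ _).trans (mul_le_mul hgG ((norm_sub_le _ _).trans (by linarith))
              (norm_nonneg _) hG0)
          have n2 : ‖(a (n + 3) + a (n + 2)) * g‖ ≤ (2 * (A * B (n + 2))) * G :=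
            (norm_mul_le _ _).trans (mul_le_mul ((norm_add_le _ _).trans (by linarith)) hgG
              (norm_nonneg _) (by positivity))
          have n3 := norm_sub_le (g * (a (n + 3) - a (n + 2))) ((a (n + 3) + a (n + 2)) * g)
          simp only [RCLike.norm_ofNat]
          nlinarith
      obtain ⟨r1, r2⟩ := growth_step hx hG0 hG (by linarith [n.cast_nonneg (α := ℝ)]) hineq
        (ih2 (n + 1) le_rfl) (ih2 n (by omega)) le_rfl
      have hN4 : (4 : ℝ) ≤ N := by rw [hG]; linarith
      have hle : A * B (n + 2) ≤ A * B (n + 1 + 2) := by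
        rw [hstep]
        refine le_mul_of_one_le_right hx ?_
        have : (0 : ℝ) ≤ N / ((n : ℝ) + 2 + 1) := by positivity
        linarith
      constructor
      · intro k hk
        rcases Nat.lt_or_ge k (n + 4) with h4 | h4
        · exact (ih1 k (by omega)).trans hle
        · obtain rfl : k = n + 4 := by omega
          have e : a (n + 4) = a (n + 2) + (a (n + 4) - a (n + 2)) := by abel
          rw [e, hstep, mul_add, mul_one]
          exact (norm_add_le _ _).trans (add_le_add (ih1 _ (by omega)) r2)
      · intro k hk
        push_cast
        rcases Nat.lt_or_ge k (n + 2) with h4 | h4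
        · have h5 := ih2 k (by omega)
          have hpos : (0 : ℝ) < (n : ℝ) + 2 := by positivity
          have h6 : ‖a (k + 2) - a k‖ ≤ A * B (n + 2) * (N / ((n : ℝ) + 2 + 1)) := by
            have : ‖a (k + 2) - a k‖ ≤ A * B (n + 2) / ((n : ℝ) + 2) := by
              rw [le_div_iff₀ hpos]; linarith
            refine this.trans ?_
            rw [div_eq_mul_one_div]
            refine mul_le_mul_of_nonneg_left ?_ hx
            rw [div_le_div_iff₀ hpos (by positivity)]
            nlinarith
          rw [hstep]
          nlinarith
        · obtain rfl : k = n + 2 := by omega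
          rw [hstep]
          convert r1 using 2
          ring
  intro n
  rcases Nat.lt_or_ge n 2 with h2 | h2
  · have hB0 : A ≤ A * B n := le_mul_of_one_le_right hA0 (hB1 n)
    refine le_trans ?_ hB0
    have h0 := norm_nonneg (a 0)
    have h1 := norm_nonneg (a 1)
    have h2 := norm_nonneg (a 2)
    have h3 := norm_nonneg (a 3)
    interval_cases n <;> linarith
  · obtain ⟨m, rfl⟩ := Nat.exists_eq_add_of_le' h2
    exact (key m).1 _ (by omega)

end Growth

end WittSuper
end

/-! ### Summation after an affine substitution, products of series, Cauchy estimates. -/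

noncomputable section

namespace WittSuper

theorem hasSum_of_eq {ι α : Type*} [AddCommMonoid α] [TopologicalSpace α] {f g : ι → α} {a b : α}
    (h : HasSum f a) (hf : ∀ i, g i = f i) (hb : b = a) : HasSum g b := by
  rw [hb, funext hf]
  exact h

section Transform

open Finset

variable {E : Type*} [NormedRing E] [NormedAlgebra ℂ E] [CompleteSpace E]

/-- This is the expansion 1/(1 - u - v s) = ∑ v^j s^j / (1 - u)^(j+1) with s^j replaced by a_j. The
double series converges absolutely: for fixed j it is a negative binomial series in u, and
regrouping it along antidiagonals gives the left side. -/
theorem hasSum_affine_transform {a : ℕ → E} {u v : ℂ} (hu : ‖u‖ < 1)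
    (hs : Summable fun j => ‖a j‖ * (‖v‖ / (1 - ‖u‖)) ^ j) :
    (Summable fun n => ‖∑ p ∈ antidiagonal n, ((n.choose p.1 : ℂ) * u ^ p.1 * v ^ p.2) • a p.2‖) ∧
    HasSum (fun n => ∑ p ∈ antidiagonal n, ((n.choose p.1 : ℂ) * u ^ p.1 * v ^ p.2) • a p.2)
      ((1 / (1 - u)) • ∑' j, (v / (1 - u)) ^ j • a j) := by
  set F : ℕ × ℕ → E := fun p => (((p.1 + p.2).choose p.1 : ℂ) * u ^ p.1 * v ^ p.2) • a p.2 with hF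
  have hchoose : ∀ n j : ℕ, (n + j).choose n = (n + j).choose j := fun n j => by
    rw [← Nat.choose_symm (by omega : j ≤ n + j)]; congr 1; omega
  have hu1 : (1 : ℝ) - ‖u‖ ≠ 0 := by linarith
  have hu2 : 1 - u ≠ 0 := by
    intro h
    rw [← sub_eq_zero.1 h, norm_one] at hu
    exact lt_irrefl _ hu
  have hnorm : ∀ j : ℕ, HasSum (fun n => ‖F (n, j)‖)
      ((1 / (1 - ‖u‖)) * (‖a j‖ * (‖v‖ / (1 - ‖u‖)) ^ j)) := by
    intro j
    have h1 := (hasSum_choose_mul_geometric_of_norm_lt_one j (r := ‖u‖) (by simpa using hu)).mul_right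
      (‖v‖ ^ j * ‖a j‖)
    refine hasSum_of_eq h1 (fun n => ?_) ?_
    · simp only [hF, norm_smul, norm_mul, norm_pow, Complex.norm_natCast, hchoose]
      ring
    · rw [div_pow, pow_succ]
      field_simp
  have hsum : ∀ j : ℕ, HasSum (fun n => F (n, j)) ((1 / (1 - u)) • (v / (1 - u)) ^ j • a j) := by
    intro j
    have h1 := ((hasSum_choose_mul_geometric_of_norm_lt_one j hu).mul_right (v ^ j)).smul_const (a j)
    refine hasSum_of_eq h1 (fun n => ?_) ?_
    · simp only [hF, hchoose]
    · rw [smul_smul, div_pow, pow_succ]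
      congr 1
      field_simp
  have hFs : Summable fun p : ℕ × ℕ => ‖F p.swap‖ := by
    rw [summable_prod_of_nonneg fun p => norm_nonneg _]
    refine ⟨fun j => (hnorm j).summable, ?_⟩
    simp only [Prod.swap_prod_mk, (hnorm _).tsum_eq]
    exact hs.mul_left _
  have hFs' : Summable fun p : ℕ × ℕ => ‖F p‖ := by
    have := (Equiv.prodComm ℕ ℕ).summable_iff.2 hFs
    exact this
  have htot : HasSum F ((1 / (1 - u)) • ∑' j, (v / (1 - u)) ^ j • a j) := by
    have h1 : Summable fun p : ℕ × ℕ => F p.swap := hFs.of_norm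
    have h2 := h1.hasSum.prod_fiberwise hsum
    have h3 : HasSum (fun p : ℕ × ℕ => F p.swap) (∑' j, (1 / (1 - u)) • (v / (1 - u)) ^ j • a j) := by
      rw [h2.tsum_eq]; exact h1.hasSum
    rw [tsum_const_smul''] at h3
    have := (Equiv.prodComm ℕ ℕ).hasSum_iff.2 h3
    exact this
  have hanti : ∀ n, ∑ p ∈ antidiagonal n, ((n.choose p.1 : ℂ) * u ^ p.1 * v ^ p.2) • a p.2 =
      ∑ p ∈ antidiagonal n, F p := fun n => sum_congr rfl fun p hp => by
    simp only [hF, mem_antidiagonal.1 hp]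
  constructor
  · have h1 := (HasAntidiagonal.sigmaAntidiagonalEquivProd (A := ℕ)).summable_iff.2 hFs'
    refine Summable.of_nonneg_of_le (fun _ => norm_nonneg _) (fun n => ?_) h1.sigma
    rw [hanti]
    refine (norm_sum_le _ _).trans (le_of_eq ?_)
    rw [tsum_fintype, ← Finset.sum_coe_sort]
    rfl
  · have h1 := (HasAntidiagonal.sigmaAntidiagonalEquivProd (A := ℕ)).hasSum_iff.2 htot
    refine h1.sigma fun n => ?_
    rw [hanti, ← Finset.sum_coe_sort]
    exact hasSum_fintype _

end Transform

section PowerSeries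

open PowerSeries

variable {E : Type*} [NormedRing E] [NormedAlgebra ℂ E]

theorem hasSum_one_sub_X_mul {p : E⟦X⟧} {w : ℂ} {s : E}
    (h : HasSum (fun n => w ^ n • coeff n p) s) :
    HasSum (fun n => w ^ n • coeff n ((1 - X) * p)) ((1 - w) • s) := by
  have h1 : HasSum (fun n => w ^ n • coeff n (X * p)) (w • s) := by
    have h2 := (hasSum_nat_add_iff (f := fun n => w ^ n • coeff n (X * p)) (g := w • s) 1).1
      (hasSum_of_eq (h.const_smul w) (fun n => by rw [coeff_succ_X_mul, pow_succ', mul_smul]) rfl)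
    simpa using h2
  refine hasSum_of_eq (h.sub h1) (fun n => ?_) ?_
  · rw [sub_mul, one_mul, map_sub, smul_sub]
  · rw [sub_smul, one_smul]

theorem hasSum_coeff_mul [CompleteSpace E] {p q : E⟦X⟧} {w : ℂ} {s t : E}
    (hp : HasSum (fun n => w ^ n • coeff n p) s) (hq : HasSum (fun n => w ^ n • coeff n q) t)
    (hp' : Summable fun n => ‖w ^ n • coeff n p‖) (hq' : Summable fun n => ‖w ^ n • coeff n q‖) :
    HasSum (fun n => w ^ n • coeff n (p * q)) (s * t) := by
  have h1 := tsum_mul_tsum_eq_tsum_sum_antidiagonal_of_summable_norm hp' hq'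
  have h2 := (summable_norm_sum_mul_antidiagonal_of_summable_norm hp' hq').of_norm.hasSum
  rw [← h1, hp.tsum_eq, hq.tsum_eq] at h2
  refine hasSum_of_eq h2 (fun n => ?_) rfl
  rw [coeff_mul, Finset.smul_sum]
  refine Finset.sum_congr rfl fun x hx => ?_
  rw [smul_mul_smul_comm, ← pow_add, Finset.HasAntidiagonal.mem_antidiagonal.1 hx]

end PowerSeries

section Taylor

open Filter Topology

variable {E : Type*} [NormedAddCommGroup E] [NormedSpace ℂ E] [CompleteSpace E]

/-- Taylor coefficients of an entire function of polynomial growth vanish eventually. -/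
theorem coeff_eq_zero_of_growth {f : ℂ → E} {h : ℕ → E} {C : ℝ} {N : ℕ}
    (hf : Differentiable ℂ f) (hsum : ∀ᶠ w in 𝓝 (0 : ℂ), HasSum (fun n => w ^ n • h n) (f w))
    (hb : ∀ R : ℝ, 1 ≤ R → ∀ w : ℂ, ‖w‖ = R → ‖f w‖ ≤ C * R ^ N) {n : ℕ} (hn : N < n) :
    h n = 0 := by
  let p : FormalMultilinearSeries ℂ ℂ E := fun n =>
    ContinuousMultilinearMap.mkPiRing ℂ (Fin n) (h n)
  have hpn : ∀ n, p n 1 = h n := fun n => by simp [p]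
  have hp : HasFPowerSeriesAt f p 0 := by
    refine hasFPowerSeriesAt_iff.2 ?_
    filter_upwards [hsum] with w hw
    rw [zero_add]
    exact hasSum_of_eq hw (fun n => by rw [FormalMultilinearSeries.coeff, hpn]) rfl
  obtain ⟨r, hr⟩ := hp
  have h1 := hr.factorial_smul (1 : ℂ) n
  rw [← iteratedDeriv_eq_iteratedFDeriv] at h1
  replace h1 : n.factorial • h n = iteratedDeriv n f 0 := by rw [← h1, ← hpn]; rfl
  -- Cauchy's estimate on the circle of radius R, with n ≥ N + 1; then R tends to infinity.
  have h2 : ∀ R : ℝ, 1 ≤ R → ‖h n‖ ≤ C * R⁻¹ := by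
    intro R hR
    have hR0 : 0 < R := by linarith
    have hC : 0 ≤ C := by
      have := (norm_nonneg _).trans (hb R hR R (by simp [abs_of_pos hR0]))
      exact nonneg_of_mul_nonneg_left this (by positivity)
    have h3 := Complex.norm_iteratedDeriv_le_of_forall_mem_sphere_norm_le (c := 0) (R := R)
      (C := C * R ^ N) (f := f) n hR0 hf.diffContOnCl
      (fun z hz => hb R hR z (by simpa using hz))
    rw [← h1, ← Nat.cast_smul_eq_nsmul ℝ, norm_smul, Real.norm_natCast, mul_div_assoc] at h3
    have h4 := le_of_mul_le_mul_left h3 (by exact_mod_cast n.factorial_pos)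
    refine h4.trans ?_
    rw [mul_div_assoc]
    refine mul_le_mul_of_nonneg_left ?_ hC
    rw [div_le_iff₀ (by positivity), ← div_eq_inv_mul, le_div_iff₀ hR0, ← pow_succ]
    exact pow_le_pow_right₀ hR hn
  have h5 : Tendsto (fun R : ℝ => C * R⁻¹) atTop (𝓝 0) := by
    simpa using tendsto_inv_atTop_zero.const_mul C
  have h6 : ‖h n‖ ≤ 0 := ge_of_tendsto h5 ((eventually_ge_atTop 1).mono h2)
  exact norm_le_zero_iff.1 h6

end Taylor

end WittSuper
end

/-! ### Analytic continuation and polynomiality of the Witt series. -/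

noncomputable section

namespace WittSuper

section Disk

open Filter Topology Metric

variable {E : Type*} [NormedRing E] {a : ℕ → E} {A : ℝ} {N : ℕ}

theorem summable_norm_of_growth (ha : ∀ n, ‖a n‖ ≤ A * ((n + N).choose N : ℝ)) {ρ : ℝ}
    (h0 : 0 ≤ ρ) (h1 : ρ < 1) : Summable fun j => ‖a j‖ * ρ ^ j := by
  have h := (summable_choose_mul_geometric_of_norm_lt_one N (r := ρ)
    (by rwa [Real.norm_of_nonneg h0])).mul_left A
  refine Summable.of_nonneg_of_le (fun j => by positivity) (fun j => ?_) h
  rw [← mul_assoc]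
  exact mul_le_mul_of_nonneg_right (ha j) (by positivity)

variable [NormedAlgebra ℂ E]

theorem norm_tsum_le_of_growth (ha : ∀ n, ‖a n‖ ≤ A * ((n + N).choose N : ℝ)) {q : ℂ}
    (hq : ‖q‖ < 1) : ‖∑' n, q ^ n • a n‖ ≤ A / (1 - ‖q‖) ^ (N + 1) := by
  have h := (hasSum_choose_mul_geometric_of_norm_lt_one N (r := ‖q‖)
    (by rwa [norm_norm])).mul_left A
  rw [mul_one_div] at h
  refine tsum_of_norm_bounded h fun j => ?_
  rw [norm_smul, norm_pow, mul_comm, ← mul_assoc]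
  exact mul_le_mul_of_nonneg_right (ha j) (by positivity)

theorem differentiableAt_tsum_of_growth [CompleteSpace E]
    (ha : ∀ n, ‖a n‖ ≤ A * ((n + N).choose N : ℝ)) {q : ℂ}
    (hq : ‖q‖ < 1) : DifferentiableAt ℂ (fun q : ℂ => ∑' n, q ^ n • a n) q := by
  obtain ⟨ρ, h1, h2⟩ := exists_between hq
  have h0 : 0 ≤ ρ := (norm_nonneg q).trans h1.le
  have h := Complex.differentiableOn_tsum_of_summable_norm (F := fun n (q : ℂ) => q ^ n • a n)
    (U := ball 0 ρ) (summable_norm_of_growth ha h0 h2) (fun n => by fun_prop) isOpen_ball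
    (fun n w hw => by
      rw [norm_smul, norm_pow, mul_comm]
      refine mul_le_mul_of_nonneg_left (pow_le_pow_left₀ (norm_nonneg _) ?_ _) (norm_nonneg _)
      exact (mem_ball_zero_iff.1 hw).le)
  exact h.differentiableAt (isOpen_ball.mem_nhds (by simpa using h1))

end Disk

section WittSeries

open Filter Topology

variable {E : Type*} [NormedRing E] [NormedAlgebra ℂ E] {a : ℕ → E} {A : ℝ} {N : ℕ}

/-- The series `(1 - X)² D(X) G(-X)`, where `G` is the generating function of `γ` and `D` that of
its binomial transform. -/
def wittSeries {E : Type*} [Ring E] [Algebra ℂ E] (γ : ℕ → E) : PowerSeries E :=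
  (1 - PowerSeries.X) * ((1 - PowerSeries.X) *
    ((PowerSeries.mk fun n => ∑ k ∈ Finset.range (n + 1), (n.choose k : ℂ) • γ k) *
      (PowerSeries.mk fun n => (-1 : ℂ) ^ n • γ n)))

theorem hasSum_umbral_affine [CompleteSpace E] {γ : ℕ → E} (ha : ∀ n, a n = umbral γ ((1 + 2 * Polynomial.X) ^ n))
    (hA : ∀ n, ‖a n‖ ≤ A * ((n + N).choose N : ℝ)) {p : Polynomial ℂ} {u v w : ℂ}
    (hp : w • p = Polynomial.C u + Polynomial.C v * (1 + 2 * Polynomial.X)) (huv : ‖u‖ + ‖v‖ < 1) :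
    (Summable fun n => ‖w ^ n • umbral γ (p ^ n)‖) ∧
      HasSum (fun n => w ^ n • umbral γ (p ^ n))
        ((1 / (1 - u)) • ∑' j, (v / (1 - u)) ^ j • a j) := by
  have hu : ‖u‖ < 1 := by linarith [norm_nonneg v]
  have h1 : ‖v‖ / (1 - ‖u‖) < 1 := by rw [div_lt_one (by linarith)]; linarith
  have h := hasSum_affine_transform hu (summable_norm_of_growth hA
    (div_nonneg (norm_nonneg v) (by linarith)) h1)
  have e : ∀ n, w ^ n • umbral γ (p ^ n) = ∑ p ∈ Finset.HasAntidiagonal.antidiagonal n,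
      ((n.choose p.1 : ℂ) * u ^ p.1 * v ^ p.2) • a p.2 := by
    intro n
    rw [← map_smul, ← smul_pow, hp, (Commute.all _ _).add_pow', map_sum]
    refine Finset.sum_congr rfl fun x _ => ?_
    rw [mul_pow, ← Polynomial.C_pow, ← Polynomial.C_pow, ← mul_assoc, ← Polynomial.C_mul,
      ← Polynomial.smul_eq_C_mul, ← Nat.cast_smul_eq_nsmul ℂ, smul_smul, map_smul, ha, mul_assoc]
  simp only [e]
  exact h

/-- With q = w/(2 - w), both 1 - w(1 + X) and 1 + wX equal (2 - w)/2 times 1 ∓ q(1 + 2X). Hence the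
two factors of the series are 2/(2 - w) times the generating function of a at q and at -q. -/
theorem hasSum_wittSeries [CompleteSpace E] {γ : ℕ → E} (ha : ∀ n, a n = umbral γ ((1 + 2 * Polynomial.X) ^ n))
    (hA : ∀ n, ‖a n‖ ≤ A * ((n + N).choose N : ℝ)) {w : ℂ} (hw : ‖w‖ < 1) :
    HasSum (fun n => w ^ n • PowerSeries.coeff n (wittSeries γ))
      ((2 * (1 - w) / (2 - w)) ^ 2 •
        ((∑' j, (w / (2 - w)) ^ j • a j) * ∑' j, (-(w / (2 - w))) ^ j • a j)) := by
  have hw2 : 2 - w ≠ 0 := by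
    intro h
    rw [← sub_eq_zero.1 h] at hw
    norm_num at hw
  have h2 : ‖w / 2‖ = ‖w‖ / 2 := by simp
  obtain ⟨d1, d2⟩ := hasSum_umbral_affine ha hA (p := 1 + Polynomial.X) (u := w / 2) (v := w / 2)
    (w := w) (by
      have h2 : (Polynomial.C (w / 2)) * 2 = Polynomial.C w := by
        rw [← polyC_ofNat 2, ← Polynomial.C_mul]; congr 1; ring
      rw [Polynomial.smul_eq_C_mul, ← h2]; ring) (by rw [h2]; linarith)
  obtain ⟨g1, g2⟩ := hasSum_umbral_affine ha hA (p := Polynomial.X) (u := w / 2) (v := -(w / 2))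
    (w := -w) (by
      have h2 : (Polynomial.C (w / 2)) * 2 = Polynomial.C w := by
        rw [← polyC_ofNat 2, ← Polynomial.C_mul]; congr 1; ring
      rw [Polynomial.smul_eq_C_mul, Polynomial.C_neg, Polynomial.C_neg, ← h2]; ring)
    (by rw [norm_neg, h2]; linarith)
  simp only [umbral_one_add_X_pow] at d1 d2
  have eg : ∀ n : ℕ, (-w) ^ n • umbral γ (Polynomial.X ^ n) = w ^ n • (-1 : ℂ) ^ n • γ n := by
    intro n
    rw [umbral_X_pow, smul_smul, ← mul_pow, mul_neg_one]
  simp only [eg] at g1 g2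
  have h := hasSum_one_sub_X_mul (hasSum_one_sub_X_mul (hasSum_coeff_mul
    (p := PowerSeries.mk fun n => ∑ k ∈ Finset.range (n + 1), (n.choose k : ℂ) • γ k)
    (q := PowerSeries.mk fun n => (-1 : ℂ) ^ n • γ n)
    (by simpa only [PowerSeries.coeff_mk] using d2) (by simpa only [PowerSeries.coeff_mk] using g2)
    (by simpa only [PowerSeries.coeff_mk] using d1)
    (by simpa only [PowerSeries.coeff_mk] using g1)))
  refine hasSum_of_eq h (fun n => rfl) ?_
  have e1 : 1 - w / 2 = (2 - w) / 2 := by ring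
  have e2 : w / 2 / ((2 - w) / 2) = w / (2 - w) := by field_simp
  have e3 : -(w / 2) / ((2 - w) / 2) = -(w / (2 - w)) := by field_simp
  rw [e1, e2, e3, smul_mul_smul_comm, smul_smul, smul_smul]
  congr 1
  field_simp

/-- The point 2 is the reflection of 0 in the line Re w = 1, so w is closer to 0 than to 2. Thus the
closed form of `hasSum_wittSeries` makes sense on this whole half-plane. -/
theorem norm_div_two_sub {w : ℂ} (hw : w.re < 1) : ‖w / (2 - w)‖ < 1 := by
  have h2 : 2 - w ≠ 0 := by
    intro h
    rw [← sub_eq_zero.1 h] at hw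
    norm_num at hw
  rw [norm_div, div_lt_one (norm_pos_iff.2 h2), ← sq_lt_sq₀ (norm_nonneg _) (norm_nonneg _),
    Complex.sq_norm, Complex.sq_norm, Complex.normSq_apply, Complex.normSq_apply]
  simp
  nlinarith

/-- From |q|² = 1 - (4 - 4 Re w)/|2 - w|² and 1 - |q|² ≤ 2(1 - |q|). It keeps 1/(1 - |q|) polynomial
in |w| on the left half-plane. -/
theorem one_sub_norm_div_two_sub {w : ℂ} (hw : w.re ≤ 0) :
    2 / ‖2 - w‖ ^ 2 ≤ 1 - ‖w / (2 - w)‖ := by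
  have h2 : 2 - w ≠ 0 := by
    intro h
    rw [← sub_eq_zero.1 h] at hw
    norm_num at hw
  have h1 := norm_div_two_sub (hw.trans_lt one_pos)
  have h3 : ‖w / (2 - w)‖ ^ 2 = 1 - (4 - 4 * w.re) / ‖2 - w‖ ^ 2 := by
    have h5 : ‖2 - w‖ ^ 2 ≠ 0 := by positivity
    rw [norm_div, div_pow, eq_sub_iff_add_eq, ← add_div, div_eq_one_iff_eq h5,
      Complex.sq_norm, Complex.sq_norm, Complex.normSq_apply, Complex.normSq_apply]
    simp
    ring
  have h4 : (4 : ℝ) / ‖2 - w‖ ^ 2 ≤ (4 - 4 * w.re) / ‖2 - w‖ ^ 2 := by gcongr; linarith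
  have h5 : (4 : ℝ) / ‖2 - w‖ ^ 2 = 2 * (2 / ‖2 - w‖ ^ 2) := by ring
  nlinarith [norm_nonneg (w / (2 - w))]

theorem norm_wittSeries_le (hA0 : 0 ≤ A) (hA : ∀ n, ‖a n‖ ≤ A * ((n + N).choose N : ℝ)) {w : ℂ}
    (hw : w.re ≤ 0) {R : ℝ} (hR : 1 ≤ R) (hwR : ‖w‖ = R) :
    ‖(2 * (1 - w) / (2 - w)) ^ 2 •
        ((∑' j, (w / (2 - w)) ^ j • a j) * ∑' j, (-(w / (2 - w))) ^ j • a j)‖ ≤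
      4 * (A * 9 ^ (N + 1)) ^ 2 * R ^ (4 * N + 4) := by
  have h2 : 2 - w ≠ 0 := by
    intro h
    rw [← sub_eq_zero.1 h] at hw
    norm_num at hw
  have h2n : 0 < ‖2 - w‖ := norm_pos_iff.2 h2
  have hq := norm_div_two_sub (hw.trans_lt one_pos)
  have hlow := one_sub_norm_div_two_sub hw
  have h3 : ‖2 - w‖ ≤ 3 * R := by
    refine (norm_sub_le _ _).trans ?_
    rw [hwR, RCLike.norm_ofNat]
    linarith
  have hb : A / (1 - ‖w / (2 - w)‖) ^ (N + 1) ≤ A * 9 ^ (N + 1) * R ^ (2 * N + 2) := by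
    rw [div_eq_mul_inv, mul_assoc, ← inv_pow]
    refine mul_le_mul_of_nonneg_left ?_ hA0
    have e : (9 : ℝ) ^ (N + 1) * R ^ (2 * N + 2) = (9 * R ^ 2) ^ (N + 1) := by
      rw [mul_pow, ← pow_mul, mul_add, mul_one]
    rw [e]
    have hpos : 0 < 1 - ‖w / (2 - w)‖ := by linarith
    refine pow_le_pow_left₀ (inv_nonneg.2 hpos.le) ?_ _
    rw [inv_le_comm₀ hpos (by positivity)]
    refine le_trans ?_ hlow
    rw [inv_eq_one_div, div_le_div_iff₀ (by positivity) (by positivity)]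
    nlinarith
  have hs : ‖(2 * (1 - w) / (2 - w)) ^ 2‖ ≤ 4 := by
    have : ‖1 - w‖ ≤ ‖2 - w‖ := by
      rw [← sq_le_sq₀ (norm_nonneg _) (norm_nonneg _), Complex.sq_norm, Complex.sq_norm,
        Complex.normSq_apply, Complex.normSq_apply]
      simp
      nlinarith
    have h5 : ‖2 * (1 - w) / (2 - w)‖ ≤ 2 := by
      rw [norm_div, norm_mul, RCLike.norm_ofNat, div_le_iff₀ h2n]
      linarith
    rw [norm_pow]
    calc ‖2 * (1 - w) / (2 - w)‖ ^ 2 ≤ 2 ^ 2 := pow_le_pow_left₀ (norm_nonneg _) h5 _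
      _ = 4 := by norm_num
  have t1 := (norm_tsum_le_of_growth hA hq).trans hb
  have t2 := norm_tsum_le_of_growth hA (q := -(w / (2 - w))) (by rwa [norm_neg])
  rw [norm_neg] at t2
  replace t2 := t2.trans hb
  rw [norm_smul]
  calc _ ≤ 4 * (A * 9 ^ (N + 1) * R ^ (2 * N + 2) * (A * 9 ^ (N + 1) * R ^ (2 * N + 2))) := by
        refine mul_le_mul hs ((norm_mul_le _ _).trans ?_) (norm_nonneg _) (by norm_num)
        exact mul_le_mul t1 t2 (norm_nonneg _) (by positivity)
    _ = _ := by ring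

theorem differentiableAt_wittSeries [CompleteSpace E]
    (hA : ∀ n, ‖a n‖ ≤ A * ((n + N).choose N : ℝ)) {w : ℂ}
    (hw : w.re < 1) : DifferentiableAt ℂ (fun w : ℂ => (2 * (1 - w) / (2 - w)) ^ 2 •
        ((∑' j, (w / (2 - w)) ^ j • a j) * ∑' j, (-(w / (2 - w))) ^ j • a j)) w := by
  have h2 : 2 - w ≠ 0 := by
    intro h
    rw [← sub_eq_zero.1 h] at hw
    norm_num at hw
  have hq := norm_div_two_sub hw
  have hd : DifferentiableAt ℂ (fun w : ℂ => w / (2 - w)) w := by fun_prop (disch := exact h2)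
  have d1 := (differentiableAt_tsum_of_growth hA hq).comp w hd
  have d2 := (differentiableAt_tsum_of_growth hA (q := -(w / (2 - w))) (by rwa [norm_neg])).comp w
    hd.neg
  have d0 : DifferentiableAt ℂ (fun w : ℂ => (2 * (1 - w) / (2 - w)) ^ 2) w := by
    fun_prop (disch := exact h2)
  exact d0.smul (d1.mul d2)

/-- If the odd coefficients of the Witt series vanish, the series is a polynomial. -/
theorem exists_coeff_wittSeries_eq_zero [CompleteSpace E] {γ : ℕ → E} {g : E} (h : IsRec γ g)
    (h1 : PowerSeries.coeff 1 (wittSeries γ) = -1)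
    (hodd : ∀ r, 3 ≤ r → Odd r → PowerSeries.coeff r (wittSeries γ) = 0) :
    ∃ R, ∀ r, R < r → PowerSeries.coeff r (wittSeries γ) = 0 := by
  obtain ⟨A, N, hA0, hA⟩ := exists_growth_bound
    (a := fun n => umbral γ ((1 + 2 * Polynomial.X) ^ n)) (g := g)
    (umbral_one_add_two_mul_X_rec h fun n => rfl)
  set a : ℕ → E := fun n => umbral γ ((1 + 2 * Polynomial.X) ^ n) with ha
  set H : ℂ → E := fun w : ℂ => (2 * (1 - w) / (2 - w)) ^ 2 •
        ((∑' j, (w / (2 - w)) ^ j • a j) * ∑' j, (-(w / (2 - w))) ^ j • a j) with hH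
  have hHs : ∀ w : ℂ, ‖w‖ < 1 →
      HasSum (fun n => w ^ n • PowerSeries.coeff n (wittSeries γ)) (H w) :=
    fun w hw => hasSum_wittSeries (fun n => rfl) hA hw
  have hHd : ∀ w : ℂ, w.re < 1 → DifferentiableAt ℂ H w := fun w hw =>
    differentiableAt_wittSeries hA hw
  have hHd' : ∀ w : ℂ, -1 < w.re → DifferentiableAt ℂ (fun w => H (-w) - (2 * w) • (1 : E)) w := by
    intro w hw
    have e := (hHd (-w) (by rw [Complex.neg_re]; linarith)).comp w differentiableAt_id.neg
    exact e.sub (by fun_prop)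
  -- The odd part of the series is the single term -w.
  have hnear : ∀ w : ℂ, ‖w‖ < 1 → H w = H (-w) - (2 * w) • (1 : E) := by
    intro w hw
    have s1 := hHs w hw
    have s2 := hHs (-w) (by rwa [norm_neg])
    have s3 : HasSum (fun n => w ^ n • PowerSeries.coeff n (wittSeries γ) -
        (-w) ^ n • PowerSeries.coeff n (wittSeries γ)) (-((2 * w) • (1 : E))) := by
      refine hasSum_of_eq (hasSum_ite_eq 1 (-((2 * w) • (1 : E)))) (fun n => ?_) rfl
      rcases Nat.even_or_odd n with he | ho
      · have : n ≠ 1 := by rintro rfl; exact absurd he (by decide)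
        rw [he.neg_pow, sub_self, if_neg this]
      · rcases Nat.lt_or_ge n 3 with hlt | hge
        · obtain rfl : n = 1 := by
            interval_cases n
            · exact absurd ho (by decide)
            · rfl
            · exact absurd ho (by decide)
          rw [h1, if_pos rfl]
          module
        · rw [hodd n hge ho, if_neg (by omega)]
          simp
    have := (s1.sub s2).unique s3
    rw [sub_eq_iff_eq_add] at this
    rw [this]
    abel
  -- Both sides are analytic on the strip, so the identity spreads from the disc by the identity
  -- theorem.
  have hstrip : Set.EqOn H (fun w => H (-w) - (2 * w) • (1 : E)) {w : ℂ | -1 < w.re ∧ w.re < 1} := by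
    have ho : IsOpen {w : ℂ | -1 < w.re ∧ w.re < 1} :=
      (isOpen_lt continuous_const Complex.continuous_re).inter
        (isOpen_lt Complex.continuous_re continuous_const)
    have hc : Convex ℝ {w : ℂ | -1 < w.re ∧ w.re < 1} :=
      (convex_halfSpace_re_gt (-1)).inter (convex_halfSpace_re_lt 1)
    have a1 : AnalyticOnNhd ℂ H {w : ℂ | -1 < w.re ∧ w.re < 1} :=
      DifferentiableOn.analyticOnNhd
        (fun w hw => (hHd w hw.2).differentiableWithinAt) ho
    have a2 : AnalyticOnNhd ℂ (fun w => H (-w) - (2 * w) • (1 : E))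
        {w : ℂ | -1 < w.re ∧ w.re < 1} :=
      DifferentiableOn.analyticOnNhd
        (fun w hw => (hHd' w hw.1).differentiableWithinAt) ho
    refine a1.eqOn_of_preconnected_of_eventuallyEq a2 hc.isPreconnected (z₀ := 0) (by simp) ?_
    filter_upwards [Metric.ball_mem_nhds (0 : ℂ) one_pos] with w hw
    exact hnear w (mem_ball_zero_iff.1 hw)
  -- The two half-planes Re w < 1 and Re w > -1 cover the plane and the branches agree on their
  -- intersection, so K is entire. Its growth on Re w ≥ 0 reduces to that of H on the left
  -- half-plane.
  set K : ℂ → E := fun w => if w.re < 1 then H w else H (-w) - (2 * w) • (1 : E) with hK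
  have hK1 : ∀ w : ℂ, w.re < 1 → K w = H w := fun w hw => if_pos hw
  have hK2 : ∀ w : ℂ, -1 < w.re → K w = H (-w) - (2 * w) • (1 : E) := by
    intro w hw
    rcases lt_or_ge w.re 1 with h | h
    · rw [hK1 w h]; exact hstrip ⟨hw, h⟩
    · exact if_neg h.not_gt
  have hKd : Differentiable ℂ K := by
    intro w
    rcases lt_or_ge w.re 1 with h | h
    · refine (hHd w h).congr_of_eventuallyEq ?_
      filter_upwards [(isOpen_lt Complex.continuous_re continuous_const).mem_nhds h] with z hz
      exact hK1 z hz
    · have h' : -1 < w.re := by linarith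
      refine (hHd' w h').congr_of_eventuallyEq ?_
      filter_upwards [(isOpen_lt continuous_const Complex.continuous_re).mem_nhds h'] with z hz
      exact hK2 z hz
  refine ⟨4 * N + 4, fun r hr => coeff_eq_zero_of_growth (f := K)
    (h := fun n => PowerSeries.coeff n (wittSeries γ))
    (C := 4 * (A * 9 ^ (N + 1)) ^ 2 + 2 * ‖(1 : E)‖) hKd ?_ ?_ hr⟩
  · filter_upwards [Metric.ball_mem_nhds (0 : ℂ) one_pos] with w hw
    have hw' := mem_ball_zero_iff.1 hw
    rw [hK1 w ((Complex.re_le_norm w).trans_lt hw')]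
    exact hHs w hw'
  · intro R hR w hw
    have hR1 : 1 ≤ R ^ (4 * N + 3) := one_le_pow₀ hR
    have hR0 : R ≤ R ^ (4 * N + 4) := by
      rw [pow_succ]; nlinarith
    have h10 := norm_nonneg (1 : E)
    rcases le_total w.re 0 with h | h
    · rw [hK1 w (by linarith)]
      refine (norm_wittSeries_le hA0 hA h hR hw).trans ?_
      refine mul_le_mul_of_nonneg_right ?_ (by positivity)
      linarith
    · rw [hK2 w (by linarith), add_mul]
      refine (norm_sub_le _ _).trans (add_le_add ?_ ?_)
      · exact norm_wittSeries_le hA0 hA (by simpa using h) hR (by rwa [norm_neg])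
      · rw [norm_smul, norm_mul, RCLike.norm_ofNat, hw]
        nlinarith

end WittSeries

end WittSuper
end

/-! ### A uniform vanishing index by means of an ultrapower. -/

noncomputable section

namespace WittSuper

section Ultraproduct

open Filter Cardinal

/-- The ultrapower of `ℂ` embeds in `ℂ`. -/
theorem exists_ringHom_ultrapower : ∃ Φ : (ℕ → ℂ) →+* ℂ,
    ∀ f, Φ f = 0 → ∀ᶠ n in (hyperfilter ℕ : Filter ℕ), f n = 0 := by
  let K := Germ (hyperfilter ℕ : Filter ℕ) ℂ
  let q : (ℕ → ℂ) →+* K := Germ.coeRingHom _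
  have hq : Function.Surjective q := fun x => Germ.inductionOn x fun f => ⟨f, rfl⟩
  let c : ℂ →+* K := q.comp (Pi.constRingHom ℕ ℂ)
  have : CharZero K := charZero_of_injective_ringHom c.injective
  have : CharZero (AlgebraicClosure K) :=
    charZero_of_injective_ringHom (algebraMap K (AlgebraicClosure K)).injective
  have hK : #K ≤ 𝔠 := by
    refine (mk_le_of_surjective hq).trans ?_
    simp [Cardinal.mk_complex]
  have hK' : 𝔠 ≤ #(AlgebraicClosure K) := by
    rw [← Cardinal.mk_complex]
    exact mk_le_of_injective ((algebraMap K (AlgebraicClosure K)).comp c).injective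
  have hle : #(AlgebraicClosure K) ≤ 𝔠 :=
    (Algebra.IsAlgebraic.cardinalMk_le_max K (AlgebraicClosure K)).trans
      (max_le hK aleph0_le_continuum)
  have heq : #(AlgebraicClosure K) = #ℂ := by
    rw [Cardinal.mk_complex]; exact le_antisymm hle hK'
  -- Algebraically closed fields of characteristic zero with the same uncountable cardinality are
  -- isomorphic; here both have the cardinality of the continuum.
  obtain ⟨e⟩ := IsAlgClosed.ringEquiv_of_equiv_of_charZero
    (aleph0_lt_continuum.trans_le hK') (Cardinal.eq.1 heq)
  refine ⟨(e.toRingHom.comp (algebraMap K (AlgebraicClosure K))).comp q, fun f hf => ?_⟩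
  have h0 : q f = q 0 := by
    rw [map_zero]
    exact (map_eq_zero (e.toRingHom.comp (algebraMap K (AlgebraicClosure K)))).1 hf
  exact Germ.coe_eq.1 h0

end Ultraproduct

section Transport

variable {E F : Type*} [Ring E] [Algebra ℂ E] [Ring F] [Algebra ℂ F]

/-- The homomorphism from the ultrapower need not be ℂ-linear. The recursion and the Witt series
involve integer scalars only, so they are transported nevertheless. -/
theorem map_natCast_smul_ringHom (φ : E →+* F) (n : ℕ) (x : E) :
    φ ((n : ℂ) • x) = (n : ℂ) • φ x := by
  rw [Nat.cast_smul_eq_nsmul, Nat.cast_smul_eq_nsmul, map_nsmul]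

theorem map_intCast_smul_ringHom (φ : E →+* F) (n : ℤ) (x : E) :
    φ ((n : ℂ) • x) = (n : ℂ) • φ x := by
  rw [Int.cast_smul_eq_zsmul, Int.cast_smul_eq_zsmul, map_zsmul]

theorem map_coeff_wittSeries (φ : E →+* F) (γ : ℕ → E) (r : ℕ) :
    φ (PowerSeries.coeff r (wittSeries γ)) = PowerSeries.coeff r (wittSeries fun n => φ (γ n)) := by
  have e1 : PowerSeries.map φ (PowerSeries.mk fun n => ∑ k ∈ Finset.range (n + 1),
      (n.choose k : ℂ) • γ k) =
      PowerSeries.mk fun n => ∑ k ∈ Finset.range (n + 1), (n.choose k : ℂ) • φ (γ k) := by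
    ext n
    simp [map_natCast_smul_ringHom]
  have e2 : PowerSeries.map φ (PowerSeries.mk fun n => (-1 : ℂ) ^ n • γ n) =
      PowerSeries.mk fun n => (-1 : ℂ) ^ n • φ (γ n) := by
    ext n
    have := map_intCast_smul_ringHom φ ((-1) ^ n) (γ n)
    push_cast at this
    simpa using this
  rw [← PowerSeries.coeff_map]
  simp only [wittSeries, map_mul, map_sub, map_one, PowerSeries.map_X, e1, e2]

theorem map_isRec_expr (φ : E →+* F) (γ : ℕ → E) (g : E) (k : ℕ) :
    φ ((((k : ℂ) - 1) * (k + 2)) • γ (k + 2) + (2 * ((k : ℂ) + 1) * (k - 1)) • γ (k + 1) +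
      ((k : ℂ) * (k - 1)) • γ k + γ (k + 1) * g - g * γ (k + 1) + γ k * g) =
    (((k : ℂ) - 1) * (k + 2)) • φ (γ (k + 2)) + (2 * ((k : ℂ) + 1) * (k - 1)) • φ (γ (k + 1)) +
      ((k : ℂ) * (k - 1)) • φ (γ k) + φ (γ (k + 1)) * φ g - φ g * φ (γ (k + 1)) +
      φ (γ k) * φ g := by
  have h1 := map_intCast_smul_ringHom φ (((k : ℤ) - 1) * (k + 2)) (γ (k + 2))
  have h2 := map_intCast_smul_ringHom φ (2 * ((k : ℤ) + 1) * (k - 1)) (γ (k + 1))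
  have h3 := map_intCast_smul_ringHom φ ((k : ℤ) * (k - 1)) (γ k)
  push_cast at h1 h2 h3
  rw [map_add, map_sub, map_add, map_add, map_add, h1, h2, h3, map_mul, map_mul, map_mul]

theorem IsRec.map {γ : ℕ → E} {g : E} (h : IsRec γ g) (φ : E →+* F) :
    IsRec (fun n => φ (γ n)) (φ g) := fun k => by
  rw [← map_isRec_expr, h k, map_zero]

end Transport

section Uniform

open Filter

local instance matrixNormedRing (d : ℕ) : NormedRing (Matrix (Fin d) (Fin d) ℂ) :=
  Matrix.linftyOpNormedRing

local instance matrixNormedAlgebra (d : ℕ) : NormedAlgebra ℂ (Matrix (Fin d) (Fin d) ℂ) :=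
  Matrix.linftyOpNormedAlgebra

/-- Otherwise there is a counterexample for every R, and together they form one family of matrices
over ℂ^ℕ. Its image over ℂ has a vanishing even coefficient by `exists_coeff_wittSeries_eq_zero`;
that coefficient then vanishes for almost all counterexamples, among them one with R beyond its
index. -/
theorem exists_even_coeff_wittSeries_eq_zero_matrix (d : ℕ) : ∃ R : ℕ,
    ∀ (γ : ℕ → Matrix (Fin d) (Fin d) ℂ) (g : Matrix (Fin d) (Fin d) ℂ), IsRec γ g →
      PowerSeries.coeff 1 (wittSeries γ) = -1 →
      (∀ r, 3 ≤ r → Odd r → PowerSeries.coeff r (wittSeries γ) = 0) →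
      ∃ r, 4 ≤ r ∧ r ≤ R ∧ Even r ∧ PowerSeries.coeff r (wittSeries γ) = 0 := by
  by_contra! hcon
  choose γ g hrec h1 hodd hne using hcon
  obtain ⟨Φ, hΦ⟩ := exists_ringHom_ultrapower
  let e : ∀ n, Matrix (Fin d) (Fin d) (ℕ → ℂ) →+* Matrix (Fin d) (Fin d) ℂ := fun n =>
    (Pi.evalRingHom (fun _ : ℕ => ℂ) n).mapMatrix
  let Γ : ℕ → Matrix (Fin d) (Fin d) (ℕ → ℂ) := fun k => Matrix.of fun i j n => γ n k i j
  let Gm : Matrix (Fin d) (Fin d) (ℕ → ℂ) := Matrix.of fun i j n => g n i j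
  have eΓ : ∀ n k, e n (Γ k) = γ n k := fun n k => rfl
  have eG : ∀ n, e n Gm = g n := fun n => rfl
  have hext : ∀ A B : Matrix (Fin d) (Fin d) (ℕ → ℂ), (∀ n, e n A = e n B) → A = B := by
    intro A B h
    ext i j n
    exact congrFun (congrFun (h n) i) j
  have hcoeff : ∀ n r, e n (PowerSeries.coeff r (wittSeries Γ)) =
      PowerSeries.coeff r (wittSeries (γ n)) := fun n r => map_coeff_wittSeries (e n) Γ r
  have hRec : IsRec Γ Gm := fun k => hext _ _ fun n => by
    rw [map_isRec_expr, map_zero]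
    exact hrec n k
  let φ : Matrix (Fin d) (Fin d) (ℕ → ℂ) →+* Matrix (Fin d) (Fin d) ℂ := Φ.mapMatrix
  have hRec' := hRec.map φ
  obtain ⟨R, hR⟩ := exists_coeff_wittSeries_eq_zero hRec'
    (by
      rw [← map_coeff_wittSeries, hext (PowerSeries.coeff 1 (wittSeries Γ)) (-1) fun n => by
        rw [hcoeff, h1, map_neg, map_one], map_neg, map_one])
    (fun r hr hro => by
      rw [← map_coeff_wittSeries, hext (PowerSeries.coeff r (wittSeries Γ)) 0 fun n => by
        rw [hcoeff, hodd n r hr hro, map_zero], map_zero])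
  have h0 := hR (2 * R + 4) (by omega)
  rw [← map_coeff_wittSeries] at h0
  have h2 : ∀ᶠ n in (hyperfilter ℕ : Filter ℕ),
      PowerSeries.coeff (2 * R + 4) (wittSeries (γ n)) = 0 := by
    have : ∀ᶠ n in (hyperfilter ℕ : Filter ℕ), ∀ i j,
        PowerSeries.coeff (2 * R + 4) (wittSeries Γ) i j n = 0 :=
      eventually_all.2 fun i => eventually_all.2 fun j => hΦ _ (congrFun (congrFun h0 i) j)
    filter_upwards [this] with n hn
    rw [← hcoeff]
    ext i j
    exact hn i j
  have h3 : ∀ᶠ n in (hyperfilter ℕ : Filter ℕ), 2 * R + 4 ≤ n :=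
    mem_hyperfilter_of_finite_compl ((Set.finite_lt_nat (2 * R + 4)).subset fun n hn => by
      simpa using hn)
  obtain ⟨n, hn, hn'⟩ := (h2.and h3).exists
  exact hne n (2 * R + 4) (by omega) hn' ⟨R + 2, by ring⟩ hn

universe u

/-- For spaces of bounded dimension there is a uniform bound for an even index at which the
coefficient of the Witt series vanishes. -/
theorem exists_even_coeff_wittSeries_eq_zero (d : ℕ) : ∃ R : ℕ,
    ∀ (V : Type u) [AddCommGroup V] [Module ℂ V] [FiniteDimensional ℂ V],
      Module.finrank ℂ V ≤ d → ∀ (γ : ℕ → Module.End ℂ V) (g : Module.End ℂ V), IsRec γ g →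
      PowerSeries.coeff 1 (wittSeries γ) = -1 →
      (∀ r, 3 ≤ r → Odd r → PowerSeries.coeff r (wittSeries γ) = 0) →
      ∃ r, 4 ≤ r ∧ r ≤ R ∧ Even r ∧ PowerSeries.coeff r (wittSeries γ) = 0 := by
  choose R hR using exists_even_coeff_wittSeries_eq_zero_matrix
  refine ⟨(Finset.range (d + 1)).sup R, fun V _ _ _ hV γ g hrec h1 hodd => ?_⟩
  let e := LinearMap.toMatrixAlgEquiv (Module.finBasis ℂ V)
  let φ : Module.End ℂ V →+* Matrix (Fin (Module.finrank ℂ V)) (Fin (Module.finrank ℂ V)) ℂ :=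
    e.toRingEquiv.toRingHom
  obtain ⟨r, h4, hr, he, h0⟩ := hR (Module.finrank ℂ V) (fun n => φ (γ n)) (φ g) (hrec.map φ)
    (by rw [← map_coeff_wittSeries, h1, map_neg, map_one])
    (fun r hr hro => by rw [← map_coeff_wittSeries, hodd r hr hro, map_zero])
  refine ⟨r, h4, hr.trans (Finset.le_sup (Finset.mem_range.2 (by omega))), he, ?_⟩
  rw [← map_coeff_wittSeries] at h0
  exact e.injective (h0.trans (map_zero e).symm)

end Uniform

end WittSuper
end

/-! ### Polynomial functions and expansions in rising factorials. -/

noncomputable section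

namespace WittSuper

section PolyFun

variable (E : Type*) [Ring E] [Algebra ℂ E]

/-- The polynomial functions of a complex variable with values in an algebra. -/
def polyFun : Subring (ℂ → E) :=
  (RingHom.pi fun x : ℂ => Polynomial.eval₂RingHom' (RingHom.id E) (algebraMap ℂ E x)
    fun a => Algebra.commute_algebraMap_right x a).range

variable {E}

theorem const_mem_polyFun (e : E) : (fun _ => e) ∈ polyFun E :=
  ⟨Polynomial.C e, funext fun _ => Polynomial.eval₂_C _ _⟩

theorem algebraMap_mem_polyFun : (fun x => algebraMap ℂ E x) ∈ polyFun E :=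
  ⟨Polynomial.X, funext fun _ => Polynomial.eval₂_X _ _⟩

/-- A linear functional turns F into a scalar polynomial with infinitely many roots, and functionals
separate the coefficients. -/
theorem eq_zero_of_mem_polyFun {F : ℂ → E} (hF : F ∈ polyFun E) (h : {x | F x = 0}.Infinite) :
    F = 0 := by
  obtain ⟨p, rfl⟩ := hF
  suffices hp : p = 0 by rw [hp, map_zero]
  ext n
  rw [Polynomial.coeff_zero, ← Module.forall_dual_apply_eq_zero_iff ℂ]
  intro ψ
  let q : Polynomial ℂ := ∑ i ∈ p.support, Polynomial.monomial i (ψ (p.coeff i))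
  have hq : ∀ x : ℂ, q.eval x = ψ (p.eval₂ (RingHom.id E) (algebraMap ℂ E x)) := by
    intro x
    rw [Polynomial.eval₂_eq_sum, Polynomial.sum, map_sum, Polynomial.eval_finsetSum]
    refine Finset.sum_congr rfl fun i _ => ?_
    rw [Polynomial.eval_monomial, RingHom.id_apply, ← map_pow, ← Algebra.commutes,
      ← Algebra.smul_def, map_smul, smul_eq_mul, mul_comm]
  have hq0 : q = 0 := Polynomial.eq_zero_of_infinite_isRoot q (h.mono fun x hx => by
    have hx' : p.eval₂ (RingHom.id E) (algebraMap ℂ E x) = 0 := hx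
    change q.eval x = 0
    rw [hq, hx', map_zero])
  have hc : q.coeff n = ψ (p.coeff n) := by
    simp only [q, Polynomial.finsetSum_coeff, Polynomial.coeff_monomial, Finset.sum_ite_eq',
      Polynomial.mem_support_iff]
    by_cases h0 : p.coeff n = 0 <;> simp [h0]
  rw [← hc, hq0, Polynomial.coeff_zero]

theorem eq_const_of_mem_polyFun {F : ℂ → E} (hF : F ∈ polyFun E) (h : ∀ x, F x = F (x - 1))
    (x : ℂ) : F x = F 0 := by
  have hn : ∀ n : ℕ, F n = F 0 := by
    intro n
    induction n with
    | zero => simp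
    | succ n ih => rw [h, ← ih]; congr 1; push_cast; ring
  have h0 := eq_zero_of_mem_polyFun (sub_mem hF (const_mem_polyFun (F 0)))
    ((Set.infinite_range_of_injective (Nat.cast_injective (R := ℂ))).mono (by
      rintro _ ⟨n, rfl⟩
      simp [hn n]))
  exact sub_eq_zero.1 (congrFun h0 x)

/-- The rising factorial. -/
def risingFactorial (y : ℂ) (m : ℕ) : ℂ := ∏ i ∈ Finset.range m, (y + i)

theorem risingFactorial_zero (y : ℂ) : risingFactorial y 0 = 1 := Finset.prod_range_zero _

theorem risingFactorial_succ (y : ℂ) (m : ℕ) :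
    risingFactorial y (m + 1) = risingFactorial y m * (y + m) := Finset.prod_range_succ _ _

theorem risingFactorial_succ' (y : ℂ) (m : ℕ) :
    risingFactorial y (m + 1) = y * risingFactorial (y + 1) m := by
  rw [risingFactorial, Finset.prod_range_succ', mul_comm]
  simp only [risingFactorial, Nat.cast_zero, add_zero]
  congr 1
  refine Finset.prod_congr rfl fun i _ => ?_
  push_cast
  ring

theorem risingFactorial_sub (y : ℂ) (m : ℕ) :
    risingFactorial y (m + 1) - risingFactorial (y - 1) (m + 1) =
      (m + 1) * risingFactorial y m := by
  rw [risingFactorial_succ, risingFactorial_succ', sub_add_cancel]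
  ring

theorem risingFactorial_mem_polyFun (b : ℂ) (m : ℕ) (e : E) :
    (fun x => risingFactorial (x + b) m • e) ∈ polyFun E := by
  induction m with
  | zero => simpa [risingFactorial_zero] using const_mem_polyFun e
  | succ m ih =>
    have := mul_mem (add_mem algebraMap_mem_polyFun (const_mem_polyFun (algebraMap ℂ E (b + m)))) ih
    convert this using 1
    funext x
    simp only [Pi.mul_apply, Pi.add_apply, ← map_add, ← Algebra.smul_def, smul_smul,
      risingFactorial_succ]
    congr 1
    ring

theorem smul_mem_polyFun (c : ℂ) {F : ℂ → E} (hF : F ∈ polyFun E) : c • F ∈ polyFun E := by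
  have := mul_mem (const_mem_polyFun (algebraMap ℂ E c)) hF
  convert this using 1
  funext x
  simp [Algebra.smul_def]

end PolyFun

section PolyForm

variable {E : Type*} [Ring E] [Algebra ℂ E]

/-- The polynomial functions describing the action of `t^a ∂` on a module on which `∂` is
invertible. -/
def polyForm (g : ℕ → E) (a : ℕ) (x : ℂ) : E :=
  ∑ j ∈ Finset.range (a + 1), ((a.choose j : ℂ) * risingFactorial (x + j) (a - j)) • g j

theorem choose_mul_sub (a j : ℕ) (hj : j ≤ a) :
    ((a + 1).choose j : ℂ) * ((a - j : ℕ) + 1) = (a + 1) * a.choose j := by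
  have h := Nat.choose_mul_succ_eq a j
  rw [show a + 1 - j = (a - j) + 1 by omega] at h
  have h' : ((a.choose j : ℂ)) * (a + 1) = (a + 1).choose j * ((a - j : ℕ) + 1) := by
    exact_mod_cast h
  rw [← h', mul_comm]

/-- This mirrors [∂, t^(a+1) ∂] = (a + 1) t^a ∂. Rising factorials obey the same difference rule,
which dictates the shape of `polyForm`. -/
theorem polyForm_sub (g : ℕ → E) (a : ℕ) (x : ℂ) :
    polyForm g (a + 1) x - polyForm g (a + 1) (x - 1) = ((a : ℂ) + 1) • polyForm g a x := by
  rw [polyForm, polyForm, Finset.sum_range_succ, Finset.sum_range_succ _ (a + 1), polyForm,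
    Finset.smul_sum]
  simp only [Nat.sub_self, risingFactorial_zero, add_sub_add_right_eq_sub]
  rw [← Finset.sum_sub_distrib]
  refine Finset.sum_congr rfl fun j hj => ?_
  have hj : j ≤ a := Nat.lt_succ_iff.1 (Finset.mem_range.1 hj)
  have h := risingFactorial_sub (x + j) (a - j)
  rw [← sub_smul, smul_smul, show a + 1 - j = a - j + 1 by omega, ← mul_sub,
    show x - 1 + (j : ℂ) = x + j - 1 by ring, h, ← mul_assoc, choose_mul_sub a j hj, mul_assoc]

theorem polyForm_mem (g : ℕ → E) (a : ℕ) (b : ℂ) :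
    (fun x => polyForm g a (x + b)) ∈ polyFun E := by
  have : (fun x => polyForm g a (x + b)) = ∑ j ∈ Finset.range (a + 1),
      (a.choose j : ℂ) • fun x => risingFactorial (x + (b + j)) (a - j) • g j := by
    funext x
    simp [polyForm, smul_smul, add_assoc]
  rw [this]
  exact sum_mem fun j _ => smul_mem_polyFun _ (risingFactorial_mem_polyFun _ _ _)

theorem polyForm_mem' (g : ℕ → E) (a : ℕ) : polyForm g a ∈ polyFun E := by
  simpa using polyForm_mem g a 0

/-- At x = 1 - a every rising factorial of positive length contains the factor zero. -/
theorem polyForm_self (g : ℕ → E) (a : ℕ) : polyForm g a (1 - a) = g a := by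
  rw [polyForm, Finset.sum_range_succ, Finset.sum_eq_zero]
  · simp [risingFactorial_zero]
  · intro j hj
    have hj := Finset.mem_range.1 hj
    obtain ⟨m, rfl⟩ : ∃ m, a = j + m + 1 := ⟨a - j - 1, by omega⟩
    rw [show j + m + 1 - j = m + 1 by omega, risingFactorial_succ]
    push_cast
    rw [show (1 - ((j : ℂ) + m + 1) + j + m) = 0 by ring]
    simp

theorem polyForm_zero (g : ℕ → E) (x : ℂ) : polyForm g 0 x = g 0 := by
  simp [polyForm, risingFactorial_zero]

theorem polyForm_one (g : ℕ → E) (x : ℂ) : polyForm g 1 x = x • g 0 + g 1 := by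
  simp [polyForm, risingFactorial, Finset.sum_range_succ]

/-- The sum describing the alternating products of `t^{r-i} ∂` and `t^i ∂`. -/
theorem sum_polyForm_risingFactorial (g : ℕ → E) (R : ℕ) (y : ℂ) (e : E) :
    ∑ m ∈ Finset.range (R + 1), ((-1 : ℂ) ^ m * R.choose m * risingFactorial y m) •
      (polyForm g (R - m) (y + m - 1) * e) = polyForm g R (-1) * e := by
  set F : ℂ → E := fun y => ∑ m ∈ Finset.range (R + 1),
    ((-1 : ℂ) ^ m * R.choose m * risingFactorial y m) • (polyForm g (R - m) (y + m - 1) * e) with hF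
  have hmem : F ∈ polyFun E := by
    have : F = ∑ m ∈ Finset.range (R + 1), ((-1 : ℂ) ^ m * R.choose m) •
        ((fun y => polyForm g (R - m) (y + (m - 1))) * fun y => risingFactorial (y + 0) m • e) := by
      funext x
      simp [hF, smul_smul, add_sub_assoc]
    rw [this]
    exact sum_mem fun m _ => smul_mem_polyFun _
      (mul_mem (polyForm_mem _ _ _) (risingFactorial_mem_polyFun _ _ _))
  have hper : ∀ x, F x = F (x - 1) := by
    intro x
    -- The difference F x - F (x - 1) telescopes: its partial sums reduce to one boundary term,
    -- which is zero for n = R because `polyForm g 0` is constant.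
    have key : ∀ n ≤ R, ∑ m ∈ Finset.range (n + 1), (((-1 : ℂ) ^ m * R.choose m *
        risingFactorial x m) • (polyForm g (R - m) (x + m - 1) * e) -
        ((-1 : ℂ) ^ m * R.choose m * risingFactorial (x - 1) m) •
          (polyForm g (R - m) (x - 1 + m - 1) * e)) =
        ((-1 : ℂ) ^ n * R.choose n * risingFactorial x n) •
          ((polyForm g (R - n) (x + n - 1) - polyForm g (R - n) (x + n - 1 - 1)) * e) := by
      intro n hn
      induction n with
      | zero =>
        simp only [zero_add, Finset.range_one, Finset.sum_singleton, pow_zero, risingFactorial_zero,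
          Nat.cast_zero, add_zero, mul_one]
        rw [← smul_sub, ← sub_mul]
      | succ n ih =>
        rw [Finset.sum_range_succ, ih (by omega)]
        obtain ⟨q, rfl⟩ : ∃ q, R = n + 1 + q := ⟨R - n - 1, by omega⟩
        rw [show n + 1 + q - n = q + 1 by omega, show n + 1 + q - (n + 1) = q by omega,
          polyForm_sub]
        have e1 : x + ((n + 1 : ℕ) : ℂ) - 1 = x + n := by push_cast; ring
        have e2 : x - 1 + ((n + 1 : ℕ) : ℂ) - 1 = x + n - 1 := by push_cast; ring
        rw [e1, e2]
        have h1 := risingFactorial_sub x n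
        have h2 : ((n + 1 + q).choose (n + 1) : ℂ) * (n + 1) = (n + 1 + q).choose n * (q + 1) := by
          have := Nat.choose_succ_right_eq (n + 1 + q) n
          rw [show n + 1 + q - n = q + 1 by omega] at this
          exact_mod_cast this
        rw [sub_eq_iff_eq_add] at h1
        rw [h1, smul_mul_assoc, smul_smul, sub_mul, smul_sub]
        have e3 : (-1 : ℂ) ^ n * (n + 1 + q).choose n * risingFactorial x n * ((q : ℂ) + 1) =
            - ((-1) ^ (n + 1) * (n + 1 + q).choose (n + 1) * ((n + 1) * risingFactorial x n)) := by
          rw [pow_succ]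
          linear_combination (-(-1) ^ n * risingFactorial x n) * h2
        rw [e3]
        module
    have h := key R le_rfl
    rw [Finset.sum_sub_distrib] at h
    have h0 : (polyForm g (R - R) (x + R - 1) - polyForm g (R - R) (x + R - 1 - 1)) * e = 0 := by
      rw [Nat.sub_self, polyForm_zero, polyForm_zero, sub_self, zero_mul]
    rw [h0, smul_zero] at h
    exact sub_eq_zero.1 h
  have h := eq_const_of_mem_polyFun hmem hper y
  change F y = _
  rw [h, hF]
  simp only
  -- At y = 0 only the term m = 0 survives.
  rw [Finset.sum_range_succ', Finset.sum_eq_zero]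
  · simp [risingFactorial_zero]
  · intro m _
    rw [risingFactorial_succ']
    simp

end PolyForm

end WittSuper
end

/-! ### Recursion, alternating products and the behaviour at the ends of ℤ. -/

noncomputable section

namespace WittSuper

open Filter

section PolyFormRelations

variable {E : Type*} [Ring E] [Algebra ℂ E]

/-- Evaluating the bracket at x = -a isolates the coefficient g (a + 1) by `polyForm_self`. In the
case a = k + 1 plus k + 1 times the case a = k, the unknown value `polyForm g k (-k)` cancels, and
division by (k + 1)! leaves the recursion. -/
theorem isRec_of_bracket {g : ℕ → E} (h0 : g 0 = 1) (h1 : g 1 = 0)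
    (hbr : ∀ (a : ℕ) (x : ℂ), polyForm g 2 (x + a - 1) * polyForm g a x - polyForm g a (x + 1) *
      polyForm g 2 x = ((a : ℂ) - 2) • polyForm g (a + 1) x) :
    IsRec (fun n => (1 / (n.factorial : ℂ)) • g n) (g 2) := by
  have hF2 : ∀ y : ℂ, polyForm g 2 y = (y * (y + 1)) • (1 : E) + g 2 := by
    intro y
    simp [polyForm, risingFactorial, Finset.sum_range_succ, Finset.prod_range_succ, h0, h1]
  have hE : ∀ a : ℕ, g 2 * polyForm g a (-a) - g a * (((a : ℂ) * (a - 1)) • (1 : E) + g 2) =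
      ((a : ℂ) - 2) • g (a + 1) := by
    intro a
    have h := hbr a (-a)
    have e1 := polyForm_self g (a + 1)
    rw [show (1 : ℂ) - ((a + 1 : ℕ) : ℂ) = -a by push_cast; ring] at e1
    have e2 := polyForm_self g a
    rw [e1, show -(a : ℂ) + a - 1 = -1 by ring, show -(a : ℂ) + 1 = 1 - a by ring, e2, hF2, hF2,
      show (-1 : ℂ) * (-1 + 1) = 0 by ring, show -(a : ℂ) * (-a + 1) = a * (a - 1) by ring,
      zero_smul, zero_add] at h
    exact h
  intro k
  have hP : polyForm g (k + 1) (-((k + 1 : ℕ) : ℂ)) = g (k + 1) - ((k : ℂ) + 1) • polyForm g k (-k) := by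
    have e1 := polyForm_self g (k + 1)
    have e2 := polyForm_sub g k (-k)
    rw [show (1 : ℂ) - ((k + 1 : ℕ) : ℂ) = -k by push_cast; ring] at e1
    rw [e1] at e2
    rw [← e2, show -((k + 1 : ℕ) : ℂ) = -(k : ℂ) - 1 by push_cast; ring]
    abel
  have h2 := hE (k + 1)
  rw [hP] at h2
  have h3 := hE k
  have f1 : ((k + 1).factorial : ℂ) ≠ 0 := by exact_mod_cast (k + 1).factorial_ne_zero
  have f0 : (k.factorial : ℂ) ≠ 0 := by exact_mod_cast k.factorial_ne_zero
  have fk : (k : ℂ) + 1 ≠ 0 := by exact_mod_cast k.succ_ne_zero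
  have fk2 : (k : ℂ) + 2 ≠ 0 := by exact_mod_cast (k + 1).succ_ne_zero
  set s : ℂ := 1 / ((k + 1).factorial : ℂ) with hs
  have s0 : 1 / (k.factorial : ℂ) = s * (k + 1) := by
    rw [hs, Nat.factorial_succ]
    push_cast
    field_simp
  have s2 : 1 / ((k + 2).factorial : ℂ) = s * (1 / (k + 2)) := by
    rw [hs, Nat.factorial_succ (k + 1)]
    push_cast
    rw [show (k : ℂ) + 1 + 1 = k + 2 by ring]
    field_simp
  have hcomb : ((k : ℂ) - 1) • g (k + 2) + (2 * ((k : ℂ) + 1) * (k - 1)) • g (k + 1) +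
      (((k : ℂ) + 1) * (k * (k - 1))) • g k + g (k + 1) * g 2 - g 2 * g (k + 1) +
      ((k : ℂ) + 1) • (g k * g 2) = 0 := by
    have h4 := congrArg₂ (· + ·) h2 (congrArg (((k : ℂ) + 1) • ·) h3)
    simp only [mul_sub, mul_add, mul_smul_comm, mul_one, Nat.cast_add, Nat.cast_one] at h4
    rw [← sub_eq_zero] at h4
    rw [← neg_eq_zero, ← h4]
    simp only [show k + 1 + 1 = k + 2 by ring]
    module
  have : s • (((k : ℂ) - 1) • g (k + 2) + (2 * ((k : ℂ) + 1) * (k - 1)) • g (k + 1) +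
      (((k : ℂ) + 1) * (k * (k - 1))) • g k + g (k + 1) * g 2 - g 2 * g (k + 1) +
      ((k : ℂ) + 1) • (g k * g 2)) = 0 := by rw [hcomb, smul_zero]
  rw [← this]
  simp only [s0, s2, smul_mul_assoc, mul_smul_comm]
  rw [smul_smul, show ((k : ℂ) - 1) * (k + 2) * (s * (1 / (k + 2))) = s * (k - 1) by field_simp]
  module

/-- Expanding the right factor and collecting the terms with a fixed g j produces the sums of
`sum_polyForm_risingFactorial`. The result does not depend on x, so the alternating product acts
alike in all degrees near the end. -/
theorem sum_polyForm_mul (g : ℕ → E) (r : ℕ) (x : ℂ) :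
    ∑ i ∈ Finset.range (r + 1), ((-1 : ℂ) ^ i * r.choose i) •
      (polyForm g (r - i) (x + i - 1) * polyForm g i x) =
    ∑ j ∈ Finset.range (r + 1), ((-1 : ℂ) ^ j * r.choose j) • (polyForm g (r - j) (-1) * g j) := by
  let T : ℕ → ℕ → E := fun j m => ((-1 : ℂ) ^ (j + m) * r.choose (j + m) * ((j + m).choose j *
    risingFactorial (x + j) m)) • (polyForm g (r - (j + m)) (x + j + m - 1) * g j)
  have h1 : ∀ i ∈ Finset.range (r + 1), ((-1 : ℂ) ^ i * r.choose i) •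
      (polyForm g (r - i) (x + i - 1) * polyForm g i x) =
        ∑ j ∈ Finset.range (i + 1), T j (i - j) := by
    intro i hi
    simp only [T]
    conv_lhs => rw [polyForm.eq_def g i x]
    rw [Finset.mul_sum, Finset.smul_sum]
    refine Finset.sum_congr rfl fun j hj => ?_
    have hj : j ≤ i := Nat.lt_succ_iff.1 (Finset.mem_range.1 hj)
    obtain ⟨m, rfl⟩ := Nat.exists_eq_add_of_le hj
    rw [mul_smul_comm, smul_smul, Nat.add_sub_cancel_left]
    push_cast
    rw [show x + (j + m : ℂ) - 1 = x + j + m - 1 by ring]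
  rw [Finset.sum_congr rfl h1, Finset.sum_range_diag_flip (r + 1) T]
  simp only [T]
  refine Finset.sum_congr rfl fun j hj => ?_
  have hj : j ≤ r := Nat.lt_succ_iff.1 (Finset.mem_range.1 hj)
  rw [show r + 1 - j = r - j + 1 by omega, ← sum_polyForm_risingFactorial g (r - j) (x + j) (g j),
    Finset.smul_sum]
  refine Finset.sum_congr rfl fun m hm => ?_
  have hm : m ≤ r - j := Nat.lt_succ_iff.1 (Finset.mem_range.1 hm)
  have hc := Nat.choose_mul (n := r) (k := j + m) (s := j) (by omega)
  rw [Nat.add_sub_cancel_left] at hc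
  have hc' : (r.choose (j + m) : ℂ) * (j + m).choose j = r.choose j * (r - j).choose m := by
    exact_mod_cast hc
  rw [smul_smul, Nat.sub_sub, pow_add]
  congr 1
  linear_combination ((-1) ^ j * (-1) ^ m * risingFactorial (x + j) m) * hc'

theorem risingFactorial_one_add_mul (j m : ℕ) :
    risingFactorial (1 + j) m * j.factorial = (j + m).factorial := by
  induction m with
  | zero => simp [risingFactorial_zero]
  | succ m ih =>
    rw [risingFactorial_succ, ← add_assoc, Nat.factorial_succ, Nat.cast_mul, ← ih]
    push_cast
    ring

/-- On the series with coefficients `polyForm g n x` / n!, multiplication by 1 - X is the shift from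
x to x - 1, by `polyForm_sub`. The binomial transform of γ is this series at x = 1; the two factors
1 - X bring it to x = -1, and the sum is the Cauchy product with G(-X). -/
theorem coeff_wittSeries_eq (g : ℕ → E) (r : ℕ) :
    PowerSeries.coeff r (wittSeries fun n => (1 / (n.factorial : ℂ)) • g n) =
      (1 / (r.factorial : ℂ)) •
        ∑ j ∈ Finset.range (r + 1), ((-1 : ℂ) ^ j * r.choose j) • (polyForm g (r - j) (-1) * g j) := by
  have hf : ∀ n : ℕ, (n.factorial : ℂ) ≠ 0 := fun n => by exact_mod_cast n.factorial_ne_zero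
  have hP : ∀ x : ℂ, (1 - PowerSeries.X) *
      PowerSeries.mk (fun n : ℕ => (1 / (n.factorial : ℂ)) • polyForm g n x) =
      PowerSeries.mk fun n : ℕ => (1 / (n.factorial : ℂ)) • polyForm g n (x - 1) := by
    intro x
    ext n
    rw [sub_mul, one_mul, map_sub]
    rcases n with _ | n
    · simp [polyForm_zero]
    · rw [PowerSeries.coeff_succ_X_mul, PowerSeries.coeff_mk, PowerSeries.coeff_mk,
        PowerSeries.coeff_mk, sub_eq_iff_eq_add, ← sub_eq_iff_eq_add', ← smul_sub, polyForm_sub,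
        smul_smul, Nat.factorial_succ]
      congr 1
      have := hf n
      have fk : (n : ℂ) + 1 ≠ 0 := by exact_mod_cast n.succ_ne_zero
      push_cast
      field_simp
  have hD : (PowerSeries.mk fun n : ℕ => ∑ k ∈ Finset.range (n + 1),
      (n.choose k : ℂ) • (1 / (k.factorial : ℂ)) • g k) =
      PowerSeries.mk fun n : ℕ => (1 / (n.factorial : ℂ)) • polyForm g n 1 := by
    ext n
    rw [PowerSeries.coeff_mk, PowerSeries.coeff_mk, polyForm, Finset.smul_sum]
    refine Finset.sum_congr rfl fun k hk => ?_
    have hk : k ≤ n := Nat.lt_succ_iff.1 (Finset.mem_range.1 hk)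
    have h := risingFactorial_one_add_mul k (n - k)
    rw [Nat.add_sub_cancel' hk] at h
    rw [smul_smul, smul_smul, ← h]
    congr 1
    have h1 := hf n
    rw [← h] at h1
    have h2 := hf k
    have h3 := left_ne_zero_of_mul h1
    field_simp
  have hassoc : ∀ a b c : PowerSeries E, a * (a * (b * c)) = a * (a * b) * c := fun a b c => by
    simp only [mul_assoc]
  rw [wittSeries, hD, hassoc, hP, hP, PowerSeries.coeff_mul,
    ← Finset.Nat.sum_antidiagonal_swap, Finset.Nat.sum_antidiagonal_eq_sum_range_succ_mk,
    Finset.smul_sum]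
  refine Finset.sum_congr rfl fun j hj => ?_
  have hj : j ≤ r := Nat.lt_succ_iff.1 (Finset.mem_range.1 hj)
  simp only [Prod.swap_prod_mk, PowerSeries.coeff_mk]
  rw [show (1 : ℂ) - 1 - 1 = -1 by ring, smul_smul, smul_smul, smul_mul_smul_comm]
  congr 1
  rw [Nat.cast_choose ℂ hj]
  have h1 := hf r
  have h2 := hf j
  have h3 := hf (r - j)
  field_simp

end PolyFormRelations

section Ends

variable {l : Filter ℤ}

theorem tendsto_add_of_end (hl : l = atTop ∨ l = atBot) (j : ℤ) : Tendsto (· + j) l l := by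
  rcases hl with rfl | rfl
  · exact tendsto_atTop_add_const_right _ _ tendsto_id
  · exact tendsto_atBot_add_const_right _ _ tendsto_id

theorem neBot_of_end (hl : l = atTop ∨ l = atBot) : l.NeBot := by
  rcases hl with rfl | rfl <;> infer_instance

theorem eventually_const_of_end {α : Type*} (hl : l = atTop ∨ l = atBot) {h : ℤ → α}
    (hh : ∀ᶠ k in l, h k = h (k - 1)) : ∃ e, ∀ᶠ k in l, h k = e := by
  rcases hl with rfl | rfl
  · obtain ⟨k0, hk0⟩ := eventually_atTop.1 hh
    refine ⟨h k0, eventually_atTop.2 ⟨k0, fun k hk => ?_⟩⟩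
    induction k, hk using Int.leInduction with
    | base => rfl
    | succ n hn ih => rw [hk0 (n + 1) (by omega), add_sub_cancel_right, ih]
  · obtain ⟨k0, hk0⟩ := eventually_atBot.1 hh
    refine ⟨h k0, eventually_atBot.2 ⟨k0, fun k hk => ?_⟩⟩
    induction k, hk using Int.leInductionDown with
    | base => rfl
    | pred n hn ih => rw [← hk0 n hn, ih]

theorem eq_zero_of_eventually {E : Type*} [Ring E] [Algebra ℂ E] (hl : l = atTop ∨ l = atBot)
    {F : ℂ → E} (hF : F ∈ polyFun E) {c : ℂ} (h : ∀ᶠ k : ℤ in l, F (c + k) = 0) : F = 0 := by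
  refine eq_zero_of_mem_polyFun hF ?_
  have hinf : {k : ℤ | F (c + k) = 0}.Infinite := by
    rcases hl with rfl | rfl
    · obtain ⟨k0, hk0⟩ := eventually_atTop.1 h
      exact (Set.Ici_infinite k0).mono fun k hk => hk0 k hk
    · obtain ⟨k0, hk0⟩ := eventually_atBot.1 h
      exact (Set.Iic_infinite k0).mono fun k hk => hk0 k hk
  have hinj : Function.Injective fun k : ℤ => c + (k : ℂ) := fun a b hab => by simpa using hab
  exact (hinf.image hinj.injOn).mono (by rintro _ ⟨k, hk, rfl⟩; exact hk)

variable {E : Type*} [Ring E] [Algebra ℂ E]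

/-- The coefficients of the polynomials describing the action of the elements `t^a ∂`. -/
def leadCoeffs (l : Filter ℤ) (f : ℕ → ℤ → E) (c : ℂ) : ℕ → E
  | a =>
    haveI : Nonempty E := ⟨0⟩
    -- The value is meaningful once the displayed difference is eventually constant along `l`.
    Classical.epsilon fun e => ∀ᶠ k : ℤ in l, f a k - ∑ j : Fin a,
      ((a.choose j : ℂ) * risingFactorial (c + k + (j : ℕ)) (a - j)) • leadCoeffs l f c j = e
  decreasing_by exact j.2

/-- By induction on a, the two sides have the same backward difference, so they differ by an
eventual constant, and the next coefficient is chosen to be that constant. -/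
theorem eventually_eq_polyForm (hl : l = atTop ∨ l = atBot) {f : ℕ → ℤ → E} (c : ℂ)
    (h0 : ∀ᶠ k in l, f 0 k = 1)
    (hrec : ∀ a : ℕ, ∀ᶠ k in l, f (a + 1) k - f (a + 1) (k - 1) = ((a : ℂ) + 1) • f a k) (a : ℕ) :
    ∀ᶠ k : ℤ in l, f a k = polyForm (leadCoeffs l f c) a (c + k) := by
  set g := leadCoeffs l f c with hg
  have hP : ∀ (a : ℕ) (x : ℂ), polyForm g a x = ∑ j : Fin a,
      ((a.choose j : ℂ) * risingFactorial (x + (j : ℕ)) (a - j)) • g j + g a := by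
    intro a x
    rw [polyForm, Finset.sum_range_succ, Nat.sub_self, risingFactorial_zero, Nat.choose_self,
      Nat.cast_one, mul_one, one_smul, Finset.sum_range]
  have hspec : ∀ a, (∃ e, ∀ᶠ k : ℤ in l, f a k - (polyForm g a (c + k) - g a) = e) →
      ∀ᶠ k : ℤ in l, f a k = polyForm g a (c + k) := by
    intro a ha
    simp only [hP, add_sub_cancel_right] at ha
    have h := Classical.epsilon_spec ha
    have e : g a = Classical.epsilon fun e => ∀ᶠ k : ℤ in l, f a k - ∑ j : Fin a,
      ((a.choose j : ℂ) * risingFactorial (c + k + (j : ℕ)) (a - j)) • g j = e := by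
      conv_lhs => rw [hg, leadCoeffs]
    rw [← e] at h
    filter_upwards [h] with k hk
    rw [hP, ← hk]
    abel
  induction a with
  | zero =>
    refine hspec 0 ⟨1, ?_⟩
    filter_upwards [h0] with k hk
    rw [polyForm_zero, sub_self, sub_zero, hk]
  | succ a ih =>
    refine hspec (a + 1) (eventually_const_of_end hl ?_)
    filter_upwards [ih, hrec a] with k hk hk'
    have h := polyForm_sub g a (c + k)
    rw [← hk, ← hk'] at h
    push_cast
    rw [show c + ((k : ℂ) - 1) = c + k - 1 by ring]
    rw [sub_eq_iff_eq_add] at h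
    rw [h]
    abel

end Ends

end WittSuper
end

/-! ### The Witt series attached to an end of a graded module. -/

noncomputable section

namespace WittSuper

open Filter

theorem word_sub_pow {U : Type*} [Ring U] [Algebra ℂ U] (L : ℕ → U) (r : ℕ) :
    word L 2 ((MvPolynomial.X 0 - MvPolynomial.X 1) ^ r) =
      ∑ i ∈ Finset.range (r + 1), ((-1 : ℂ) ^ i * r.choose i) • (L (r - i) * L i) := by
  have e : (MvPolynomial.X 0 - MvPolynomial.X 1 : MvPolynomial (Fin 2) ℂ) ^ r =
      ∑ i ∈ Finset.range (r + 1), ((-1 : ℂ) ^ i * r.choose i) •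
        (MvPolynomial.X 0 ^ (r - i) * MvPolynomial.X 1 ^ i) := by
    rw [sub_eq_neg_add, add_pow]
    refine Finset.sum_congr rfl fun i _ => ?_
    rw [MvPolynomial.smul_eq_C_mul, neg_pow]
    simp only [map_mul, map_pow, map_neg, map_one, map_natCast]
    ring
  rw [e, map_sum]
  refine Finset.sum_congr rfl fun i _ => ?_
  rw [map_smul, word_two]

theorem word_odd_eq_zero {U : Type*} [Ring U] [Algebra ℂ U] {L : ℕ → U} (hL : IsWitt L) {r : ℕ}
    (hr : 2 ≤ r) (ho : Odd r) :
    word L 2 ((MvPolynomial.X 0 - MvPolynomial.X 1) ^ r) = 0 := by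
  refine word_two_eq_zero_of_skew hL
    (G := (MvPolynomial.X 0 - MvPolynomial.X 1) ^ (r - 2)) ?_ ?_
  · rw [map_pow, map_sub, MvPolynomial.aeval_X, MvPolynomial.aeval_X, ← ho.neg_pow]
    simp
  · rw [← pow_add, Nat.add_sub_cancel' hr]

variable {M V : Type*} [AddCommGroup M] [Module ℂ M] [AddCommGroup V] [Module ℂ V]
  {L : ℕ → Module.End ℂ M} {φ : ℤ → V →ₗ[ℂ] M} {c : ℂ} {l : Filter ℤ}

/-- On a graded module of a Witt algebra on which `∂` is bijective in the degrees near `±∞`, the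
alternating products `∑ (-1)^i C(r,i) t^{r-i}∂ t^i∂` act by the coefficients of a Witt series. -/
theorem exists_wittSeries_of_end (hL : IsWitt L) (hl : l = atTop ∨ l = atBot)
    (hinj : ∀ᶠ k in l, Function.Injective (φ k))
    (hdel : ∀ᶠ k in l, ∀ v, L 0 (φ k v) = φ (k - 1) v)
    (hone : ∀ᶠ k : ℤ in l, ∀ v, L 1 (φ k v) = (c + k) • φ k v)
    (hrange : ∀ a : ℕ, ∀ᶠ k in l, ∀ v, ∃ u, L a (φ k v) = φ (k + a - 1) u) :
    ∃ (γ : ℕ → Module.End ℂ V) (g : Module.End ℂ V), IsRec γ g ∧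
      PowerSeries.coeff 1 (wittSeries γ) = -1 ∧
      (∀ r, 3 ≤ r → Odd r → PowerSeries.coeff r (wittSeries γ) = 0) ∧
      ∀ r, PowerSeries.coeff r (wittSeries γ) = 0 → ∀ᶠ k in l, ∀ v,
        word L 2 ((MvPolynomial.X 0 - MvPolynomial.X 1) ^ r) (φ k v) = 0 := by
  have := neBot_of_end hl
  have hshift : ∀ {p : ℤ → Prop} (j : ℤ), (∀ᶠ k in l, p k) → ∀ᶠ k in l, p (k + j) :=
    fun j hp => (tendsto_add_of_end hl j).eventually hp
  have hex : ∀ a : ℕ, ∀ᶠ k in l, ∃ F : Module.End ℂ V, ∀ v, L a (φ k v) = φ (k + a - 1) (F v) := by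
    intro a
    filter_upwards [hrange a, hshift (a - 1) hinj] with k hk hk'
    rw [← add_sub_assoc] at hk'
    -- A left inverse makes the preimages given by `hrange` depend linearly on v.
    obtain ⟨ψ, hψ⟩ := (φ (k + a - 1)).exists_leftInverse_of_injective (LinearMap.ker_eq_bot.2 hk')
    refine ⟨ψ ∘ₗ L a ∘ₗ φ k, fun v => ?_⟩
    obtain ⟨u, hu⟩ := hk v
    have := LinearMap.congr_fun hψ u
    simp only [LinearMap.comp_apply, LinearMap.id_apply] at this ⊢
    rw [hu, this]
  let f : ℕ → ℤ → Module.End ℂ V := fun a k =>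
    Classical.epsilon fun F : Module.End ℂ V => ∀ v, L a (φ k v) = φ (k + a - 1) (F v)
  have hf : ∀ a : ℕ, ∀ᶠ k in l, ∀ v, L a (φ k v) = φ (k + a - 1) (f a k v) := fun a =>
    (hex a).mono fun k hk => Classical.epsilon_spec hk
  have hf0 : ∀ᶠ k in l, f 0 k = 1 := by
    filter_upwards [hf 0, hdel, hshift (-1) hinj] with k h1 h2 h3
    ext v
    refine h3 ?_
    rw [← sub_eq_add_neg, Module.End.one_apply, ← h2 v, h1 v]
    simp
  have hf1 : ∀ᶠ k : ℤ in l, f 1 k = (c + k) • 1 := by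
    filter_upwards [hf 1, hone, hinj] with k h1 h2 h3
    ext v
    refine h3 ?_
    rw [LinearMap.smul_apply, map_smul, Module.End.one_apply, ← h2 v, h1 v]
    simp
  have hrec : ∀ a : ℕ, ∀ᶠ k in l,
      f (a + 1) k - f (a + 1) (k - 1) = ((a : ℂ) + 1) • f a k := by
    intro a
    filter_upwards [hf (a + 1), hshift (-1) (hf (a + 1)), hf a, hdel, hshift a hdel,
      hshift (a - 1) hinj] with k h1 h2 h3 h4 h5 h6
    ext v
    refine h6 ?_
    have hb := LinearMap.congr_fun (hL 0 (a + 1)) (φ k v)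
    rw [LinearMap.sub_apply, Module.End.mul_apply, Module.End.mul_apply, LinearMap.smul_apply,
      h1 v, h4 v, sub_eq_add_neg k 1, h2 v, show 0 + (a + 1) - 1 = a by omega, h3 v,
      show k + ((a + 1 : ℕ) : ℤ) - 1 = k + a by push_cast; ring, h5,
      show k + -1 + ((a + 1 : ℕ) : ℤ) - 1 = k + a - 1 by push_cast; ring] at hb
    rw [LinearMap.sub_apply, map_sub, LinearMap.smul_apply, map_smul,
      show k + ((a : ℤ) - 1) = k + a - 1 by ring, sub_eq_add_neg k 1, hb]
    push_cast
    rw [sub_zero]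
  have hbr : ∀ a : ℕ, ∀ᶠ k in l, f 2 (k + (a - 1)) * f a k - f a (k + 1) * f 2 k =
      ((a : ℂ) - 2) • f (a + 1) k := by
    intro a
    filter_upwards [hf (a + 1), hf a, hf 2, hshift (a - 1) (hf 2), hshift 1 (hf a),
      hshift a hinj] with k h1 h2 h3 h4 h5 h6
    ext v
    refine h6 ?_
    have hb := LinearMap.congr_fun (hL 2 a) (φ k v)
    rw [LinearMap.sub_apply, Module.End.mul_apply, Module.End.mul_apply, LinearMap.smul_apply,
      h2 v, h3 v, show 2 + a - 1 = a + 1 by omega, h1 v,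
      show k + ((2 : ℕ) : ℤ) - 1 = k + 1 by push_cast; ring, h5,
      show k + (a : ℤ) - 1 = k + (a - 1) by ring, h4,
      show k + 1 + (a : ℤ) - 1 = k + a by ring,
      show k + ((a + 1 : ℕ) : ℤ) - 1 = k + a by push_cast; ring,
      show k + ((a : ℤ) - 1) + ((2 : ℕ) : ℤ) - 1 = k + a by push_cast; ring] at hb
    rw [LinearMap.sub_apply, map_sub, LinearMap.smul_apply, map_smul, Module.End.mul_apply,
      Module.End.mul_apply, hb]
    push_cast
    rfl
  set g := leadCoeffs l f c with hg
  have hp : ∀ a, ∀ᶠ k : ℤ in l, f a k = polyForm g a (c + k) :=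
    eventually_eq_polyForm hl c hf0 hrec
  have hg0 : g 0 = 1 := by
    obtain ⟨k, h1, h2⟩ := ((hp 0).and hf0).exists
    rw [← polyForm_zero g, ← h1, h2]
  have hg1 : g 1 = 0 := by
    obtain ⟨k, h1, h2⟩ := ((hp 1).and hf1).exists
    rw [polyForm_one, h2, hg0] at h1
    simpa using h1
  -- Both sides are polynomial in x and agree at the infinitely many points c + k near the end.
  have hbr' : ∀ (a : ℕ) (x : ℂ), polyForm g 2 (x + a - 1) * polyForm g a x - polyForm g a (x + 1) *
      polyForm g 2 x = ((a : ℂ) - 2) • polyForm g (a + 1) x := by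
    intro a x
    have hmem : ((fun x => polyForm g 2 (x + (a - 1))) * polyForm g a -
        (fun x => polyForm g a (x + 1)) * polyForm g 2 - ((a : ℂ) - 2) • polyForm g (a + 1)) ∈
        polyFun (Module.End ℂ V) :=
      sub_mem (sub_mem (mul_mem (polyForm_mem _ _ _) (polyForm_mem' _ _))
        (mul_mem (polyForm_mem _ _ _) (polyForm_mem' _ _))) (smul_mem_polyFun _ (polyForm_mem' _ _))
    have hz := eq_zero_of_eventually hl hmem (c := c) (by
      filter_upwards [hbr a, hp a, hp 2, hp (a + 1), hshift (a - 1) (hp 2), hshift 1 (hp a)]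
        with k h1 h2 h3 h4 h5 h6
      rw [h2, h3, h4, h5, h6] at h1
      push_cast at h1
      simp only [Pi.sub_apply, Pi.mul_apply, Pi.smul_apply]
      rw [add_assoc, add_assoc, h1, sub_self])
    have := congrFun hz x
    simp only [Pi.sub_apply, Pi.mul_apply, Pi.smul_apply, Pi.zero_apply] at this
    rw [add_sub_assoc]
    exact sub_eq_zero.1 this
  have hcoef := coeff_wittSeries_eq g
  have hword : ∀ r : ℕ, ∀ᶠ k in l, ∀ v,
      word L 2 ((MvPolynomial.X 0 - MvPolynomial.X 1) ^ r) (φ k v) = φ (k + (r - 2))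
        ((∑ j ∈ Finset.range (r + 1), ((-1 : ℂ) ^ j * r.choose j) •
          (polyForm g (r - j) (-1) * g j)) v) := by
    intro r
    have h1 : ∀ᶠ k in l, ∀ i ∈ Finset.range (r + 1), ∀ v, (L (r - i) * L i) (φ k v) =
        φ (k + (r - 2)) ((polyForm g (r - i) (c + k + i - 1) * polyForm g i (c + k)) v) := by
      refine (Filter.eventually_all_finset _).2 fun i hi => ?_
      have hi : i ≤ r := Nat.lt_succ_iff.1 (Finset.mem_range.1 hi)
      filter_upwards [hf i, hshift (i - 1) (hf (r - i)), hp i, hshift (i - 1) (hp (r - i))]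
        with k h1 h2 h3 h4 v
      push_cast at h4
      rw [Module.End.mul_apply, h1, show k + (i : ℤ) - 1 = k + (i - 1) by ring, h2, h3, h4,
        Module.End.mul_apply, show k + ((i : ℤ) - 1) + ((r - i : ℕ) : ℤ) - 1 = k + (r - 2) by
          push_cast [hi]; ring, show c + ((k : ℂ) + (i - 1)) = c + k + i - 1 by ring]
    filter_upwards [h1] with k h2 v
    rw [word_sub_pow, ← sum_polyForm_mul g r (c + k), LinearMap.sum_apply, LinearMap.sum_apply,
      map_sum]
    refine Finset.sum_congr rfl fun i hi => ?_
    rw [LinearMap.smul_apply, h2 i hi v, LinearMap.smul_apply, map_smul]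
  refine ⟨fun n => (1 / (n.factorial : ℂ)) • g n, g 2, isRec_of_bracket hg0 hg1 hbr', ?_, ?_, ?_⟩
  · rw [hcoef]
    simp [Finset.sum_range_succ, polyForm_one, polyForm_zero, hg0, hg1]
  · intro r hr hro
    rw [hcoef]
    -- One degree with an injective identification suffices to read off the vanishing of the
    -- coefficient from that of the odd word.
    obtain ⟨k, h1, h2⟩ := ((hword r).and (hshift (r - 2) hinj)).exists
    rw [word_odd_eq_zero hL (by omega) hro] at h1
    have : (∑ j ∈ Finset.range (r + 1), ((-1 : ℂ) ^ j * r.choose j) •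
        (polyForm g (r - j) (-1) * g j)) = 0 := by
      ext v
      refine h2 ?_
      rw [← h1 v]
      simp
    rw [this, smul_zero]
  · intro r hr
    rw [hcoef] at hr
    have hr0 := (smul_eq_zero.1 hr).resolve_left
      (one_div_ne_zero (by exact_mod_cast r.factorial_ne_zero))
    filter_upwards [hword r] with k hk v
    rw [hk v, hr0, LinearMap.zero_apply, map_zero]

end WittSuper
end

/-! ### Graded modules on which ∂ is surjective or injective. -/

noncomputable section

namespace WittSuper

open Filter

universe u

section Graded

variable {M : Type u} [AddCommGroup M] [Module ℂ M]

/-- A family of finite-dimensional weight spaces of bounded dimension, along a coset of `ℤ`, for an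
action of the Witt algebra of the line by operators `L a = t^a ∂`. -/
structure IsGraded (L : ℕ → Module.End ℂ M) (N : ℤ → Submodule ℂ M) (c : ℂ) (d : ℕ) : Prop where
  witt : IsWitt L
  mem : ∀ (a : ℕ) (k : ℤ), ∀ v ∈ N k, L a v ∈ N (k + a - 1)
  one : ∀ k : ℤ, ∀ v ∈ N k, L 1 v = (c + k) • v
  finite : ∀ k, FiniteDimensional ℂ (N k)
  finrank_le : ∀ k, Module.finrank ℂ (N k) ≤ d

namespace IsGraded

variable {L : ℕ → Module.End ℂ M} {N : ℤ → Submodule ℂ M} {c : ℂ} {d : ℕ}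

theorem zero_mem (h : IsGraded L N c d) {k : ℤ} {v : M} (hv : v ∈ N k) : L 0 v ∈ N (k - 1) := by
  simpa using h.mem 0 k v hv

theorem zero_mem' (h : IsGraded L N c d) {k : ℤ} {v : M} (hv : v ∈ N (k + 1)) : L 0 v ∈ N k := by
  simpa using h.zero_mem hv

theorem pow_mem (h : IsGraded L N c d) {k : ℤ} {v : M} (n : ℕ) (hv : v ∈ N (k + n)) :
    (L 0 ^ n) v ∈ N k := by
  induction n generalizing v with
  | zero => simpa using hv
  | succ n ih =>
    rw [pow_succ, Module.End.mul_apply]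
    refine ih (h.zero_mem' ?_)
    rwa [add_assoc, ← Nat.cast_succ]

/-- The restriction of `∂` to neighbouring weight spaces. -/
def del (h : IsGraded L N c d) (k : ℤ) : N (k + 1) →ₗ[ℂ] N k :=
  (L 0).restrict fun _ hv => h.zero_mem' hv

theorem del_surjective_iff (h : IsGraded L N c d) (k : ℤ) : Function.Surjective (h.del k) ↔
    ∀ v ∈ N k, ∃ u ∈ N (k + 1), L 0 u = v := by
  constructor
  · intro hs v hv
    obtain ⟨u, hu⟩ := hs ⟨v, hv⟩
    exact ⟨u, u.2, congrArg Subtype.val hu⟩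
  · rintro hs ⟨v, hv⟩
    obtain ⟨u, hu, rfl⟩ := hs v hv
    exact ⟨⟨u, hu⟩, rfl⟩

theorem del_injective_iff (h : IsGraded L N c d) (k : ℤ) : Function.Injective (h.del k) ↔
    ∀ u ∈ N (k + 1), L 0 u = 0 → u = 0 := by
  rw [injective_iff_map_eq_zero]
  constructor
  · intro hs u hu h0
    exact congrArg Subtype.val (hs ⟨u, hu⟩ (Subtype.ext h0))
  · rintro hs ⟨u, hu⟩ h0
    exact Subtype.ext (hs u hu (congrArg Subtype.val h0))

theorem exists_max (h : IsGraded L N c d) :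
    ∃ k0, ∀ k, Module.finrank ℂ (N k) ≤ Module.finrank ℂ (N k0) := by
  refine ⟨Function.argmin fun k => d - Module.finrank ℂ (N k), fun k => ?_⟩
  have h1 := Function.argmin_le (fun k => d - Module.finrank ℂ (N k)) k
  have h2 := h.finrank_le k
  have h3 := h.finrank_le (Function.argmin fun k => d - Module.finrank ℂ (N k))
  omega

/-- Surjectivity makes the dimensions nondecreasing in k. Being bounded, they are constant from some
degree on, and there surjective implies injective. -/
theorem exists_injective (h : IsGraded L N c d)
    (hs : ∀ k, ∀ v ∈ N k, ∃ u ∈ N (k + 1), L 0 u = v) :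
    ∃ k0, ∀ k, k0 ≤ k → ∀ u ∈ N (k + 1), L 0 u = 0 → u = 0 := by
  have := h.finite
  obtain ⟨k0, hk0⟩ := h.exists_max
  have hmono : ∀ k, Module.finrank ℂ (N k) ≤ Module.finrank ℂ (N (k + 1)) := fun k =>
    LinearMap.finrank_le_finrank_of_surjective ((h.del_surjective_iff k).2 (hs k))
  have heq : ∀ k, k0 ≤ k → Module.finrank ℂ (N k) = Module.finrank ℂ (N k0) := by
    intro k hk
    induction k, hk using Int.leInduction with
    | base => rfl
    | succ n hn ih => exact le_antisymm (hk0 _) (ih ▸ hmono n)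
  refine ⟨k0, fun k hk => (h.del_injective_iff k).1 ?_⟩
  rw [LinearMap.injective_iff_surjective_of_finrank_eq_finrank
    ((heq (k + 1) (by omega)).trans (heq k hk).symm)]
  exact (h.del_surjective_iff k).2 (hs k)

/-- The mirror image: injectivity makes the dimensions nonincreasing in k, so the maximal one
persists towards -∞. -/
theorem exists_surjective (h : IsGraded L N c d)
    (hi : ∀ k, ∀ u ∈ N (k + 1), L 0 u = 0 → u = 0) :
    ∃ k0, ∀ k, k < k0 → ∀ v ∈ N k, ∃ u ∈ N (k + 1), L 0 u = v := by
  have := h.finite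
  obtain ⟨k0, hk0⟩ := h.exists_max
  have hmono : ∀ k, Module.finrank ℂ (N (k + 1)) ≤ Module.finrank ℂ (N k) := fun k =>
    LinearMap.finrank_le_finrank_of_injective ((h.del_injective_iff k).2 (hi k))
  have heq : ∀ k, k ≤ k0 → Module.finrank ℂ (N k) = Module.finrank ℂ (N k0) := by
    intro k hk
    induction k, hk using Int.leInductionDown with
    | base => rfl
    | pred n hn ih =>
      refine le_antisymm (hk0 _) (ih ▸ ?_)
      have := hmono (n - 1)
      rwa [sub_add_cancel] at this
  refine ⟨k0, fun k hk => (h.del_surjective_iff k).1 ?_⟩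
  rw [← LinearMap.injective_iff_surjective_of_finrank_eq_finrank
    ((heq (k + 1) (by omega)).trans (heq k hk.le).symm)]
  exact (h.del_injective_iff k).2 (hi k)

theorem iSup_stable (h : IsGraded L N c d) (a : ℕ) : ∀ v ∈ ⨆ k, N k, L a v ∈ ⨆ k, N k := by
  intro v hv
  induction hv using Submodule.iSup_induction' with
  | mem k v hv => exact Submodule.mem_iSup_of_mem _ (h.mem a k v hv)
  | zero => rw [map_zero]; exact Submodule.zero_mem _
  | add x y _ _ hx hy => rw [map_add]; exact add_mem hx hy

theorem mem_wordKer_iSup {F : MvPolynomial (Fin 2) ℂ}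
    (hF : ∀ k, ∀ v ∈ N k, word L 2 F v = 0) : F ∈ wordKer L (⨆ k, N k) := by
  intro v hv
  induction hv using Submodule.iSup_induction' with
  | mem k v hv => exact hF k v hv
  | zero => rw [map_zero]
  | add x y _ _ hx hy => rw [map_add, hx, hy, add_zero]

/-- A power of z_0 - z_1 is invariant under simultaneous translation of both variables, which is how
∂ acts on words. -/
theorem commute_pow (h : IsGraded L N c d) (r i : ℕ) (v : M) :
    (L 0 ^ i) (word L 2 ((MvPolynomial.X 0 - MvPolynomial.X 1) ^ r) v) =
      word L 2 ((MvPolynomial.X 0 - MvPolynomial.X 1) ^ r) ((L 0 ^ i) v) := by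
  have h1 := commutator_word_two h.witt 0 ((MvPolynomial.X 0 - MvPolynomial.X 1) ^ r)
  have h2 : adPoly 0 ((MvPolynomial.X 0 - MvPolynomial.X 1) ^ r) = 0 := by
    rw [adPoly_apply]
    simp [Derivation.leibniz_pow, MvPolynomial.pderiv_X]
  rw [h2, map_zero, sub_eq_zero] at h1
  exact LinearMap.congr_fun (Commute.pow_left (show Commute (L 0) _ from h1) i) v

/-- The exponent depends on the dimension bound alone. -/
def IsBound (d R : ℕ) : Prop :=
  ∀ (V : Type u) [AddCommGroup V] [Module ℂ V] [FiniteDimensional ℂ V],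
    Module.finrank ℂ V ≤ d → ∀ (γ : ℕ → Module.End ℂ V) (g : Module.End ℂ V), IsRec γ g →
    PowerSeries.coeff 1 (wittSeries γ) = -1 →
    (∀ r, 3 ≤ r → Odd r → PowerSeries.coeff r (wittSeries γ) = 0) →
    ∃ r, 4 ≤ r ∧ r ≤ R ∧ Even r ∧ PowerSeries.coeff r (wittSeries γ) = 0

/-- Far to the right ∂ is bijective and the Witt series yields an even r ≤ R whose word vanishes
there. Every vector is ∂^n of a vector that far out, and the word commutes with ∂, so it vanishes in
all degrees. -/
theorem mul_mem_of_surjective (h : IsGraded L N c d) {R : ℕ} (hR : IsBound.{u} d R)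
    (hs : ∀ k, ∀ v ∈ N k, ∃ u ∈ N (k + 1), L 0 u = v) (F : MvPolynomial (Fin 2) ℂ) :
    (MvPolynomial.X 0 - MvPolynomial.X 1) ^ R * F ∈ wordKer L (⨆ k, N k) := by
  have := h.finite
  obtain ⟨k0, hk0⟩ := h.exists_injective hs
  have hinj : ∀ n : ℕ, ∀ k, k0 ≤ k → ∀ u ∈ N (k + n), (L 0 ^ n) u = 0 → u = 0 := by
    intro n
    induction n with
    | zero => intro k _ u _ h0; simpa using h0
    | succ n ih =>
      intro k hk u hu h0
      rw [pow_succ, Module.End.mul_apply] at h0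
      rw [Nat.cast_succ, ← add_assoc] at hu
      exact hk0 (k + n) (by omega) u hu (ih k hk _ (h.zero_mem' hu) h0)
  have hsur : ∀ n : ℕ, ∀ k, ∀ v ∈ N k, ∃ u ∈ N (k + n), (L 0 ^ n) u = v := by
    intro n
    induction n with
    | zero => intro k v hv; exact ⟨v, by simpa using hv, rfl⟩
    | succ n ih =>
      intro k v hv
      obtain ⟨u, hu, rfl⟩ := ih k v hv
      obtain ⟨w, hw, rfl⟩ := hs _ u hu
      exact ⟨w, by rwa [Nat.cast_succ, ← add_assoc], by rw [pow_succ, Module.End.mul_apply]⟩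
  -- `φ k` inverts the bijection ∂^(k - k0) from `N k` to `N k0`; below `k0` it is never used and is
  -- set to zero.
  have hφ : ∀ k : ℤ, ∃ φ : N k0 →ₗ[ℂ] M, k0 ≤ k →
      ∀ v : N k0, φ v ∈ N k ∧ (L 0 ^ (k - k0).toNat) (φ v) = v := by
    intro k
    by_cases hk : k0 ≤ k
    · obtain ⟨n, rfl⟩ := Int.le.dest hk
      let P : N (k0 + n) →ₗ[ℂ] N k0 := (L 0 ^ n).restrict fun _ hv => h.pow_mem n hv
      have hP : Function.Bijective P := by
        constructor
        · rw [injective_iff_map_eq_zero]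
          rintro ⟨u, hu⟩ h0
          exact Subtype.ext (hinj n k0 le_rfl u hu (congrArg Subtype.val h0))
        · rintro ⟨v, hv⟩
          obtain ⟨u, hu, huv⟩ := hsur n k0 v hv
          exact ⟨⟨u, hu⟩, Subtype.ext huv⟩
      refine ⟨(N (k0 + n)).subtype ∘ₗ (LinearEquiv.ofBijective P hP).symm.toLinearMap,
        fun _ v => ⟨Subtype.prop _, ?_⟩⟩
      have h1 := (LinearEquiv.ofBijective P hP).apply_symm_apply v
      have h2 := congrArg Subtype.val h1
      rw [add_sub_cancel_left, Int.toNat_natCast]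
      exact h2
    · exact ⟨0, fun hk' => absurd hk' hk⟩
  choose φ hφ using hφ
  have huniq : ∀ k, k0 ≤ k → ∀ w ∈ N k, ∀ v : N k0, (L 0 ^ (k - k0).toNat) w = v → w = φ k v := by
    intro k hk w hw v hwv
    obtain ⟨n, rfl⟩ := Int.le.dest hk
    have h1 := hφ (k0 + n) hk v
    rw [add_sub_cancel_left, Int.toNat_natCast] at h1 hwv
    exact sub_eq_zero.1 (hinj n k0 le_rfl _ (sub_mem hw h1.1) (by rw [map_sub, hwv, h1.2, sub_self]))
  have hsurφ : ∀ k, k0 ≤ k → ∀ w ∈ N k, ∃ v : N k0, w = φ k v := by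
    intro k hk w hw
    obtain ⟨n, rfl⟩ := Int.le.dest hk
    refine ⟨⟨(L 0 ^ n) w, h.pow_mem n hw⟩, huniq _ hk w hw _ ?_⟩
    rw [add_sub_cancel_left, Int.toNat_natCast]
  obtain ⟨γ, g, hrec, h1, hodd, hz⟩ := exists_wittSeries_of_end (V := N k0) (φ := φ) (c := c)
    (l := atTop) h.witt (Or.inl rfl)
    (by
      filter_upwards [eventually_ge_atTop k0] with k hk v w hvw
      refine Subtype.ext ?_
      rw [← (hφ k hk v).2, ← (hφ k hk w).2, hvw])
    (by
      filter_upwards [eventually_ge_atTop (k0 + 1)] with k hk v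
      have h1 := hφ k (by omega) v
      refine huniq (k - 1) (by omega) _ (h.zero_mem h1.1) v ?_
      rw [← Module.End.mul_apply, ← pow_succ, show (k - 1 - k0).toNat + 1 = (k - k0).toNat by omega]
      exact h1.2)
    (by
      filter_upwards [eventually_ge_atTop k0] with k hk v
      exact h.one k _ (hφ k hk v).1)
    (by
      intro a
      filter_upwards [eventually_ge_atTop (k0 + 1)] with k hk v
      exact hsurφ (k + a - 1) (by omega) _ (h.mem a k _ (hφ k (by omega) v).1))
  obtain ⟨r, hr4, hrR, hre, hr0⟩ := hR (N k0) (h.finrank_le k0) γ g hrec h1 hodd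
  obtain ⟨k1, hk1⟩ := eventually_atTop.1 (hz r hr0)
  have hmem : (MvPolynomial.X 0 - MvPolynomial.X 1) ^ r ∈ wordKer L (⨆ k, N k) := by
    refine mem_wordKer_iSup fun k v hv => ?_
    obtain ⟨n, hn1, hn2⟩ : ∃ n : ℕ, k0 ≤ k + n ∧ k1 ≤ k + n :=
      ⟨(max k0 k1 - k).toNat, by omega, by omega⟩
    obtain ⟨u, hu, rfl⟩ := hsur n k v hv
    obtain ⟨w, rfl⟩ := hsurφ _ hn1 u hu
    rw [← h.commute_pow, hk1 _ hn2, map_zero]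
  have := mul_mem_wordKer h.witt h.iSup_stable hr4 hre hmem
    ((MvPolynomial.X 0 - MvPolynomial.X 1) ^ (R - r) * F)
  rwa [← mul_assoc, ← pow_add, Nat.add_sub_cancel' hrR] at this

/-- Here the end is -∞, and the identification is ∂^(k0 - k) itself. A power of ∂ carries any vector
into the region where the word vanishes, and injectivity of ∂ brings the vanishing back. -/
theorem mul_mem_of_injective (h : IsGraded L N c d) {R : ℕ} (hR : IsBound.{u} d R)
    (hi : ∀ k, ∀ u ∈ N k, L 0 u = 0 → u = 0) (F : MvPolynomial (Fin 2) ℂ) :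
    (MvPolynomial.X 0 - MvPolynomial.X 1) ^ R * F ∈ wordKer L (⨆ k, N k) := by
  have := h.finite
  obtain ⟨k0, hk0⟩ := h.exists_surjective fun k => hi (k + 1)
  have hpow : ∀ n : ℕ, ∀ k, ∀ v ∈ N k, (L 0 ^ n) v ∈ N (k - n) := by
    intro n k v hv
    exact h.pow_mem n (by rwa [sub_add_cancel])
  have hinj : ∀ n : ℕ, ∀ k, ∀ u ∈ N k, (L 0 ^ n) u = 0 → u = 0 := by
    intro n
    induction n with
    | zero => intro k u _ h0; simpa using h0
    | succ n ih =>
      intro k u hu h0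
      rw [pow_succ, Module.End.mul_apply] at h0
      exact hi k u hu (ih _ _ (h.zero_mem hu) h0)
  have hsur : ∀ n : ℕ, ∀ v ∈ N (k0 - n), ∃ u ∈ N k0, (L 0 ^ n) u = v := by
    intro n
    induction n with
    | zero => intro v hv; exact ⟨v, by simpa using hv, rfl⟩
    | succ n ih =>
      intro v hv
      obtain ⟨w, hw, rfl⟩ := hk0 _ (by push_cast; omega) v hv
      obtain ⟨u, hu, rfl⟩ := ih w (by
        rwa [show k0 - ((n + 1 : ℕ) : ℤ) + 1 = k0 - n by push_cast; ring] at hw)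
      exact ⟨u, hu, by rw [pow_succ', Module.End.mul_apply]⟩
  let φ : ℤ → N k0 →ₗ[ℂ] M := fun k => (L 0 ^ (k0 - k).toNat) ∘ₗ (N k0).subtype
  have hφ : ∀ k, k ≤ k0 → ∀ v, φ k v ∈ N k := by
    intro k hk v
    have := hpow (k0 - k).toNat k0 v v.2
    rwa [Int.toNat_of_nonneg (by omega), sub_sub_cancel] at this
  have hsurφ : ∀ k, k ≤ k0 → ∀ w ∈ N k, ∃ v : N k0, w = φ k v := by
    intro k hk w hw
    obtain ⟨u, hu, huw⟩ := hsur (k0 - k).toNat w (by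
      rwa [Int.toNat_of_nonneg (by omega), sub_sub_cancel])
    exact ⟨⟨u, hu⟩, huw.symm⟩
  obtain ⟨γ, g, hrec, h1, hodd, hz⟩ := exists_wittSeries_of_end (V := N k0) (φ := φ) (c := c)
    (l := atBot) h.witt (Or.inr rfl)
    (Eventually.of_forall fun k => (injective_iff_map_eq_zero _).2 fun v hv =>
      Subtype.ext (hinj _ k0 v v.2 hv))
    (by
      filter_upwards [eventually_le_atBot k0] with k hk v
      change L 0 ((L 0 ^ (k0 - k).toNat) v) = (L 0 ^ (k0 - (k - 1)).toNat) v
      rw [← Module.End.mul_apply, ← pow_succ',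
        show (k0 - k).toNat + 1 = (k0 - (k - 1)).toNat by omega])
    (by
      filter_upwards [eventually_le_atBot k0] with k hk v
      exact h.one k _ (hφ k hk v))
    (by
      intro a
      filter_upwards [eventually_le_atBot (k0 - a)] with k hk v
      exact hsurφ (k + a - 1) (by omega) _ (h.mem a k _ (hφ k (by omega) v)))
  obtain ⟨r, hr4, hrR, hre, hr0⟩ := hR (N k0) (h.finrank_le k0) γ g hrec h1 hodd
  obtain ⟨k1, hk1⟩ := eventually_atBot.1 (hz r hr0)
  have hmem : (MvPolynomial.X 0 - MvPolynomial.X 1) ^ r ∈ wordKer L (⨆ k, N k) := by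
    refine mem_wordKer_iSup fun k v hv => ?_
    have hstab : word L 2 ((MvPolynomial.X 0 - MvPolynomial.X 1) ^ r) v ∈ N (k + (r - 2)) := by
      rw [word_sub_pow, LinearMap.sum_apply]
      refine sum_mem fun i hi => Submodule.smul_mem _ _ ?_
      have hi : i ≤ r := Nat.lt_succ_iff.1 (Finset.mem_range.1 hi)
      have := h.mem (r - i) _ _ (h.mem i k v hv)
      rwa [show k + (i : ℤ) - 1 + ((r - i : ℕ) : ℤ) - 1 = k + (r - 2) by push_cast [hi]; ring]
        at this
    obtain ⟨n, hn1, hn2⟩ : ∃ n : ℕ, k - n ≤ k0 ∧ k - n ≤ k1 :=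
      ⟨(k - min k0 k1).toNat, by omega, by omega⟩
    refine hinj n _ _ hstab ?_
    rw [h.commute_pow]
    obtain ⟨w, hw⟩ := hsurφ _ hn1 _ (hpow n k v hv)
    rw [hw, hk1 _ hn2]
  have := mul_mem_wordKer h.witt h.iSup_stable hr4 hre hmem
    ((MvPolynomial.X 0 - MvPolynomial.X 1) ^ (R - r) * F)
  rwa [← mul_assoc, ← pow_add, Nat.add_sub_cancel' hrR] at this

end IsGraded

end Graded

end WittSuper
end

/-! ### Torsion, divisible vectors and arbitrary graded modules. -/

noncomputable section

namespace WittSuper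

universe u

theorem word_sub_pow_mul {U : Type*} [Ring U] [Algebra ℂ U] (L : ℕ → U) (r a b : ℕ) :
    word L 2 ((MvPolynomial.X 0 - MvPolynomial.X 1) ^ r *
      (MvPolynomial.X 0 ^ a * MvPolynomial.X 1 ^ b)) =
      ∑ i ∈ Finset.range (r + 1), ((-1 : ℂ) ^ i * r.choose i) • (L (r - i + a) * L (i + b)) := by
  have e : (MvPolynomial.X 0 - MvPolynomial.X 1 : MvPolynomial (Fin 2) ℂ) ^ r *
      (MvPolynomial.X 0 ^ a * MvPolynomial.X 1 ^ b) =
      ∑ i ∈ Finset.range (r + 1), ((-1 : ℂ) ^ i * r.choose i) •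
        (MvPolynomial.X 0 ^ (r - i + a) * MvPolynomial.X 1 ^ (i + b)) := by
    rw [sub_eq_neg_add, add_pow, Finset.sum_mul]
    refine Finset.sum_congr rfl fun i _ => ?_
    rw [MvPolynomial.smul_eq_C_mul, neg_pow]
    simp only [map_mul, map_pow, map_neg, map_one, map_natCast]
    ring
  rw [e, map_sum]
  refine Finset.sum_congr rfl fun i _ => ?_
  rw [map_smul, word_two]

variable {M : Type u} [AddCommGroup M] [Module ℂ M]

theorem word_mem_of_forall {L : ℕ → Module.End ℂ M} {S : Submodule ℂ M}
    (hS : ∀ a, ∀ v ∈ S, L a v ∈ S) {v : M} (hv : ∀ a, L a v ∈ S)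
    (F : MvPolynomial (Fin 2) ℂ) : word L 2 F v ∈ S := by
  have h : S.mkQ ∘ₗ LinearMap.applyₗ v ∘ₗ word L 2 = 0 := by
    refine linearMap_ext_X_pow fun s => ?_
    simp only [LinearMap.comp_apply, Fin.prod_univ_two, word_two, LinearMap.zero_apply]
    exact (Submodule.Quotient.mk_eq_zero S).2 (hS _ _ (hv _))
  exact (Submodule.Quotient.mk_eq_zero S).1 (LinearMap.congr_fun h F)

theorem word_quotient {L : ℕ → Module.End ℂ M} {S : Submodule ℂ M}
    (hS : ∀ a, S ≤ S.comap (L a)) (F : MvPolynomial (Fin 2) ℂ) (v : M) :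
    word (fun a => S.mapQ S (L a) (hS a)) 2 F (S.mkQ v) = S.mkQ (word L 2 F v) := by
  have h : LinearMap.applyₗ (S.mkQ v) ∘ₗ word (fun a => S.mapQ S (L a) (hS a)) 2 =
      S.mkQ ∘ₗ LinearMap.applyₗ v ∘ₗ word L 2 := by
    refine linearMap_ext_X_pow fun s => ?_
    simp only [LinearMap.comp_apply, Fin.prod_univ_two, word_two]
    rfl
  exact LinearMap.congr_fun h F

namespace IsGraded

variable {L : ℕ → Module.End ℂ M} {N : ℤ → Submodule ℂ M} {c : ℂ} {d : ℕ}

theorem word_mem (h : IsGraded L N c d) (r a b : ℕ) {k : ℤ} {v : M} (hv : v ∈ N k) :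
    word L 2 ((MvPolynomial.X 0 - MvPolynomial.X 1) ^ r *
      (MvPolynomial.X 0 ^ a * MvPolynomial.X 1 ^ b)) v ∈ N (k + (r + a + b - 2)) := by
  rw [word_sub_pow_mul, LinearMap.sum_apply]
  refine sum_mem fun i hi => Submodule.smul_mem _ _ ?_
  have hi : i ≤ r := Nat.lt_succ_iff.1 (Finset.mem_range.1 hi)
  have := h.mem (r - i + a) _ _ (h.mem (i + b) k v hv)
  rwa [show k + ((i + b : ℕ) : ℤ) - 1 + ((r - i + a : ℕ) : ℤ) - 1 = k + (r + a + b - 2) by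
    push_cast [hi]; ring] at this

theorem zero_mul (h : IsGraded L N c d) (a : ℕ) (v : M) :
    L 0 (L (a + 1) v) = L (a + 1) (L 0 v) + ((a : ℂ) + 1) • L a v := by
  have hb := LinearMap.congr_fun (h.witt 0 (a + 1)) v
  rw [LinearMap.sub_apply, Module.End.mul_apply, Module.End.mul_apply, LinearMap.smul_apply,
    sub_eq_iff_eq_add', show 0 + (a + 1) - 1 = a by omega] at hb
  rw [hb]
  push_cast
  rw [sub_zero]

/-! ### Torsion -/

/-- The vectors annihilated by a power of `∂`. -/
def torsion (L : ℕ → Module.End ℂ M) : Submodule ℂ M where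
  carrier := {v | ∃ i, (L 0 ^ i) v = 0}
  add_mem' := by
    rintro v w ⟨i, hi⟩ ⟨j, hj⟩
    refine ⟨i + j, ?_⟩
    rw [map_add]
    conv_lhs => rw [add_comm i j, pow_add, Module.End.mul_apply, hi, map_zero, ← pow_add,
      add_comm j i, pow_add, Module.End.mul_apply, hj, map_zero, add_zero]
  zero_mem' := ⟨0, map_zero _⟩
  smul_mem' := by
    rintro c v ⟨i, hi⟩
    exact ⟨i, by rw [map_smul, hi, smul_zero]⟩

/-- A factor ∂ either passes through L a or lowers its index. So if ∂^n kills v, then ∂^(n+a) kills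
L a v. -/
theorem torsion_stable (h : IsGraded L N c d) (a : ℕ) : torsion L ≤ (torsion L).comap (L a) := by
  rintro v ⟨n, hn⟩
  suffices H : ∀ a n (v : M), (L 0 ^ n) v = 0 → (L 0 ^ (n + a)) (L a v) = 0 from
    ⟨n + a, H a n v hn⟩
  clear hn v n a
  intro a
  induction a with
  | zero =>
    intro n v hv
    rw [add_zero, ← Module.End.mul_apply, ← pow_succ, pow_succ', Module.End.mul_apply, hv, map_zero]
  | succ a iha =>
    intro n
    induction n with
    | zero =>
      intro v hv
      rw [pow_zero, Module.End.one_apply] at hv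
      rw [hv, map_zero, map_zero]
    | succ n ihn =>
      intro v hv
      rw [show n + 1 + (a + 1) = n + (a + 1) + 1 by ring, pow_succ, Module.End.mul_apply,
        h.zero_mul, map_add, map_smul, ihn (L 0 v) (by rwa [← Module.End.mul_apply, ← pow_succ]),
        show n + (a + 1) = n + 1 + a by ring, iha _ _ hv, smul_zero, add_zero]

theorem quotient (h : IsGraded L N c d) : IsGraded
    (fun a => (torsion L).mapQ (torsion L) (L a) (h.torsion_stable a))
    (fun k => (N k).map (torsion L).mkQ) c d where
  witt a b := by
    refine Submodule.linearMap_qext _ (LinearMap.ext fun v => ?_)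
    exact congrArg (torsion L).mkQ (LinearMap.congr_fun (h.witt a b) v)
  mem := by
    rintro a k _ ⟨v, hv, rfl⟩
    exact ⟨L a v, h.mem a k v hv, rfl⟩
  one := by
    rintro k _ ⟨v, hv, rfl⟩
    exact congrArg (torsion L).mkQ (h.one k v hv)
  finite k := by
    have := h.finite k
    infer_instance
  finrank_le k := by
    have := h.finite k
    exact (Submodule.finrank_map_le _ _).trans (h.finrank_le k)

/-- Modulo the torsion ∂ is injective, and `mul_mem_of_injective` applies to the quotient. -/
theorem word_mem_torsion (h : IsGraded L N c d) {R : ℕ} (hR : IsBound.{u} d R)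
    (F : MvPolynomial (Fin 2) ℂ) {k : ℤ} {v : M} (hv : v ∈ N k) :
    word L 2 ((MvPolynomial.X 0 - MvPolynomial.X 1) ^ R * F) v ∈ torsion L := by
  have h1 := h.quotient.mul_mem_of_injective hR (by
    rintro k _ ⟨v, hv, rfl⟩ h0
    obtain ⟨i, hi⟩ := (Submodule.Quotient.mk_eq_zero (torsion L)).1 h0
    refine (Submodule.Quotient.mk_eq_zero (torsion L)).2 ⟨i + 1, ?_⟩
    rwa [pow_succ, Module.End.mul_apply]) F
  have h2 := h1 _ (Submodule.mem_iSup_of_mem k ⟨v, hv, rfl⟩)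
  rw [word_quotient h.torsion_stable] at h2
  exact (Submodule.Quotient.mk_eq_zero (torsion L)).1 h2

/-- A submodule stable under the Witt algebra inherits the grading. -/
theorem of_le (h : IsGraded L N c d) {N' : ℤ → Submodule ℂ M} (hle : ∀ k, N' k ≤ N k)
    (hmem : ∀ (a : ℕ) (k : ℤ), ∀ v ∈ N' k, L a v ∈ N' (k + a - 1)) : IsGraded L N' c d where
  witt := h.witt
  mem := hmem
  one k v hv := h.one k v (hle k hv)
  finite k := by
    have := h.finite k
    exact Submodule.finiteDimensional_of_le (hle k)
  finrank_le k := by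
    have := h.finite k
    exact (Submodule.finrank_mono (hle k)).trans (h.finrank_le k)

theorem torsionPart (h : IsGraded L N c d) : IsGraded L (fun k => N k ⊓ torsion L) c d :=
  h.of_le (fun _ => inf_le_left) fun a k v hv =>
    ⟨h.mem a k v hv.1, h.torsion_stable a hv.2⟩

/-! ### The divisible part -/

/-- The vectors that are infinitely divisible by `∂`. -/
def divisible (L : ℕ → Module.End ℂ M) (N : ℤ → Submodule ℂ M) (k : ℤ) : Submodule ℂ M :=
  ⨅ i : ℕ, (N (k + i)).map (L 0 ^ i)

theorem mem_divisible {k : ℤ} {v : M} :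
    v ∈ divisible L N k ↔ ∀ i : ℕ, ∃ u ∈ N (k + i), (L 0 ^ i) u = v := by
  simp [divisible, Submodule.mem_iInf]

theorem divisible_le (k : ℤ) : divisible L N k ≤ N k := fun v hv => by
  obtain ⟨u, hu, rfl⟩ := mem_divisible.1 hv 0
  simpa using hu

theorem map_antitone (h : IsGraded L N c d) (k : ℤ) {i j : ℕ} (hij : i ≤ j) :
    (N (k + j)).map (L 0 ^ j) ≤ (N (k + i)).map (L 0 ^ i) := by
  rintro _ ⟨u, hu, rfl⟩
  obtain ⟨n, rfl⟩ := Nat.exists_eq_add_of_le hij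
  refine ⟨(L 0 ^ n) u, h.pow_mem n ?_, ?_⟩
  · rwa [add_assoc, ← Nat.cast_add]
  · rw [pow_add, Module.End.mul_apply]

/-- The images of ∂^i form a decreasing chain of finite-dimensional spaces, stationary from any
stage of minimal dimension. -/
theorem exists_map_le_divisible (h : IsGraded L N c d) (k : ℤ) :
    ∃ i : ℕ, (N (k + i)).map (L 0 ^ i) ≤ divisible L N k := by
  have := h.finite
  set f : ℕ → ℕ := fun i => Module.finrank ℂ ((N (k + i)).map (L 0 ^ i)) with hf
  refine ⟨Function.argmin f, le_iInf fun i => ?_⟩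
  rcases le_total i (Function.argmin f) with hi | hi
  · exact h.map_antitone k hi
  · exact (Submodule.eq_of_le_of_finrank_le (h.map_antitone k hi) (Function.argmin_le f i)).ge

/-- Moving L a past powers of ∂ uses up at most a of them, each loss lowering the index by one.
Hence the divisible part is stable. -/
theorem exists_pow_eq (h : IsGraded L N c d) (a : ℕ) : ∀ (i : ℕ) (k : ℤ), ∀ u ∈ N (k + (i + a)),
    ∃ w ∈ N (k + a - 1 + i), (L 0 ^ i) w = L a ((L 0 ^ (i + a)) u) := by
  induction a with
  | zero =>
    intro i k u hu
    refine ⟨L 0 u, ?_, ?_⟩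
    · have := h.zero_mem hu
      rwa [show k + ((i : ℤ) + ((0 : ℕ) : ℤ)) - 1 = k + ((0 : ℕ) : ℤ) - 1 + i by ring] at this
    · rw [← Module.End.mul_apply, ← Module.End.mul_apply, ← pow_succ, add_zero, ← pow_succ']
  | succ a iha =>
    intro i
    induction i with
    | zero =>
      intro k u hu
      refine ⟨L (a + 1) ((L 0 ^ (0 + (a + 1))) u), ?_, by simp⟩
      rw [Nat.cast_zero, add_zero]
      refine h.mem _ _ _ (h.pow_mem _ ?_)
      simpa using hu
    | succ i ihi =>
      intro k u hu
      obtain ⟨w1, hw1, e1⟩ := ihi (k + 1) u (by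
        rwa [show k + 1 + ((i : ℤ) + ((a + 1 : ℕ) : ℤ)) =
          k + (((i + 1 : ℕ) : ℤ) + ((a + 1 : ℕ) : ℤ)) by push_cast; ring])
      obtain ⟨w2, hw2, e2⟩ := iha (i + 1) (k + 1) u (by
        rwa [show k + 1 + (((i + 1 : ℕ) : ℤ) + (a : ℤ)) =
          k + (((i + 1 : ℕ) : ℤ) + ((a + 1 : ℕ) : ℤ)) by push_cast; ring])
      refine ⟨w1 - ((a : ℂ) + 1) • w2, sub_mem ?_ (Submodule.smul_mem _ _ ?_), ?_⟩
      · rwa [show k + ((a + 1 : ℕ) : ℤ) - 1 + ((i + 1 : ℕ) : ℤ) =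
          k + 1 + ((a + 1 : ℕ) : ℤ) - 1 + i by push_cast; ring]
      · rwa [show k + ((a + 1 : ℕ) : ℤ) - 1 + ((i + 1 : ℕ) : ℤ) =
          k + 1 + (a : ℤ) - 1 + ((i + 1 : ℕ) : ℤ) by push_cast; ring]
      · rw [map_sub, map_smul, e2, pow_succ', Module.End.mul_apply, e1, h.zero_mul,
          show i + 1 + (a + 1) = i + (a + 1) + 1 by ring, pow_succ' _ (i + (a + 1)),
          Module.End.mul_apply, show i + 1 + a = i + (a + 1) by ring]
        abel

theorem divisiblePart (h : IsGraded L N c d) : IsGraded L (divisible L N) c d :=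
  h.of_le divisible_le fun a k v hv => mem_divisible.2 fun i => by
    obtain ⟨u, hu, rfl⟩ := mem_divisible.1 hv (i + a)
    exact h.exists_pow_eq a i k u (by simpa using hu)

/-- A Mittag-Leffler argument: a preimage of the form ∂^i u, with i in the stationary range for
degree k + 1, is itself divisible. -/
theorem divisible_surjective (h : IsGraded L N c d) (k : ℤ) :
    ∀ v ∈ divisible L N k, ∃ u ∈ divisible L N (k + 1), L 0 u = v := by
  intro v hv
  obtain ⟨i, hi⟩ := h.exists_map_le_divisible (k + 1)
  obtain ⟨u, hu, rfl⟩ := mem_divisible.1 hv (i + 1)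
  refine ⟨(L 0 ^ i) u, hi ⟨u, ?_, rfl⟩, ?_⟩
  · rwa [show k + 1 + (i : ℤ) = k + ((i + 1 : ℕ) : ℤ) by push_cast; ring]
  · rw [← Module.End.mul_apply, ← pow_succ']

theorem pow_eq_factorial_smul (h : IsGraded L N c d) {v : M} (hv : L 0 v = 0) (i : ℕ) :
    (L 0 ^ i) (L (i + 1) v) = ((i + 1).factorial : ℂ) • L 1 v := by
  induction i with
  | zero => simp
  | succ i ih =>
    rw [pow_succ, Module.End.mul_apply, h.zero_mul, hv, map_zero, zero_add, map_smul, ih, smul_smul,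
      Nat.factorial_succ (i + 1)]
    push_cast
    rfl

/-- Subtracting a divisible vector with the same image under ∂ leaves some w with ∂w = 0. Then ∂^i L
(i + 1) w = (i + 1)! (c + k) w displays w as divisible, provided that the weight is nonzero. -/
theorem mem_divisible_of_zero (h : IsGraded L N c d) {k : ℤ} (hk : c + k ≠ 0) {v : M}
    (hv : v ∈ N k) (h0 : L 0 v ∈ divisible L N (k - 1)) : v ∈ divisible L N k := by
  obtain ⟨v', hv', hvv⟩ := h.divisible_surjective (k - 1) _ h0
  rw [sub_add_cancel] at hv'
  have hw : v - v' ∈ divisible L N k := mem_divisible.2 fun i => by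
    have h1 := h.pow_eq_factorial_smul (v := v - v') (by rw [map_sub, hvv, sub_self]) i
    have hm : v - v' ∈ N k := sub_mem hv (divisible_le k hv')
    rw [h.one k _ hm, smul_smul] at h1
    have hne : ((i + 1).factorial : ℂ) * (c + k) ≠ 0 :=
      mul_ne_zero (by exact_mod_cast (i + 1).factorial_ne_zero) hk
    refine ⟨(((i + 1).factorial : ℂ) * (c + k))⁻¹ • L (i + 1) (v - v'), Submodule.smul_mem _ _ ?_, ?_⟩
    · have := h.mem (i + 1) k _ hm
      rwa [show k + ((i + 1 : ℕ) : ℤ) - 1 = k + i by push_cast; ring] at this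
    · rw [map_smul, h1, inv_smul_smul₀ hne]
  have := add_mem hw hv'
  rwa [sub_add_cancel] at this

theorem mem_divisible_of_pow (h : IsGraded L N c d) (n : ℕ) : ∀ {k : ℤ},
    (∀ i < n, c + k ≠ (i : ℂ)) → ∀ v ∈ N k, (L 0 ^ n) v ∈ divisible L N (k - n) →
      v ∈ divisible L N k := by
  induction n with
  | zero => intro k _ v _ hn; simpa using hn
  | succ n ih =>
    intro k hk v hv hn
    refine h.mem_divisible_of_zero (by simpa using hk 0 n.succ_pos) hv (ih ?_ _ (h.zero_mem hv) ?_)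
    · intro i hi hci
      refine hk (i + 1) (by omega) ?_
      push_cast at hci ⊢
      linear_combination hci
    · rw [← Module.End.mul_apply, ← pow_succ]
      rwa [show k - 1 - (n : ℤ) = k - ((n + 1 : ℕ) : ℤ) by push_cast; ring]

/-- Needed to cross weight 0, where `mem_divisible_of_zero` gives nothing: L 2 leads from weight -1
to weight 1 - 1 = 0 directly. -/
theorem two_mul_pow (h : IsGraded L N c d) (i : ℕ) (v : M) :
    L 2 ((L 0 ^ (i + 1)) v) = (L 0 ^ (i + 1)) (L 2 v) -
      (2 * ((i : ℂ) + 1)) • (L 0 ^ i) (L 1 v) + (((i : ℂ) + 1) * i) • (L 0 ^ i) v := by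
  induction i generalizing v with
  | zero =>
    have := h.zero_mul 1 v
    push_cast at this
    simp only [zero_add, pow_one, pow_zero, Module.End.one_apply, Nat.cast_zero, mul_zero, zero_smul,
      add_zero, mul_one]
    rw [this]
    module
  | succ i ih =>
    have h2 := h.zero_mul 1 v
    have h1 := h.zero_mul 0 v
    rw [pow_succ, Module.End.mul_apply, ih, ← sub_eq_iff_eq_add.2 h1, ← sub_eq_iff_eq_add.2 h2]
    simp only [pow_succ, Module.End.mul_apply, map_sub, map_smul]
    push_cast
    module

/-- If `∂` is locally nilpotent, every vector of nonzero weight is infinitely divisible by `∂`. -/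
theorem mem_divisible_of_ne_zero (h : IsGraded L N c d)
    (hnil : ∀ k, ∀ v ∈ N k, ∃ n, (L 0 ^ n) v = 0) {k : ℤ} (hk : c + k ≠ 0) {v : M} (hv : v ∈ N k) :
    v ∈ divisible L N k := by
  -- If the weight is not a natural number, applying ∂ until it kills the vector never meets weight
  -- 0.
  have hnat : ∀ k : ℤ, (∀ n : ℕ, c + k ≠ n) → ∀ v ∈ N k, v ∈ divisible L N k := by
    intro k hk v hv
    obtain ⟨n, hn⟩ := hnil k v hv
    exact h.mem_divisible_of_pow n (fun i _ => hk i) v hv (by rw [hn]; exact Submodule.zero_mem _)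
  by_cases hex : ∃ n : ℕ, c + k = n
  · obtain ⟨x, hx⟩ := hex
    obtain ⟨k0, rfl⟩ : ∃ k0 : ℤ, k = k0 + x := ⟨k - x, by ring⟩
    have hc : c = -(k0 : ℂ) := by
      push_cast at hx
      linear_combination hx
    have hx1 : 1 ≤ x := by
      rcases x with _ | x
      · exact absurd (by simpa using hx) hk
      · omega
    have hdesc : ∀ (x : ℕ), ∀ v ∈ N (k0 + x), (L 0 ^ x) v ∈ divisible L N k0 →
        v ∈ divisible L N (k0 + x) := by
      intro x v hv h0
      refine h.mem_divisible_of_pow x (fun i hi hci => ?_) v hv (by rwa [add_sub_cancel_right])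
      rw [hc] at hci
      push_cast at hci
      have : (x : ℂ) = i := by linear_combination hci
      exact hi.ne' (by exact_mod_cast this)
    obtain ⟨i0, hi0⟩ := h.exists_map_le_divisible k0
    -- For positive integral weight x the induction descends from x ≥ i0, where ∂^x v is already
    -- divisible in weight 0.
    have hP : ∀ n x : ℕ, 1 ≤ x → i0 ≤ x + n → ∀ v ∈ N (k0 + x), v ∈ divisible L N (k0 + x) := by
      intro n
      induction n with
      | zero =>
        intro x _ hx v hv
        exact hdesc x v hv (hi0 (h.map_antitone k0 hx ⟨v, hv, rfl⟩))
      | succ n ih =>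
        intro x hx1 hx v hv
        have h2v : L 2 v ∈ divisible L N (k0 + (x + 1 : ℕ)) := by
          refine ih (x + 1) (by omega) (by omega) _ ?_
          have := h.mem 2 _ v hv
          rwa [show k0 + (x : ℤ) + ((2 : ℕ) : ℤ) - 1 = k0 + ((x + 1 : ℕ) : ℤ) by push_cast; ring]
            at this
        -- This vector has weight -1, where divisibility is known. Applying L 2 and using L 2 v
        -- divisible leaves x(x + 1) ∂^x v in the divisible part.
        have hz : (L 0 ^ (x + 1)) v ∈ divisible L N (k0 - 1) := by
          refine hnat (k0 - 1) (fun n hn => ?_) _ (h.pow_mem (x + 1) ?_)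
          · rw [hc] at hn
            push_cast at hn
            have : ((n + 1 : ℕ) : ℂ) = 0 := by push_cast; linear_combination -hn
            exact n.succ_ne_zero (by exact_mod_cast this)
          · rwa [show k0 - 1 + ((x + 1 : ℕ) : ℤ) = k0 + x by push_cast; ring]
        have h2z := h.divisiblePart.mem 2 _ _ hz
        rw [show k0 - 1 + ((2 : ℕ) : ℤ) - 1 = k0 by push_cast; ring, h.two_mul_pow,
          h.one _ v hv] at h2z
        have h3 := h.divisiblePart.pow_mem (x + 1) h2v
        refine hdesc x v hv ?_
        have h4 := sub_mem h3 h2z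
        have hcx : c + ((k0 + (x : ℤ) : ℤ) : ℂ) = x := by rw [hc]; push_cast; ring
        rw [hcx] at h4
        have e : (L 0 ^ (x + 1)) (L 2 v) - ((L 0 ^ (x + 1)) (L 2 v) -
            (2 * ((x : ℂ) + 1)) • (L 0 ^ x) ((x : ℂ) • v) + (((x : ℂ) + 1) * x) • (L 0 ^ x) v) =
            (((x : ℂ) + 1) * x) • (L 0 ^ x) v := by
          rw [map_smul]
          module
        rw [e] at h4
        have hne : ((x : ℂ) + 1) * x ≠ 0 :=
          mul_ne_zero (by exact_mod_cast x.succ_ne_zero) (by exact_mod_cast (by omega : x ≠ 0))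
        exact (Submodule.smul_mem_iff _ hne).1 h4
    exact hP i0 x hx1 (by omega) v hv
  · exact hnat k (by simpa using hex) v hv

/-- Only a target of weight 0 needs care: either a = 1 and L 1 acts by the weight 0, or the source
has nonzero weight and v is divisible already. -/
theorem mem_divisible_of_nilpotent (h : IsGraded L N c d)
    (hnil : ∀ k, ∀ v ∈ N k, ∃ n, (L 0 ^ n) v = 0) (a : ℕ) {k : ℤ} {v : M} (hv : v ∈ N k) :
    L a v ∈ divisible L N (k + a - 1) := by
  by_cases h1 : c + ((k + a - 1 : ℤ) : ℂ) = 0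
  · by_cases ha : a = 1
    · subst ha
      rw [h.one k v hv]
      have : c + (k : ℂ) = 0 := by
        push_cast at h1
        linear_combination h1
      rw [this, zero_smul]
      exact Submodule.zero_mem _
    · refine h.divisiblePart.mem a k v (h.mem_divisible_of_ne_zero hnil (fun h2 => ha ?_) hv)
      push_cast at h1
      have : (a : ℂ) = 1 := by linear_combination h1 - h2
      exact_mod_cast this
  · exact h.mem_divisible_of_ne_zero hnil h1 (h.mem a k v hv)

/-- The alternating products of large order vanish on a graded module of bounded dimension. -/
theorem mul_mem (h : IsGraded L N c d) {R : ℕ} (hR : IsBound.{u} d R) (hRe : Even R) (hR4 : 4 ≤ R)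
    (F : MvPolynomial (Fin 2) ℂ) :
    (MvPolynomial.X 0 - MvPolynomial.X 1) ^ (16 * R) * F ∈ wordKer L (⨆ k, N k) := by
  obtain ⟨s, hs⟩ := hRe
  have hT := h.torsionPart
  have hD := hT.divisiblePart
  have hnil : ∀ k, ∀ v ∈ N k ⊓ torsion L, ∃ n, (L 0 ^ n) v = 0 := fun k v hv => hv.2
  -- On the torsion the inner word lands in the divisible part, where the outer one vanishes. With
  -- 2s = R the conversion of products into one word gives exponent 8s = 4R.
  have hTker : ∀ G, (MvPolynomial.X 0 - MvPolynomial.X 1) ^ (4 * R) * G ∈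
      wordKer L (⨆ k, N k ⊓ torsion L) := by
    intro G
    have h1 := pow_mem_wordKer_of_mul h.witt (r := s) (by omega) (S := ⨆ k, N k ⊓ torsion L) (by
      intro F t v hv
      refine hD.mul_mem_of_surjective hR hT.divisible_surjective F _ ?_ |> fun h => by
        rwa [show 2 * s = R by omega]
      refine word_mem_of_forall hD.iSup_stable (fun a => ?_) _
      induction hv using Submodule.iSup_induction' with
      | mem k v hv => exact Submodule.mem_iSup_of_mem _ (hT.mem_divisible_of_nilpotent hnil a hv)
      | zero => rw [map_zero]; exact Submodule.zero_mem _
      | add x y _ _ hx hy => rw [map_add]; exact add_mem hx hy)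
    rw [show 8 * s = 4 * R by omega] at h1
    exact mul_mem_wordKer h.witt hT.iSup_stable (by omega) ⟨2 * R, by ring⟩ h1 G
  -- On the whole module the inner word lands in the torsion, which the outer word of order 4R
  -- kills; one more conversion gives 16R.
  have h2 := pow_mem_wordKer_of_mul h.witt (r := 2 * R) (by omega) (S := ⨆ k, N k) (by
    intro F t v hv
    rw [show 2 * (2 * R) = 4 * R by ring]
    refine hTker F _ ?_
    induction hv using Submodule.iSup_induction' with
    | mem k v hv =>
      rw [Fin.prod_univ_two]
      refine Submodule.mem_iSup_of_mem (k + ((4 * R : ℕ) + t 0 + t 1 - 2))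
        ⟨h.word_mem _ _ _ hv, ?_⟩
      rw [show 4 * R = R + 3 * R by ring, pow_add, mul_assoc]
      exact h.word_mem_torsion hR _ hv
    | zero => rw [map_zero]; exact Submodule.zero_mem _
    | add x y _ _ hx hy => rw [map_add]; exact add_mem hx hy)
  rw [show 8 * (2 * R) = 16 * R by ring] at h2
  exact mul_mem_wordKer h.witt h.iSup_stable (by omega) ⟨8 * R, by ring⟩ h2 F

end IsGraded

/-- The exponent can be chosen uniformly for all graded modules of bounded dimension. -/
theorem exists_uniform_exponent (d : ℕ) : ∃ R : ℕ, 4 ≤ R ∧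
    ∀ (M : Type u) [AddCommGroup M] [Module ℂ M] (L : ℕ → Module.End ℂ M) (N : ℤ → Submodule ℂ M)
      (c : ℂ), IsGraded L N c d → ∀ F, (MvPolynomial.X 0 - MvPolynomial.X 1) ^ R * F ∈
        wordKer L (⨆ k, N k) := by
  obtain ⟨R, hR⟩ := exists_even_coeff_wittSeries_eq_zero.{u} d
  refine ⟨16 * (2 * R + 4), by omega, fun M _ _ L N c h F => h.mul_mem ?_ ⟨R + 2, by ring⟩
    (by omega) F⟩
  intro V _ _ _ hV γ g hrec h1 hodd
  obtain ⟨r, h4, hr, he, h0⟩ := hR V hV γ g hrec h1 hodd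
  exact ⟨r, h4, by omega, he, h0⟩

end WittSuper
end

/-! ### Pairings of two different families of operators. -/

noncomputable section

namespace WittSuper

section Pairing

open MvPolynomial

variable {U : Type*} [Ring U] [Algebra ℂ U]

/-- The linear map sending `z₁^a z₂^b` to `K a * K' b`. -/
def pairing (K K' : ℕ → U) : MvPolynomial (Fin 2) ℂ →ₗ[ℂ] U :=
  (basisMonomials (Fin 2) ℂ).constr ℂ fun s => K (s 0) * K' (s 1)

theorem pairing_X_pow (K K' : ℕ → U) (a b : ℕ) :
    pairing K K' (X 0 ^ a * X 1 ^ b) = K a * K' b := by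
  have h := (basisMonomials (Fin 2) ℂ).constr_basis ℂ (fun s => K (s 0) * K' (s 1))
    (Finsupp.single 0 a + Finsupp.single 1 b)
  rw [coe_basisMonomials] at h
  have e : (X 0 ^ a * X 1 ^ b : MvPolynomial (Fin 2) ℂ) =
      monomial (Finsupp.single 0 a + Finsupp.single 1 b) 1 := by
    rw [X_pow_eq_monomial, X_pow_eq_monomial, monomial_mul, one_mul]
  rw [e]
  refine h.trans ?_
  simp

theorem pairing_self (L : ℕ → U) (F : MvPolynomial (Fin 2) ℂ) :
    pairing L L F = word L 2 F := by
  have : pairing L L = word L 2 := linearMap_ext_X_pow fun s => by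
    rw [Fin.prod_univ_two, pairing_X_pow, word_two]
  rw [this]

theorem pairing_zero_left (K : ℕ → U) (F : MvPolynomial (Fin 2) ℂ) :
    pairing (fun _ => 0) K F = 0 := by
  have : pairing (fun _ => 0) K = 0 := linearMap_ext_X_pow fun s => by
    rw [Fin.prod_univ_two, pairing_X_pow, zero_mul, LinearMap.zero_apply]
  rw [this, LinearMap.zero_apply]

theorem pairing_sub_left (K K1 L : ℕ → U) (F : MvPolynomial (Fin 2) ℂ) :
    pairing (fun a => K a - K1 a) L F = pairing K L F - pairing K1 L F := by
  have : pairing (fun a => K a - K1 a) L = pairing K L - pairing K1 L :=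
    linearMap_ext_X_pow fun s => by
      rw [Fin.prod_univ_two, LinearMap.sub_apply, pairing_X_pow, pairing_X_pow, pairing_X_pow,
        sub_mul]
  rw [this, LinearMap.sub_apply]

theorem X_pow_mul_pderiv_zero (c a b : ℕ) :
    (X 0 ^ c * pderiv 0 (X 0 ^ a * X 1 ^ b) : MvPolynomial (Fin 2) ℂ) =
      (a : ℂ) • (X 0 ^ (a + c - 1) * X 1 ^ b) := by
  rcases a with _ | a
  · simp [Derivation.leibniz_pow, pderiv_X]
  · simp [Derivation.leibniz_pow, pderiv_X, smul_eq_C_mul, show a + 1 + c - 1 = c + a by omega]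
    ring

theorem X_pow_mul_pderiv_one (c a b : ℕ) :
    (X 1 ^ c * pderiv 1 (X 0 ^ a * X 1 ^ b) : MvPolynomial (Fin 2) ℂ) =
      (b : ℂ) • (X 0 ^ a * X 1 ^ (b + c - 1)) := by
  rcases b with _ | b
  · simp [Derivation.leibniz_pow, pderiv_X]
  · simp [Derivation.leibniz_pow, pderiv_X, smul_eq_C_mul, show b + 1 + c - 1 = c + b by omega]
    ring

/-- Leibniz rule for moving Y across both factors. The auxiliary families collect the parts of the
bracket proportional to a or b, to c, and independent of both; s is the Koszul sign from the left
factor. -/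
theorem pairing_commutator {Y : U} {P Q P0 P1 P2 Q0 Q1 : ℕ → U} {s : ℂ} {c : ℕ}
    (hP : ∀ a, Y * P a - s • (P a * Y) =
      (a : ℂ) • P1 (a + c - 1) - (c : ℂ) • P0 (a + c - 1) + P2 (a + c))
    (hQ : ∀ b, Y * Q b - Q b * Y = (b : ℂ) • Q1 (b + c - 1) - (c : ℂ) • Q0 (b + c - 1))
    (F : MvPolynomial (Fin 2) ℂ) :
    Y * pairing P Q F - s • (pairing P Q F * Y) =
      pairing P1 Q (X 0 ^ c * pderiv 0 F) - (c : ℂ) • pairing P0 Q (X 0 ^ (c - 1) * F) +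
      pairing P2 Q (X 0 ^ c * F) +
      s • (pairing P Q1 (X 1 ^ c * pderiv 1 F) - (c : ℂ) • pairing P Q0 (X 1 ^ (c - 1) * F)) := by
  have key : LinearMap.mulLeft ℂ Y ∘ₗ pairing P Q - s • (LinearMap.mulRight ℂ Y ∘ₗ pairing P Q) =
      pairing P1 Q ∘ₗ LinearMap.mulLeft ℂ (X 0 ^ c) ∘ₗ (pderiv 0).toLinearMap -
      (c : ℂ) • (pairing P0 Q ∘ₗ LinearMap.mulLeft ℂ (X 0 ^ (c - 1))) +
      pairing P2 Q ∘ₗ LinearMap.mulLeft ℂ (X 0 ^ c) +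
      s • (pairing P Q1 ∘ₗ LinearMap.mulLeft ℂ (X 1 ^ c) ∘ₗ (pderiv 1).toLinearMap -
        (c : ℂ) • (pairing P Q0 ∘ₗ LinearMap.mulLeft ℂ (X 1 ^ (c - 1)))) := by
    refine linearMap_ext_X_pow fun t => ?_
    simp only [LinearMap.add_apply, LinearMap.sub_apply, LinearMap.smul_apply,
      LinearMap.comp_apply, Fin.prod_univ_two, LinearMap.mulLeft_apply, LinearMap.mulRight_apply]
    have e0 := X_pow_mul_pderiv_zero c (t 0) (t 1)
    have e1 := X_pow_mul_pderiv_one c (t 0) (t 1)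
    have f0 : (c : ℂ) • pairing P0 Q (X 0 ^ (c - 1) * (X 0 ^ t 0 * X 1 ^ t 1)) =
        (c : ℂ) • (P0 (t 0 + c - 1) * Q (t 1)) := by
      rcases c with _ | c
      · simp
      · rw [← mul_assoc, ← pow_add, pairing_X_pow, show c + 1 - 1 + t 0 = t 0 + (c + 1) - 1 by omega]
    have f1 : (c : ℂ) • pairing P Q0 (X 1 ^ (c - 1) * (X 0 ^ t 0 * X 1 ^ t 1)) =
        (c : ℂ) • (P (t 0) * Q0 (t 1 + c - 1)) := by
      rcases c with _ | c
      · simp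
      · rw [mul_left_comm, ← pow_add, pairing_X_pow,
          show c + 1 - 1 + t 1 = t 1 + (c + 1) - 1 by omega]
    have f2 : pairing P2 Q (X 0 ^ c * (X 0 ^ t 0 * X 1 ^ t 1)) = P2 (t 0 + c) * Q (t 1) := by
      rw [← mul_assoc, ← pow_add, pairing_X_pow, add_comm]
    rw [f0, f1, f2]
    change _ = pairing P1 Q (X 0 ^ c * pderiv 0 (X 0 ^ t 0 * X 1 ^ t 1)) - _ + _ +
      s • (pairing P Q1 (X 1 ^ c * pderiv 1 (X 0 ^ t 0 * X 1 ^ t 1)) - _)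
    rw [e0, e1, map_smul, map_smul, pairing_X_pow, pairing_X_pow, pairing_X_pow]
    have h1 := congrArg (· * Q (t 1)) (hP (t 0))
    have h2 := congrArg (fun x => s • (P (t 0) * x)) (hQ (t 1))
    simp only [sub_mul, add_mul, mul_sub, smul_sub, smul_mul_assoc, mul_smul_comm] at h1 h2
    have h3 := congrArg₂ (· + ·) h1 h2
    simp only [← mul_assoc] at h3 ⊢
    rw [show Y * P (t 0) * Q (t 1) - s • (P (t 0) * Q (t 1) * Y) =
      Y * P (t 0) * Q (t 1) - s • (P (t 0) * Y * Q (t 1)) +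
        (s • (P (t 0) * Y * Q (t 1)) - s • (P (t 0) * Q (t 1) * Y)) by abel, h3, smul_sub]
  exact LinearMap.congr_fun key F

/-- The polynomials divisible by `(z₁ - z₂)^r` pair to zero. -/
def Annihilates (K K' : ℕ → U) (r : ℕ) : Prop :=
  ∀ F : MvPolynomial (Fin 2) ℂ, pairing K K' ((X 0 - X 1) ^ r * F) = 0

theorem Annihilates.mono {K K' : ℕ → U} {r q : ℕ} (h : Annihilates K K' r) (hrq : r ≤ q) :
    Annihilates K K' q := fun F => by
  rw [← Nat.add_sub_cancel' hrq, pow_add, mul_assoc]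
  exact h _

theorem pderiv_zero_sub_pow (r : ℕ) (F : MvPolynomial (Fin 2) ℂ) :
    pderiv 0 ((X 0 - X 1) ^ (r + 1) * F) =
      (X 0 - X 1) ^ r * (((r : MvPolynomial (Fin 2) ℂ) + 1) * F + (X 0 - X 1) * pderiv 0 F) := by
  simp [Derivation.leibniz, Derivation.leibniz_pow, pderiv_X]
  ring

theorem pderiv_one_sub_pow (r : ℕ) (F : MvPolynomial (Fin 2) ℂ) :
    pderiv 1 ((X 0 - X 1) ^ (r + 1) * F) =
      (X 0 - X 1) ^ r * (-((r : MvPolynomial (Fin 2) ℂ) + 1) * F + (X 0 - X 1) * pderiv 1 F) := by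
  simp [Derivation.leibniz, Derivation.leibniz_pow, pderiv_X]
  ring

variable {L K : ℕ → U} {r : ℕ}

theorem Annihilates.commutator {K1 : ℕ → U} (hL : Annihilates L L r)
    (hK : ∀ c a, K c * L a - L a * K c =
      (a : ℂ) • K1 (a + c - 1) - (c : ℂ) • K (a + c - 1)) (c : ℕ) (F : MvPolynomial (Fin 2) ℂ) :
    pairing K1 L (X 0 ^ c * pderiv 0 ((X 0 - X 1) ^ r * F)) -
      (c : ℂ) • pairing K L (X 0 ^ (c - 1) * ((X 0 - X 1) ^ r * F)) +
    (pairing L K1 (X 1 ^ c * pderiv 1 ((X 0 - X 1) ^ r * F)) -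
      (c : ℂ) • pairing L K (X 1 ^ (c - 1) * ((X 0 - X 1) ^ r * F))) = 0 := by
  have h := pairing_commutator (Y := K c) (P := L) (Q := L) (P0 := K) (P1 := K1) (P2 := fun _ => 0)
    (Q0 := K) (Q1 := K1) (s := 1) (c := c) (fun a => by rw [one_smul, add_zero, hK])
    (fun b => hK c b) ((X 0 - X 1) ^ r * F)
  rw [hL, mul_zero, zero_mul, smul_zero, sub_zero, pairing_zero_left, add_zero, one_smul] at h
  exact h.symm

/-- Put u = z_0 - z_1. The commutator with K 1 at z_1 F and that with K 2 at F have the same ⟨L, K⟩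
term z_1 u^r F; subtracting them leaves ⟨K, L⟩ at (z_0 - z_1) u^r F. -/
theorem Annihilates.of_commutator_zero (hL : Annihilates L L r)
    (hK : ∀ c a, K c * L a - L a * K c = -((c : ℂ) • K (a + c - 1))) :
    Annihilates K L (r + 1) := by
  intro F
  have hK' : ∀ c a, K c * L a - L a * K c =
      (a : ℂ) • (fun _ => 0 : ℕ → U) (a + c - 1) - (c : ℂ) • K (a + c - 1) := fun c a => by
    rw [hK, smul_zero, zero_sub]
  have hz : ∀ G, pairing L (fun _ => (0 : U)) G = 0 := fun G => by
    have : pairing L (fun _ => (0 : U)) = 0 := linearMap_ext_X_pow fun s => by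
      rw [Fin.prod_univ_two, pairing_X_pow, mul_zero, LinearMap.zero_apply]
    rw [this, LinearMap.zero_apply]
  have h1 := hL.commutator (K := K) (K1 := fun _ => 0) hK' 1 (X 1 * F)
  have h2 := hL.commutator (K := K) (K1 := fun _ => 0) hK' 2 F
  rw [pairing_zero_left, hz, zero_sub, zero_sub] at h1 h2
  simp only [Nat.cast_one, one_smul, Nat.sub_self, pow_zero, one_mul, Nat.cast_ofNat,
    Nat.add_one_sub_one, pow_one] at h1 h2
  have h2' : pairing K L (X 0 * ((X 0 - X 1) ^ r * F)) + pairing L K (X 1 * ((X 0 - X 1) ^ r * F)) =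
      0 := by
    have h3 : (2 : ℂ) • (pairing K L (X 0 * ((X 0 - X 1) ^ r * F)) +
        pairing L K (X 1 * ((X 0 - X 1) ^ r * F))) = 0 := by
      rw [← neg_eq_zero, ← h2]
      module
    exact (smul_eq_zero.1 h3).resolve_left two_ne_zero
  have e : (X 0 - X 1 : MvPolynomial (Fin 2) ℂ) ^ (r + 1) * F =
      X 0 * ((X 0 - X 1) ^ r * F) - (X 0 - X 1) ^ r * (X 1 * F) := by ring
  rw [e, map_sub, eq_neg_of_add_eq_zero_left h2']
  rw [show (X 0 - X 1 : MvPolynomial (Fin 2) ℂ) ^ r * (X 1 * F) = X 1 * ((X 0 - X 1) ^ r * F) by ring]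
    at h1 ⊢
  rw [← h1]
  abel

/-- The commutators with K 0, K 1, K 2, weighted by z_1², -2 z_1, 1, form a second difference: the
⟨L, K⟩ terms cancel and the ⟨K, L⟩ terms gain (z_0 - z_1)². What remains is a first-order operator
in z_0, inverted on monomials by induction on the degree in z_0. -/
theorem Annihilates.of_commutator_self (hL : Annihilates L L r) (hr : 3 ≤ r)
    (hK : ∀ c a, K c * L a - L a * K c = ((a : ℂ) - c) • K (a + c - 1)) :
    Annihilates K L (r + 1) := by
  have hK' : ∀ c a, K c * L a - L a * K c =
      (a : ℂ) • K (a + c - 1) - (c : ℂ) • K (a + c - 1) := fun c a => by rw [hK, sub_smul]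
  have key : ∀ q, r ≤ q + 1 → ∀ F, pairing K L ((X 0 - X 1) ^ (q + 2) *
      (C ((q : ℂ) - 1) * F + (X 0 - X 1) * pderiv 0 F)) = 0 := by
    intro q hq F
    have hq' := hL.mono hq
    have h0 := hq'.commutator hK' 0 (X 1 ^ 2 * F)
    have h1 := hq'.commutator hK' 1 (-(X 1 * F) - X 1 * F)
    have h2 := hq'.commutator hK' 2 F
    simp only [← map_smul, ← map_sub] at h0 h1 h2
    have h := congrArg₂ (· + ·) (congrArg₂ (· + ·) h0 h1) h2
    simp only [add_zero] at h
    have e : ∀ A0 A1 A2 B0 B1 B2 : MvPolynomial (Fin 2) ℂ,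
        pairing K L A0 + pairing L K B0 + (pairing K L A1 + pairing L K B1) +
          (pairing K L A2 + pairing L K B2) =
        pairing K L (A0 + A1 + A2) + pairing L K (B0 + B1 + B2) := by
      intros
      simp only [map_add]
      abel
    rw [e] at h
    simp only [pderiv_zero_sub_pow, pderiv_one_sub_pow, smul_eq_C_mul] at h
    have eA : ∀ A B A' : MvPolynomial (Fin 2) ℂ, A = A' → B = 0 →
        pairing K L A + pairing L K B = 0 → pairing K L A' = 0 := by
      rintro A B A' rfl rfl h
      rwa [map_zero, add_zero] at h
    refine eA _ _ _ ?_ ?_ h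
    · simp [Derivation.leibniz, Derivation.leibniz_pow, pderiv_X, C_ofNat]
      ring
    · simp [Derivation.leibniz, Derivation.leibniz_pow, pderiv_X, C_ofNat]
      ring
  have hmon : ∀ a b q, r ≤ q + 1 → pairing K L ((X 0 - X 1) ^ (q + 2) * (X 0 ^ a * X 1 ^ b)) = 0 := by
    intro a b
    induction a with
    | zero =>
      intro q hq
      have h := key q hq (X 0 ^ 0 * X 1 ^ b)
      have e : (X 0 - X 1 : MvPolynomial (Fin 2) ℂ) ^ (q + 2) *
          (C ((q : ℂ) - 1) * (X 0 ^ 0 * X 1 ^ b) + (X 0 - X 1) * pderiv 0 (X 0 ^ 0 * X 1 ^ b)) =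
          ((q : ℂ) - 1) • ((X 0 - X 1) ^ (q + 2) * (X 0 ^ 0 * X 1 ^ b)) := by
        simp [Derivation.leibniz_pow, pderiv_X, smul_eq_C_mul]
        ring
      rw [e, map_smul] at h
      -- The scalar q - 1 is nonzero since 3 ≤ r ≤ q + 1.
      refine (smul_eq_zero.1 h).resolve_left (sub_ne_zero.2 ?_)
      exact_mod_cast (by omega : q ≠ 1)
    | succ a ih =>
      intro q hq
      have h := key q hq (X 0 ^ (a + 1) * X 1 ^ b)
      have e : (X 0 - X 1 : MvPolynomial (Fin 2) ℂ) ^ (q + 2) *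
          (C ((q : ℂ) - 1) * (X 0 ^ (a + 1) * X 1 ^ b) +
            (X 0 - X 1) * pderiv 0 (X 0 ^ (a + 1) * X 1 ^ b)) =
          ((q : ℂ) - 1) • ((X 0 - X 1) ^ (q + 2) * (X 0 ^ (a + 1) * X 1 ^ b)) +
          ((a : ℂ) + 1) • ((X 0 - X 1) ^ (q + 1 + 2) * (X 0 ^ a * X 1 ^ b)) := by
        simp [Derivation.leibniz_pow, pderiv_X, smul_eq_C_mul]
        ring
      rw [e, map_add, map_smul, map_smul, ih (q + 1) (by omega), smul_zero, add_zero] at h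
      refine (smul_eq_zero.1 h).resolve_left (sub_ne_zero.2 ?_)
      exact_mod_cast (by omega : q ≠ 1)
  intro F
  have hlin : pairing K L ∘ₗ LinearMap.mulLeft ℂ ((X 0 - X 1) ^ (r + 1)) = 0 :=
    linearMap_ext_X_pow fun s => by
      have := hmon (s 0) (s 1) (r - 1) (by omega)
      rw [show r - 1 + 2 = r + 1 by omega] at this
      rw [LinearMap.comp_apply, LinearMap.mulLeft_apply, Fin.prod_univ_two, this,
        LinearMap.zero_apply]
  exact LinearMap.congr_fun hlin F

end Pairing

end WittSuper
end

/-! ### Vector fields with coefficients independent of t_j. -/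

noncomputable section

namespace WittSuper

section Vector

variable {m n : ℕ} {i k : ZMod 2}

/-- The even variable `t_j` of `A_{m,n}`. -/
def tVar (m n : ℕ) (j : Fin m) : A m n := MvPolynomial.X j ⊗ₜ[ℂ] 1

theorem tVar_pow (j : Fin m) (a : ℕ) :
    tVar m n j ^ a = MvPolynomial.monomial (Finsupp.single j a) (1 : ℂ) ⊗ₜ[ℂ] 1 := by
  rw [tVar, Algebra.TensorProduct.tmul_pow, one_pow, MvPolynomial.X_pow_eq_monomial]

theorem tVar_pow_mul_comm (j : Fin m) (a : ℕ) (b : A m n) :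
    tVar m n j ^ a * b = b * tVar m n j ^ a := by
  rw [tVar_pow]
  induction b using TensorProduct.induction_on with
  | zero => simp
  | add x y hx hy => rw [mul_add, add_mul, hx, hy]
  | tmul p x =>
    rw [Algebra.TensorProduct.tmul_mul_tmul, Algebra.TensorProduct.tmul_mul_tmul, mul_comm,
      one_mul, mul_one]

theorem tVar_pow_mem (j : Fin m) (a : ℕ) : tVar m n j ^ a ∈ parity m n 0 := by
  rw [tVar_pow]
  exact Submodule.subset_span ⟨_, 1, SetLike.GradedOne.one_mem, rfl⟩

theorem tDeriv_tVar (j : Fin m) : tDeriv m n j (tVar m n j) = 1 := by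
  rw [tVar, tDeriv_tmul, MvPolynomial.pderiv_X_self, Algebra.TensorProduct.one_def]

theorem tDeriv_tVar_of_ne {i j : Fin m} (h : j ≠ i) : tDeriv m n i (tVar m n j) = 0 := by
  rw [tVar, tDeriv_tmul, MvPolynomial.pderiv_X_of_ne h, TensorProduct.zero_tmul]

theorem sgn_zero_right (i : ZMod 2) : sgn i 0 = 1 := by simp [sgn]

theorem sgn_zero_left (i : ZMod 2) : sgn 0 i = 1 := by simp [sgn]

theorem sgn_ne_zero (i k : ZMod 2) : sgn i k ≠ 0 := fun h => by
  simpa [h] using sgn_mul_self i k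

theorem superDer_tVar_pow_mul {D : Module.End ℂ (A m n)} (hD : D ∈ superDer m n i) (j : Fin m)
    (a : ℕ) (b : A m n) :
    D (tVar m n j ^ a * b) =
      (a : ℂ) • (tVar m n j ^ (a - 1) * (D (tVar m n j) * b)) + tVar m n j ^ a * D b := by
  have h1 : ∀ a b, D (tVar m n j ^ a * b) = D (tVar m n j ^ a) * b + tVar m n j ^ a * D b :=
    fun a b => by rw [hD.2 0 _ (tVar_pow_mem j a) b, sgn_zero_right, one_smul]
  rw [h1, ← mul_assoc, ← smul_mul_assoc]
  congr 2
  induction a with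
  | zero =>
    have := h1 0 1
    simpa using this
  | succ a ih =>
    rw [pow_succ, h1, ih]
    rcases a with _ | a
    · simp
    · rw [smul_mul_assoc, mul_assoc, ← pow_one (tVar m n j), ← tVar_pow_mul_comm, ← mul_assoc,
        pow_one, Nat.add_sub_cancel, ← pow_succ, Nat.add_sub_cancel]
      push_cast
      module

theorem fieldMul_add (a : A m n) (x y : W m n) :
    fieldMul a (x + y) = fieldMul a x + fieldMul a y := Subtype.ext (mul_add _ _ _)

theorem fieldMul_smul (a : A m n) (c : ℂ) (x : W m n) :
    fieldMul a (c • x) = c • fieldMul a x := Subtype.ext (mul_smul_comm _ _ _)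

theorem fieldMul_zero (a : A m n) : fieldMul a (0 : W m n) = 0 := Subtype.ext (mul_zero _)

theorem fieldMul_mul (a b : A m n) (x : W m n) : fieldMul (a * b) x = fieldMul a (fieldMul b x) :=
  Subtype.ext (by
    change LinearMap.mulLeft ℂ (a * b) * x.1 = LinearMap.mulLeft ℂ a * (LinearMap.mulLeft ℂ b * x.1)
    rw [LinearMap.mulLeft_mul]
    rfl)

theorem fieldMul_one (x : W m n) : fieldMul 1 x = x := Subtype.ext (by
    change LinearMap.mulLeft ℂ 1 * x.1 = x.1
    rw [LinearMap.mulLeft_one]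
    rfl)

theorem zero_fieldMul (x : W m n) : fieldMul 0 x = 0 := Subtype.ext (by
    change LinearMap.mulLeft ℂ 0 * x.1 = 0
    rw [LinearMap.mulLeft_zero_eq_zero, zero_mul])

theorem fieldMul_apply (a : A m n) (x : W m n) (b : A m n) : (fieldMul a x).1 b = a * x.1 b := rfl

/-- The vector field `y(t_j) x`. -/
def contract (j : Fin m) (y x : W m n) : W m n := fieldMul (y.1 (tVar m n j)) x

/-- The superderivation `x`, homogeneous of parity `i`, has coefficients that do not depend on
`t_j`. -/
structure IsFlat (j : Fin m) (i : ZMod 2) (x : W m n) : Prop where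
  mem : x.1 ∈ superDer m n i
  comm : ∀ b, x.1 (tDeriv m n j b) = tDeriv m n j (x.1 b)

theorem tVar_mem (j : Fin m) : tVar m n j ∈ parity m n 0 := by
  simpa using tVar_pow_mem (n := n) j 1

theorem superDer_one {D : Module.End ℂ (A m n)} (hD : D ∈ superDer m n i) (j : Fin m) :
    D 1 = 0 := by
  have h := hD.2 0 _ (tVar_pow_mem j 0) (tVar m n j ^ 0)
  rw [pow_zero, one_mul, sgn_zero_right, one_smul, mul_one, one_mul] at h
  exact left_eq_add.1 h

theorem tDeriv_mul (j : Fin m) (a b : A m n) :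
    tDeriv m n j (a * b) = tDeriv m n j a * b + a * tDeriv m n j b := by
  have ha : a ∈ parity m n 0 ⊔ parity m n 1 := by rw [parity_sup]; trivial
  obtain ⟨x, hx, y, hy, rfl⟩ := Submodule.mem_sup.1 ha
  rw [add_mul, map_add, map_add, (tDeriv_mem m n j).2 0 x hx, (tDeriv_mem m n j).2 1 y hy,
    sgn_zero_left, sgn_zero_left, one_smul, one_smul, add_mul, add_mul]
  abel

theorem IsFlat.fieldMul {j : Fin m} {x : W m n} (hx : IsFlat j k x) {a : A m n}
    (ha : a ∈ parity m n i) (h : tDeriv m n j a = 0) : IsFlat j (i + k) (fieldMul a x) where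
  mem := mulLeft_mem_superDer ha hx.mem
  comm b := by rw [fieldMul_apply, fieldMul_apply, hx.comm, tDeriv_mul, h, zero_mul, zero_add]

theorem IsFlat.contract {j : Fin m} {x y : W m n} (hy : IsFlat j i y) (hx : IsFlat j k x) :
    IsFlat j (i + 0 + k) (contract j y x) :=
  hx.fieldMul (hy.mem.1 0 _ (tVar_mem j)) (by
    rw [← hy.comm, tDeriv_tVar, superDer_one hy.mem j])

theorem IsFlat.smul {j : Fin m} {x : W m n} (hx : IsFlat j i x) (c : ℂ) : IsFlat j i (c • x) where
  mem := Submodule.smul_mem _ c hx.mem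
  comm b := by
    change c • x.1 _ = tDeriv m n j (c • x.1 b)
    rw [hx.comm, map_smul]

/-- The supercommutator of two flat fields, as an element of `W_{m,n}`. -/
theorem IsFlat.exists_superComm {j : Fin m} {x y : W m n} (hy : IsFlat j i y) (hx : IsFlat j k x) :
    ∃ z : W m n, IsFlat j (i + k) z ∧ z.1 = y.1 * x.1 - sgn i k • (x.1 * y.1) :=
  ⟨⟨_, superDer_le m n _ (superComm_mem hy.mem hx.mem)⟩, ⟨superComm_mem hy.mem hx.mem, fun b => by
    simp only [LinearMap.sub_apply, LinearMap.smul_apply, Module.End.mul_apply, hy.comm, hx.comm,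
      map_sub, map_smul]⟩, rfl⟩

theorem pderiv_comm (i j : Fin m) (p : MvPolynomial (Fin m) ℂ) :
    MvPolynomial.pderiv i (MvPolynomial.pderiv j p) =
      MvPolynomial.pderiv j (MvPolynomial.pderiv i p) := by
  have h : ⁅(MvPolynomial.pderiv i : Derivation ℂ (MvPolynomial (Fin m) ℂ) _),
      MvPolynomial.pderiv j⁆ = 0 := MvPolynomial.derivation_ext fun k => by
    rw [Derivation.commutator_apply]
    simp [MvPolynomial.pderiv_X, Pi.single_apply, apply_ite]
  rw [← sub_eq_zero, ← Derivation.commutator_apply, h, Derivation.zero_apply]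

theorem tDeriv_comm (i j : Fin m) (b : A m n) :
    tDeriv m n i (tDeriv m n j b) = tDeriv m n j (tDeriv m n i b) := by
  induction b using TensorProduct.induction_on with
  | zero => simp
  | add x y hx hy => simp only [map_add, hx, hy]
  | tmul p x => rw [tDeriv_tmul, tDeriv_tmul, tDeriv_tmul, tDeriv_tmul, pderiv_comm]

theorem isFlat_dt (j i : Fin m) : IsFlat j 0 (dt m n i) where
  mem := tDeriv_mem m n i
  comm := tDeriv_comm i j

theorem isFlat_dxi (j : Fin m) (i : Fin n) : IsFlat j 1 (dxi m n i) where
  mem := xiDeriv_mem m n i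
  comm b := by
    change xiDeriv m n i _ = tDeriv m n j (xiDeriv m n i b)
    induction b using TensorProduct.induction_on with
    | zero => simp
    | add x y hx hy => simp only [map_add, hx, hy]
    | tmul p x => rfl

theorem contract_dt_apply (j : Fin m) (y : W m n) :
    (contract j y (dt m n j)).1 (tVar m n j) = y.1 (tVar m n j) := by
  change y.1 (tVar m n j) * tDeriv m n j (tVar m n j) = _
  rw [tDeriv_tVar, mul_one]

theorem contract_dt_left (j : Fin m) (y : W m n) : contract j (dt m n j) y = y := by
  change fieldMul (tDeriv m n j (tVar m n j)) y = y
  rw [tDeriv_tVar, fieldMul_one]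

theorem contract_contract_dt (j : Fin m) (y x : W m n) :
    contract j (contract j y (dt m n j)) x = contract j y x := by
  rw [contract, contract_dt_apply, contract]

end Vector

namespace WittModule

variable {m n : ℕ} {M : Type*} [AddCommGroup M] [Module ℂ M] (ρ : WittModule m n M)
  {i k : ZMod 2} {j : Fin m} {x y : W m n}

theorem act_superComm {z : W m n} (hy : y.1 ∈ superDer m n i) (hx : x.1 ∈ superDer m n k)
    (hz : z.1 = y.1 * x.1 - sgn i k • (x.1 * y.1)) :
    ρ.act y * ρ.act x - sgn i k • (ρ.act x * ρ.act y) = ρ.act z := by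
  ext v
  have := ρ.act_bracket i k ⟨y, hy⟩ ⟨x, hx⟩ v
  have e : (bracket (⟨y, hy⟩ : homog m n i) (⟨x, hx⟩ : homog m n k)).1 = z :=
    Subtype.ext hz.symm
  rw [e] at this
  exact this.symm

/-- The action of `t_j^a x`. -/
def field (j : Fin m) (x : W m n) (a : ℕ) : Module.End ℂ M := ρ.act (fieldMul (tVar m n j ^ a) x)

/-- Each field differentiates the power of t_j in front of the other, and the supercommutator of y
and x remains. Powers of t_j are even and central, so the only sign is that of exchanging x and y.
-/
theorem field_superComm {z : W m n} (hy : y.1 ∈ superDer m n i) (hx : x.1 ∈ superDer m n k)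
    (hz : z.1 = y.1 * x.1 - sgn i k • (x.1 * y.1)) (c a : ℕ) :
    ρ.field j y c * ρ.field j x a - sgn i k • (ρ.field j x a * ρ.field j y c) =
      (a : ℂ) • ρ.field j (contract j y x) (a + c - 1) -
      (c : ℂ) • ρ.field j (sgn i k • contract j x y) (a + c - 1) + ρ.field j z (a + c) := by
  have hy' := mulLeft_mem_superDer (tVar_pow_mem j c) hy
  have hx' := mulLeft_mem_superDer (tVar_pow_mem j a) hx
  rw [zero_add] at hx' hy'
  have h := ρ.act_superComm (y := fieldMul (tVar m n j ^ c) y)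
    (x := fieldMul (tVar m n j ^ a) x) hy' hx' (z := (a : ℂ) • fieldMul (tVar m n j ^ (a + c - 1))
    (contract j y x) + (-(c : ℂ)) • fieldMul (tVar m n j ^ (a + c - 1)) (sgn i k • contract j x y) +
    fieldMul (tVar m n j ^ (a + c)) z) ?_
  · rw [map_add, map_add, map_smul, map_smul, neg_smul, ← sub_eq_add_neg] at h
    exact h
  refine LinearMap.ext fun b => ?_
  change (a : ℂ) • (tVar m n j ^ (a + c - 1) * (y.1 (tVar m n j) * x.1 b)) +
      (-(c : ℂ)) • (tVar m n j ^ (a + c - 1) * (sgn i k • (x.1 (tVar m n j) * y.1 b))) +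
      tVar m n j ^ (a + c) * z.1 b = tVar m n j ^ c * y.1 (tVar m n j ^ a * x.1 b) -
        sgn i k • (tVar m n j ^ a * x.1 (tVar m n j ^ c * y.1 b))
  -- The truncated exponents p - 1 and p + q - 1 match only for p > 0; for p = 0 the scalar
  -- vanishes.
  have key : ∀ (p q : ℕ) (s : ℂ) (u : A m n), (p = 0 → s = 0) →
      s • (tVar m n j ^ (p + q - 1) * u) = s • (tVar m n j ^ q * (tVar m n j ^ (p - 1) * u)) := by
    intro p q s u hs
    rcases p with _ | p
    · rw [hs rfl, zero_smul, zero_smul]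
    · rw [← mul_assoc, ← pow_add, show p + 1 + q - 1 = q + (p + 1 - 1) by omega]
  rw [hz, superDer_tVar_pow_mul hy, superDer_tVar_pow_mul hx,
    key a c _ _ fun h => by rw [h, Nat.cast_zero], add_comm a c,
    key c a _ _ fun h => by rw [h, Nat.cast_zero, neg_zero]]
  simp only [LinearMap.sub_apply, LinearMap.smul_apply, Module.End.mul_apply, mul_add, mul_sub,
    mul_smul_comm, smul_add, ← mul_assoc, ← pow_add, add_comm a c]
  module

theorem field_comm_dt (hy : IsFlat j i y) (c a : ℕ) :
    ρ.field j y c * ρ.field j (dt m n j) a - ρ.field j (dt m n j) a * ρ.field j y c =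
      (a : ℂ) • ρ.field j (contract j y (dt m n j)) (a + c - 1) -
      (c : ℂ) • ρ.field j y (a + c - 1) := by
  have h := ρ.field_superComm (j := j) (z := 0) hy.mem (isFlat_dt j j).mem (by
    rw [sgn_zero_right, one_smul]
    refine LinearMap.ext fun b => ?_
    exact (sub_eq_zero.2 (hy.comm b)).symm) c a
  rw [sgn_zero_right, one_smul, one_smul, contract_dt_left] at h
  rw [h, field, field, field, fieldMul_zero, map_zero, add_zero]

theorem isWitt_field (j : Fin m) : IsWitt (ρ.field j (dt m n j)) := fun a b => by
  rw [field_comm_dt ρ (isFlat_dt j j), contract_dt_left, add_comm b a, sub_smul]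

variable {R : ℕ}

/-- The field x splits into x(t_j) ∂_j, covered by `Annihilates.of_commutator_self`, and a remainder
killing t_j, covered by `Annihilates.of_commutator_zero`. -/
theorem annihilates_dt (hR : 3 ≤ R)
    (h : Annihilates (ρ.field j (dt m n j)) (ρ.field j (dt m n j)) R) (hx : IsFlat j i x) :
    Annihilates (ρ.field j x) (ρ.field j (dt m n j)) (R + 1) := by
  have h1 : Annihilates (ρ.field j (contract j x (dt m n j))) (ρ.field j (dt m n j)) (R + 1) :=
    h.of_commutator_self hR fun c a => by
      rw [ρ.field_comm_dt (hx.contract (isFlat_dt j j)), contract_contract_dt, sub_smul]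
  have h2 : Annihilates (fun a => ρ.field j x a - ρ.field j (contract j x (dt m n j)) a)
      (ρ.field j (dt m n j)) (R + 1) :=
    h.of_commutator_zero fun c a => by
      have e1 := ρ.field_comm_dt hx c a
      have e2 := ρ.field_comm_dt (hx.contract (isFlat_dt j j)) c a
      rw [contract_contract_dt] at e2
      rw [sub_mul, mul_sub, sub_sub_sub_comm, e1, e2]
      module
  intro F
  have := h2 F
  rw [pairing_sub_left, h1, sub_zero] at this
  exact this

-- Commuting t_j^c y through the pairing of x with ∂_j produces pairings with ∂_j on the right, zero
-- by `annihilates_dt`, and two terms with x on the left that must therefore balance.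
open MvPolynomial in
theorem annihilates_flat (hR : 3 ≤ R)
    (h : Annihilates (ρ.field j (dt m n j)) (ρ.field j (dt m n j)) R) (hx : IsFlat j k x)
    (hy : IsFlat j i y) : Annihilates (ρ.field j x) (ρ.field j y) (R + 3) := by
  have step : ∀ {i : ZMod 2} {y : W m n}, IsFlat j i y → ∀ (c : ℕ) (F : MvPolynomial (Fin 2) ℂ),
      pairing (ρ.field j x) (ρ.field j (contract j y (dt m n j)))
        (X 1 ^ c * pderiv 1 ((X 0 - X 1) ^ (R + 2) * F)) =
      (c : ℂ) • pairing (ρ.field j x) (ρ.field j y)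
        (X 1 ^ (c - 1) * ((X 0 - X 1) ^ (R + 2) * F)) := by
    intro i y hy c F
    obtain ⟨z, hz, hz'⟩ := hy.exists_superComm hx
    have e := pairing_commutator (ρ.field_superComm (j := j) hy.mem hx.mem hz' c)
      (ρ.field_comm_dt hy c) ((X 0 - X 1) ^ (R + 2) * F)
    have ann : ∀ {l : ZMod 2} {u : W m n}, IsFlat j l u → ∀ G : MvPolynomial (Fin 2) ℂ,
        pairing (ρ.field j u) (ρ.field j (dt m n j)) ((X 0 - X 1) ^ (R + 1) * G) = 0 :=
      fun hu => ρ.annihilates_dt hR h hu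
    have e1 : ((X 0 - X 1) ^ (R + 2) * F : MvPolynomial (Fin 2) ℂ) =
        (X 0 - X 1) ^ (R + 1) * ((X 0 - X 1) * F) := by ring
    have z1 : pairing (ρ.field j x) (ρ.field j (dt m n j)) ((X 0 - X 1) ^ (R + 2) * F) = 0 := by
      rw [e1, ann hx]
    have z2 : pairing (ρ.field j (contract j y x)) (ρ.field j (dt m n j))
        (X 0 ^ c * pderiv 0 ((X 0 - X 1) ^ (R + 2) * F)) = 0 := by
      rw [pderiv_zero_sub_pow, mul_left_comm, ann (hy.contract hx)]
    have z3 : pairing (ρ.field j (sgn i k • contract j x y)) (ρ.field j (dt m n j))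
        (X 0 ^ (c - 1) * ((X 0 - X 1) ^ (R + 2) * F)) = 0 := by
      rw [e1, mul_left_comm, ann ((hx.contract hy).smul _)]
    have z4 : pairing (ρ.field j z) (ρ.field j (dt m n j))
        (X 0 ^ c * ((X 0 - X 1) ^ (R + 2) * F)) = 0 := by
      rw [e1, mul_left_comm, ann hz]
    rw [z1, z2, z3, z4, mul_zero, zero_mul, smul_zero, smul_zero, sub_zero, zero_add, zero_add] at e
    exact sub_eq_zero.1 ((smul_eq_zero.1 e.symm).resolve_left (sgn_ne_zero _ _))
  -- For the field y(t_j) ∂_j, which contraction reproduces, the balance for c = 0 at z_1 F and for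
  -- c = 1 at F yields twice the pairing.
  have h1 : Annihilates (ρ.field j x) (ρ.field j (contract j y (dt m n j))) (R + 2) := by
    intro F
    have s0 := step (hy.contract (isFlat_dt j j)) 0 (X 1 * F)
    have s1 := step (hy.contract (isFlat_dt j j)) 1 F
    rw [contract_contract_dt] at s0 s1
    have e : pderiv 1 ((X 0 - X 1) ^ (R + 2) * (X 1 * F) : MvPolynomial (Fin 2) ℂ) =
        (X 0 - X 1) ^ (R + 2) * F + X 1 ^ 1 * pderiv 1 ((X 0 - X 1) ^ (R + 2) * F) := by
      rw [mul_left_comm, Derivation.leibniz, pderiv_X_self]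
      simp only [smul_eq_mul]
      ring
    rw [pow_zero, one_mul, e, map_add, s1, Nat.cast_one, one_smul, Nat.sub_self, pow_zero, one_mul,
      Nat.cast_zero, zero_smul] at s0
    rw [← two_smul ℂ] at s0
    exact (smul_eq_zero.1 s0).resolve_left two_ne_zero
  intro F
  -- A derivative lowers the power R + 3 to R + 2, so the term with y(t_j) ∂_j vanishes.
  have s := step hy 1 ((X 0 - X 1) * F)
  rw [← mul_assoc, ← pow_succ, pderiv_one_sub_pow, mul_left_comm, h1, Nat.cast_one, one_smul,
    Nat.sub_self, pow_zero, one_mul] at s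
  exact s.symm

end WittModule

end WittSuper

end

/-! ### Monomial fields, weight spaces and the conclusion. -/

noncomputable section

namespace WittSuper

section Monomial

variable {m n : ℕ}

theorem mono_mem_parity (α : Fin m →₀ ℕ) (I : Finset (Fin n)) :
    ∃ p, (mono α I : A m n) ∈ parity m n p := by
  suffices h : ∀ l : List (Fin n), ∃ p, (l.map (extGen n)).prod ∈ extParity n p by
    obtain ⟨p, hp⟩ := h (I.sort (· ≤ ·))
    exact ⟨p, Submodule.subset_span ⟨_, _, hp, rfl⟩⟩
  intro l
  induction l with
  | nil => exact ⟨0, SetLike.GradedOne.one_mem⟩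
  | cons a l ih =>
    obtain ⟨p, hp⟩ := ih
    rw [List.map_cons, List.prod_cons]
    exact ⟨1 + p, SetLike.mul_mem_graded (ι_mem_extParity _) hp⟩

theorem mono_single (j : Fin m) (a : ℕ) :
    (mono (Finsupp.single j a) ∅ : A m n) = tVar m n j ^ a := by
  rw [mono, Finset.sort_empty, tVar_pow, List.map_nil, List.prod_nil]

theorem euler_eq (j : Fin m) : euler m n j = fieldMul (tVar m n j ^ 1) (dt m n j) := by
  rw [euler, mono_single]

theorem mono_add_single (j : Fin m) (α : Fin m →₀ ℕ) (s : ℕ) (I : Finset (Fin n)) :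
    (mono (α + Finsupp.single j s) I : A m n) = tVar m n j ^ (α j + s) * mono (α.erase j) I := by
  rw [tVar_pow, mono, mono, Algebra.TensorProduct.tmul_mul_tmul, MvPolynomial.monomial_mul,
    one_mul, one_mul, Finsupp.single_add, add_right_comm, Finsupp.single_add_erase]

theorem tDeriv_mono_erase (j : Fin m) (α : Fin m →₀ ℕ) (I : Finset (Fin n)) :
    tDeriv m n j (mono (α.erase j) I) = 0 := by
  rw [mono, tDeriv_tmul, MvPolynomial.pderiv_monomial]
  simp

/-- Erasing the exponent of t_j leaves a homogeneous coefficient free of t_j; the erased power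
becomes the index of `field`. -/
theorem exists_isFlat (j : Fin m) (α : Fin m →₀ ℕ) (I : Finset (Fin n)) {d : W m n}
    (hd : d ∈ Set.range (dt m n) ∪ Set.range (dxi m n)) :
    ∃ p, IsFlat j p (fieldMul (mono (α.erase j) I) d) := by
  obtain ⟨p, hp⟩ := mono_mem_parity (n := n) (α.erase j) I
  rcases hd with ⟨i, rfl⟩ | ⟨i, rfl⟩
  · exact ⟨_, (isFlat_dt j i).fieldMul hp (tDeriv_mono_erase j α I)⟩
  · exact ⟨_, (isFlat_dxi j i).fieldMul hp (tDeriv_mono_erase j α I)⟩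

end Monomial

open MvPolynomial in
theorem pairing_sub_pow_mul {U : Type*} [Ring U] [Algebra ℂ U] (K K' : ℕ → U) (r a b : ℕ) :
    pairing K K' ((X 0 - X 1) ^ r * (X 0 ^ a * X 1 ^ b)) =
      ∑ i ∈ Finset.range (r + 1), ((-1 : ℂ) ^ i * (r.choose i : ℂ)) •
        (K (a + (r - i)) * K' (b + i)) := by
  have e : ((X 0 - X 1) ^ r * (X 0 ^ a * X 1 ^ b) : MvPolynomial (Fin 2) ℂ) =
      ∑ i ∈ Finset.range (r + 1), ((-1 : ℂ) ^ i * (r.choose i : ℂ)) •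
        (X 0 ^ (a + (r - i)) * X 1 ^ (b + i)) := by
    rw [sub_eq_neg_add, add_pow, Finset.sum_mul]
    refine Finset.sum_congr rfl fun i _ => ?_
    rw [smul_eq_C_mul, neg_pow, pow_add, pow_add]
    simp only [map_mul, map_pow, map_neg, map_one, map_natCast]
    ring
  rw [e, map_sum]
  exact Finset.sum_congr rfl fun i _ => by rw [map_smul, pairing_X_pow]

namespace WittModule

universe u

variable {m n : ℕ} {M : Type u} [AddCommGroup M] [Module ℂ M] (ρ : WittModule m n M)

theorem envAct_envι (x : W m n) : ρ.envAct (envι m n x) = ρ.act x := by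
  change RingQuot.liftAlgHom ℂ _ (RingQuot.mkAlgHom ℂ (EnvRel m n) (TensorAlgebra.ι ℂ x)) = _
  rw [RingQuot.liftAlgHom_mkAlgHom_apply, TensorAlgebra.lift_ι_apply]

theorem envAct_w (r : ℕ) (j : Fin m) (d d' : W m n) (α β : Fin m →₀ ℕ) (I J : Finset (Fin n)) :
    ρ.envAct (w r j d d' α β I J) =
      ∑ i ∈ Finset.range (r + 1), ((-1 : ℂ) ^ i * (r.choose i : ℂ)) •
        (ρ.field j (fieldMul (mono (α.erase j) I) d) (α j + (r - i)) *
          ρ.field j (fieldMul (mono (β.erase j) J) d') (β j + i)) := by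
  rw [w, map_sum]
  refine Finset.sum_congr rfl fun i _ => ?_
  rw [map_smul, map_mul, envAct_envι, envAct_envι, mono_add_single, mono_add_single, fieldMul_mul,
    fieldMul_mul, field, field]

theorem field_add (j : Fin m) (x y : W m n) (a : ℕ) :
    ρ.field j (x + y) a = ρ.field j x a + ρ.field j y a := by
  rw [field, fieldMul_add, map_add, field, field]

theorem field_smul (j : Fin m) (c : ℂ) (x : W m n) (a : ℕ) :
    ρ.field j (c • x) a = c • ρ.field j x a := by
  rw [field, fieldMul_smul, map_smul, field]

theorem field_zero (j : Fin m) (a : ℕ) : ρ.field j 0 a = 0 := by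
  rw [field, fieldMul_zero, map_zero]

theorem envAct_w_eq_zero {R : ℕ} {j : Fin m} (hR : 3 ≤ R)
    (h : Annihilates (ρ.field j (dt m n j)) (ρ.field j (dt m n j)) R) {d d' : W m n}
    (hd : d ∈ Delta m n) (hd' : d' ∈ Delta m n) (α β : Fin m →₀ ℕ) (I J : Finset (Fin n)) :
    ρ.envAct (w (R + 3) j d d' α β I J) = 0 := by
  rw [envAct_w]
  induction hd using Submodule.span_induction with
  | mem d hd =>
    induction hd' using Submodule.span_induction with
    | mem d' hd' =>
      obtain ⟨p, hp⟩ := exists_isFlat j α I hd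
      obtain ⟨q, hq⟩ := exists_isFlat j β J hd'
      rw [← pairing_sub_pow_mul]
      exact ρ.annihilates_flat hR h hp hq _
    | zero => simp [fieldMul_zero, field_zero]
    | add x y _ _ hx hy =>
      simp only [fieldMul_add, field_add, mul_add, smul_add, Finset.sum_add_distrib, hx, hy,
        add_zero]
    | smul c x _ hx =>
      simp only [fieldMul_smul, field_smul, mul_smul_comm, smul_comm _ c, ← Finset.smul_sum, hx,
        smul_zero]
  | zero => simp [fieldMul_zero, field_zero]
  | add x y _ _ hx hy =>
    simp only [fieldMul_add, field_add, add_mul, smul_add, Finset.sum_add_distrib, hx, hy,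
      add_zero]
  | smul c x _ hx =>
    simp only [fieldMul_smul, field_smul, smul_mul_assoc, smul_comm _ c, ← Finset.smul_sum, hx,
      smul_zero]

theorem euler_comm_field {i j : Fin m} (h : i ≠ j) (a : ℕ) (v : M) :
    ρ.act (euler m n i) (ρ.field j (dt m n j) a v) =
      ρ.field j (dt m n j) a (ρ.act (euler m n i) v) := by
  have hf : IsFlat j (0 + 0) (euler m n i) := by
    rw [euler_eq]
    refine (isFlat_dt j i).fieldMul (tVar_pow_mem i 1) ?_
    rw [pow_one, tDeriv_tVar_of_ne h]
  have hc : contract j (euler m n i) (dt m n j) = 0 := by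
    have : (euler m n i).1 (tVar m n j) = 0 := by
      change _ * tDeriv m n i (tVar m n j) = 0
      rw [tDeriv_tVar_of_ne h.symm, mul_zero]
    rw [contract, this, zero_fieldMul]
  have e := ρ.field_comm_dt hf 0 a
  rw [hc, field_zero, smul_zero, Nat.cast_zero, zero_smul, sub_zero, sub_eq_zero] at e
  have e0 : ρ.field j (euler m n i) 0 = ρ.act (euler m n i) := by
    rw [field, pow_zero, fieldMul_one]
  rw [e0] at e
  exact LinearMap.congr_fun e v

/-- L 1 is the Euler field of t_j, so its bracket with L a shifts the j-th coordinate of the weight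
by a - 1. The other Euler fields commute with L a. -/
theorem isGraded_weightSpace {N : ℕ}
    (hN : ∀ l : Fin m → ℂ, Module.rank ℂ (ρ.weightSpace l) ≤ (N : Cardinal)) (j : Fin m)
    (l : Fin m → ℂ) :
    IsGraded (ρ.field j (dt m n j)) (fun k => ρ.weightSpace (l + Pi.single j (k : ℂ))) (l j) N where
  witt := ρ.isWitt_field j
  mem a k v hv i := by
    rcases eq_or_ne i j with rfl | h
    · have h1 := hv i
      have e := LinearMap.congr_fun (ρ.isWitt_field i 1 a) v
      rw [euler_eq] at h1 ⊢
      change ρ.field i (dt m n i) 1 (ρ.field i (dt m n i) a v) = _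
      change ρ.field i (dt m n i) 1 v = _ at h1
      simp only [LinearMap.sub_apply, Module.End.mul_apply, LinearMap.smul_apply, h1, map_smul,
        add_comm 1 a, Nat.add_sub_cancel] at e
      rw [sub_eq_iff_eq_add.1 e, ← add_smul]
      congr 1
      simp only [Pi.add_apply, Pi.single_eq_same]
      push_cast
      ring
    · rw [ρ.euler_comm_field h, hv i, map_smul]
      simp [h]
  one k v hv := by
    have h1 := hv j
    rw [euler_eq, Pi.add_apply, Pi.single_eq_same] at h1
    exact h1
  finite k := Module.rank_lt_aleph0_iff.1 ((hN _).trans_lt Cardinal.natCast_lt_aleph0)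
  finrank_le k := Module.finrank_le_of_rank_le (hN _)

/-- Each weight vector sits in degree 0 of the graded module along its own coset, and the exponent
depends only on N, so it serves all cosets at once. -/
theorem annihilates_of_isUniformlyBounded {N R : ℕ}
    (hR : ∀ (M : Type u) [AddCommGroup M] [Module ℂ M] (L : ℕ → Module.End ℂ M)
      (V : ℤ → Submodule ℂ M) (c : ℂ), IsGraded L V c N → ∀ F : MvPolynomial (Fin 2) ℂ,
        (MvPolynomial.X 0 - MvPolynomial.X 1) ^ R * F ∈ wordKer L (⨆ k, V k))
    (hw : ρ.IsWeight) (hN : ∀ l : Fin m → ℂ, Module.rank ℂ (ρ.weightSpace l) ≤ (N : Cardinal))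
    (j : Fin m) : Annihilates (ρ.field j (dt m n j)) (ρ.field j (dt m n j)) R := by
  unfold IsWeight at hw
  intro F
  rw [pairing_self]
  refine LinearMap.ext fun v => ?_
  have hv : v ∈ ⨆ l, ρ.weightSpace l := by
    rw [hw.submodule_iSup_eq_top]
    trivial
  induction hv using Submodule.iSup_induction' with
  | mem l v hv =>
    refine hR M _ _ _ (ρ.isGraded_weightSpace hN j l) F v
      (Submodule.mem_iSup_of_mem 0 ?_)
    simpa using hv
  | zero => rw [map_zero, map_zero]
  | add x y _ _ hx hy => rw [map_add, hx, hy, map_add]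

end WittModule

end WittSuper

end

theorem theorem5p4 {m n : ℕ} {M : Type*} [AddCommGroup M] [Module ℂ M]
    (ρ : WittSuper.WittModule m n M) (hM : ρ.IsUniformlyBounded) :
    ∃ r : ℕ, ∀ (α β : Fin m →₀ ℕ) (I J : Finset (Fin n)) (j : Fin m),
      ∀ d ∈ WittSuper.Delta m n, ∀ d' ∈ WittSuper.Delta m n, ∀ v : M,
        ρ.envAct (WittSuper.w r j d d' α β I J) v = 0 := by
  obtain ⟨hw, N, hN⟩ := hM
  obtain ⟨R, hR4, hR⟩ := WittSuper.exists_uniform_exponent N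
  -- One unit replaces the left ∂_j by an arbitrary flat field, two more replace the right one.
  refine ⟨R + 3, fun α β I J j d hd d' hd' v => ?_⟩
  rw [ρ.envAct_w_eq_zero (by omega) (ρ.annihilates_of_isUniformlyBounded hR hw hN j) hd hd' α β I J,
    LinearMap.zero_apply]
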